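/- Let $V$ be a finite dimensional vector space over a field $\Bbbk$, and let $R:V\otimes V\to V\otimes V$ be a Hecke symmetry with parameter $0\neq q\in\Bbbk$, i.e. a linear operator satisfying the braid equation $(R\otimes\mathrm{Id})(\mathrm{Id}\otimes R)(R\otimes\mathrm{Id})=(\mathrm{Id}\otimes R)(R\otimes\mathrm{Id})(\mathrm{Id}\otimes R)$ and $(R-q\,\mathrm{Id})(R+\mathrm{Id})=0$. On $V^{\otimes m}$ let $T_i=\mathrm{Id}^{\otimes(i-1)}\otimes R\otimes\mathrm{Id}^{\otimes(m-i-1)}$, and for a permutation $\sigma$ let $T_\sigma$ be the product of the $T_i$ along a reduced expression of $\sigma$; let $\ell(\sigma)$ be the length of $\sigma$. Put $\Upsilon^{(m)}=\bigcap_{i=1}^{m-1}(T_i-q)V^{\otimes m}$ (so $\Upsilon^{(0)}=\Bbbk$, $\Upsilon^{(1)}=V$), and let $\Upsilon(V,R)=\bigoplus_m\Upsilon^{(m)}$ be the graded algebra with the multiplication $$a\star b=\sum_{d}(-1)^{\ell(d)}q^{kl-\ell(d)}\,T_d(a\otimes b),\qquad a\in\Upsilon^{(k)},\ b\in\Upsilon^{(l)},$$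 where $d$ runs over the permutations in $\mathfrak S_{k+l}$ that are increasing on $\{1,\dots,k\}$ and on $\{k+1,\dots,k+l\}$. Let $\mathbb S(V,R)^!=\mathbb T(V^*)/\bigl(\operatorname{Im}(R-q\,\mathrm{Id})^\perp\bigr)$ be the quadratic dual of $\mathbb S(V,R)=\mathbb T(V)/\bigl(\operatorname{Im}(R-q\,\mathrm{Id})\bigr)$, where $V^*\otimes V^*$ is paired with $V\otimes V$ by $\langle f\otimes g,v\otimes w\rangle=f(v)g(w)$. Suppose that $\dim\Upsilon^{(n)}=1$ and $\Upsilon^{(n+1)}=0$ for some $n>0$, and fix a nonzero $t\in\Upsilon^{(n)}$. For a graded algebra $A$ with last nonzero component $A_n$, its Nakayama automorphism is the grading-preserving algebra automorphism $\nu$ with $ba=\nu(a)b$ for all $a\in A_k$, $b\in A_{n-k}$, $0\le k\le n$. Then there are uniquely determined linear operators $\varphi,\psi,\theta:V\to V$, all of them invertible, such that * $\varphi$ is the degree $1$ component of the Nakayama automorphism of $\Upsilon(V,R)$; * the dual operator $\psi^*:V^*\to V^*$ is the degree $1$ component of the Nakayama automorphism of $\mathbb S(V,R)^!$; * $T_nT_{n-1}\cdots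 T_1(v\otimes t)=t\otimes\theta(v)$ for all $v\in V$. The operators $\varphi,\psi,\theta$ pairwise commute and $\psi=q^{-n-1}\varphi\,\theta^2$. Moreover, all three lie in the subgroup of $GL(V)$ consisting of all invertible linear operators $\chi:V\to V$ such that $\chi\otimes\chi$ commutes with $R$. -/

import Mathlib

open scoped TensorProduct

namespace HeckeSym

universe u v

variable {k : Type u} [Field k] {V : Type v} [AddCommGroup V] [Module k V]

/-! ### Hecke symmetries -/

/-- `R ⊗ Id` on `(V ⊗ V) ⊗ V`. -/
def onLeft (R : V ⊗[k] V →ₗ[k] V ⊗[k] V) : Module.End k ((V ⊗[k] V) ⊗[k] V) :=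
  R.rTensor V

/-- `Id ⊗ R` on `(V ⊗ V) ⊗ V = V ⊗ (V ⊗ V)`. -/
def onRight (R : V ⊗[k] V →ₗ[k] V ⊗[k] V) : Module.End k ((V ⊗[k] V) ⊗[k] V) :=
  (TensorProduct.assoc k V V V).symm.toLinearMap ∘ₗ R.lTensor V ∘ₗ
    (TensorProduct.assoc k V V V).toLinearMap

/-- A Hecke symmetry on `V` with parameter `q ≠ 0`: a solution of the braid equation with
`(R - q)(R + 1) = 0`. -/
structure IsHeckeSymmetry (q : k) (R : V ⊗[k] V →ₗ[k] V ⊗[k] V) : Prop where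
  q_ne_zero : q ≠ 0
  braid : onLeft R * onRight R * onLeft R = onRight R * onLeft R * onRight R
  hecke : (R - q • LinearMap.id) ∘ₗ (R + LinearMap.id) = 0

/-- The subspace `Im (R - q)` of `V ⊗ V`. -/
def imRq (q : k) (R : V ⊗[k] V →ₗ[k] V ⊗[k] V) : Submodule k (V ⊗[k] V) :=
  LinearMap.range (R - q • LinearMap.id)

/-- The subgroup of `GL(V)` of all invertible `χ` such that `χ ⊗ χ` commutes with `R`. -/
def commutingGL (R : V ⊗[k] V →ₗ[k] V ⊗[k] V) : Subgroup (V ≃ₗ[k] V) where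
  carrier := {χ | TensorProduct.map χ.toLinearMap χ.toLinearMap ∘ₗ R =
    R ∘ₗ TensorProduct.map χ.toLinearMap χ.toLinearMap}
  one_mem' := by
    have h : TensorProduct.map (1 : V ≃ₗ[k] V).toLinearMap (1 : V ≃ₗ[k] V).toLinearMap =
        LinearMap.id := TensorProduct.map_id
    simp only [Set.mem_ofPred_eq, h, LinearMap.id_comp, LinearMap.comp_id]
  mul_mem' := by
    intro a b ha hb
    have h : TensorProduct.map (a * b).toLinearMap (a * b).toLinearMap =
        TensorProduct.map a.toLinearMap a.toLinearMap ∘ₗ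
          TensorProduct.map b.toLinearMap b.toLinearMap :=
      TensorProduct.map_comp _ _ _ _
    simp only [Set.mem_ofPred_eq] at ha hb ⊢
    rw [h, LinearMap.comp_assoc, hb, ← LinearMap.comp_assoc, ha, LinearMap.comp_assoc]
  inv_mem' := by
    intro a ha
    simp only [Set.mem_ofPred_eq] at ha ⊢
    have h1 : TensorProduct.map (a⁻¹).toLinearMap (a⁻¹).toLinearMap ∘ₗ
        TensorProduct.map a.toLinearMap a.toLinearMap = LinearMap.id := by
      rw [← TensorProduct.map_comp]
      have : (a⁻¹).toLinearMap ∘ₗ a.toLinearMap = LinearMap.id := by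
        ext x; exact a.symm_apply_apply x
      rw [this, TensorProduct.map_id]
    have h2 : TensorProduct.map a.toLinearMap a.toLinearMap ∘ₗ
        TensorProduct.map (a⁻¹).toLinearMap (a⁻¹).toLinearMap = LinearMap.id := by
      rw [← TensorProduct.map_comp]
      have : a.toLinearMap ∘ₗ (a⁻¹).toLinearMap = LinearMap.id := by
        ext x; exact a.apply_symm_apply x
      rw [this, TensorProduct.map_id]
    generalize TensorProduct.map (a⁻¹).toLinearMap (a⁻¹).toLinearMap = B at *
    generalize TensorProduct.map a.toLinearMap a.toLinearMap = A at *
    calc B ∘ₗ R = B ∘ₗ R ∘ₗ (A ∘ₗ B) := by rw [h2, LinearMap.comp_id]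
      _ = B ∘ₗ (R ∘ₗ A) ∘ₗ B := by simp only [LinearMap.comp_assoc]
      _ = B ∘ₗ (A ∘ₗ R) ∘ₗ B := by rw [ha]
      _ = (B ∘ₗ A) ∘ₗ R ∘ₗ B := by simp only [LinearMap.comp_assoc]
      _ = R ∘ₗ B := by rw [h1, LinearMap.id_comp]

/-! ### Tensor powers and the action of the Hecke algebras

All tensors live in the tensor algebra `T(V)`; the tensor power `V^{⊗ n}` is its component of
degree `n`, and `a ⊗ b` is the product `a * b`. -/

variable (k V) in
/-- The tensor power `V^{⊗ n}`, as a subspace of `T(V)`. -/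
def tensorPow (n : ℕ) : Submodule k (TensorAlgebra k V) :=
  LinearMap.range (TensorAlgebra.ι k : V →ₗ[k] TensorAlgebra k V) ^ n

/-- For `v ∈ V`, the operator `(w, z) ↦ (v w, v ⊗ w)` on `T(V) × (V ⊗ T(V))`. -/
def splitAux : V →ₗ[k] Module.End k (TensorAlgebra k V × (V ⊗[k] TensorAlgebra k V)) where
  toFun v := LinearMap.prod
    (LinearMap.mulLeft k (TensorAlgebra.ι k v) ∘ₗ LinearMap.fst k _ _)
    (TensorProduct.mk k V (TensorAlgebra k V) v ∘ₗ LinearMap.fst k _ _)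
  map_add' v w := by
    ext x <;> simp [add_mul]
  map_smul' c v := by
    ext x <;> simp [TensorProduct.smul_tmul']

variable (k V) in
/-- The linear map `T(V) → V ⊗ T(V)` splitting off the first letter: `1 ↦ 0`,
`v w ↦ v ⊗ w` (see `splitFirst_one` and `splitFirst_ι_mul`). -/
def splitFirst : TensorAlgebra k V →ₗ[k] V ⊗[k] TensorAlgebra k V where
  toFun x := (TensorAlgebra.lift k splitAux x (1, 0)).2
  map_add' x y := by simp
  map_smul' c x := by simp

theorem splitFirst_one : splitFirst k V 1 = 0 := by
  simp [splitFirst]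

theorem splitFirst_ι_mul (v : V) (w : TensorAlgebra k V) :
    splitFirst k V (TensorAlgebra.ι k v * w) = v ⊗ₜ[k] w := by
  have key : ∀ w : TensorAlgebra k V, ∀ p : TensorAlgebra k V × (V ⊗[k] TensorAlgebra k V),
      (TensorAlgebra.lift k splitAux w p).1 = w * p.1 := by
    intro w
    induction w using TensorAlgebra.induction with
    | algebraMap r => intro p; simp [Module.algebraMap_end_apply, Algebra.smul_def]
    | ι x => intro p; simp [splitAux]
    | mul a b ha hb => intro p; simp [ha, hb, mul_assoc]
    | add a b ha hb => intro p; simp [ha, hb, add_mul]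
  have h : (TensorAlgebra.lift k splitAux w (1, 0)).1 = w := by rw [key, mul_one]
  change (TensorAlgebra.lift k splitAux (TensorAlgebra.ι k v * w) (1, 0)).2 = _
  rw [map_mul, TensorAlgebra.lift_ι_apply, Module.End.mul_apply]
  change v ⊗ₜ[k] (TensorAlgebra.lift k splitAux w (1, 0)).1 = _
  rw [h]

variable (k V) in
/-- The product `V ⊗ T(V) → T(V)`, `v ⊗ w ↦ v w`. -/
def joinFirst : V ⊗[k] TensorAlgebra k V →ₗ[k] TensorAlgebra k V :=
  TensorProduct.lift (LinearMap.mul k (TensorAlgebra k V) ∘ₗ TensorAlgebra.ι k)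

/-- The operator on `T(V)` applying `R` to the letters in the places `i` and `i + 1`, where
places are counted from `0`: `gen R i` acts on `V^{⊗ m}`, `m ≥ i + 2`, as
`Id^{⊗ i} ⊗ R ⊗ Id^{⊗ (m - i - 2)}`. So it is the action of the generator usually written
`T_{i+1}` of the Hecke algebra of type `A`. On `V^{⊗ m}` with `m < i + 2` it is `0`, which plays
no role. -/
def gen (R : V ⊗[k] V →ₗ[k] V ⊗[k] V) : ℕ → Module.End k (TensorAlgebra k V)
  | 0 => joinFirst k V ∘ₗ (joinFirst k V).lTensor V ∘ₗ
      (TensorProduct.assoc k V V (TensorAlgebra k V)).toLinearMap ∘ₗ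
      R.rTensor (TensorAlgebra k V) ∘ₗ
      (TensorProduct.assoc k V V (TensorAlgebra k V)).symm.toLinearMap ∘ₗ
      (splitFirst k V).lTensor V ∘ₗ splitFirst k V
  | i + 1 => joinFirst k V ∘ₗ (gen R i).lTensor V ∘ₗ splitFirst k V

theorem gen_zero_apply (R : V ⊗[k] V →ₗ[k] V ⊗[k] V) (x y : V) (w : TensorAlgebra k V) :
    gen R 0 (TensorAlgebra.ι k x * (TensorAlgebra.ι k y * w)) =
      LinearMap.mul' k (TensorAlgebra k V)
        (TensorProduct.map (TensorAlgebra.ι k) (TensorAlgebra.ι k) (R (x ⊗ₜ[k] y))) * w := by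
  simp only [gen, LinearMap.comp_apply, splitFirst_ι_mul, LinearMap.lTensor_tmul,
    LinearEquiv.coe_coe, TensorProduct.assoc_symm_tmul, LinearMap.rTensor_tmul]
  induction R (x ⊗ₜ[k] y) using TensorProduct.induction_on with
  | zero => simp
  | tmul a b => simp [joinFirst, mul_assoc]
  | add a b ha hb => simp only [TensorProduct.add_tmul, map_add, ha, hb, add_mul]

theorem gen_succ_apply (R : V ⊗[k] V →ₗ[k] V ⊗[k] V) (i : ℕ) (v : V)
    (w : TensorAlgebra k V) :
    gen R (i + 1) (TensorAlgebra.ι k v * w) = TensorAlgebra.ι k v * gen R i w := by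
  simp [gen, splitFirst_ι_mul, joinFirst]

/-- The action of the element `T_{i+m-1} ⋯ T_{i+1} T_i` (the rightmost factor acts first), that
is, of the Hecke algebra element of the cycle moving the place `i` to the place `i + m` and each
of the places `i + 1, …, i + m` one step to the left. -/
def cyc (R : V ⊗[k] V →ₗ[k] V ⊗[k] V) (i : ℕ) : ℕ → Module.End k (TensorAlgebra k V)
  | 0 => 1
  | m + 1 => gen R (i + m) * cyc R i m

/-- The length of a permutation: its number of inversions. -/
def len {n : ℕ} (σ : Equiv.Perm (Fin n)) : ℕ :=
  (Finset.univ.filter fun p : Fin n × Fin n => p.1 < p.2 ∧ σ p.2 < σ p.1).card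

/-- The Lehmer code `c_i = #{j > i | σ j < σ i}` of a permutation. -/
def lehmer {n : ℕ} (σ : Equiv.Perm (Fin n)) (i : Fin n) : ℕ :=
  (Finset.univ.filter fun j : Fin n => i < j ∧ σ j < σ i).card

/-- The action of the standard basis element `T_σ` of the Hecke algebra on tensors, i.e. the
product of the generators along a reduced expression of `σ`. The reduced expression used is
`σ = γ_0 γ_1 ⋯ γ_{n-1}`, where `γ_i` is the cycle sending `i` to `i + c_i` and each of
`i + 1, …, i + c_i` one step down, with `c` the Lehmer code of `σ`; `γ_i` has length `c_i`, and
the sum of all `c_i` is the length of `σ`. -/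
def heckeT (R : V ⊗[k] V →ₗ[k] V ⊗[k] V) {n : ℕ} (σ : Equiv.Perm (Fin n)) :
    Module.End k (TensorAlgebra k V) :=
  (List.ofFn fun i : Fin n => cyc R i (lehmer σ i)).prod

/-- The distinguished (minimal length) representatives of the cosets `S_{a+b} / (S_a × S_b)`:
permutations that are increasing on the first `a` and on the last `b` places. -/
def shuffles (a b : ℕ) : Finset (Equiv.Perm (Fin (a + b))) :=
  Finset.univ.filter fun d =>
    ∀ i j : Fin (a + b), i < j → ((j : ℕ) < a ∨ a ≤ (i : ℕ)) → d i < d j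

/-- The action on tensors of the partial antisymmetrizer
`∑_d (-1)^{ℓ(d)} q^{a b - ℓ(d)} T_d`, the sum over the distinguished representatives `d` of
`S_{a+b} / (S_a × S_b)`. -/
def antisym (q : k) (R : V ⊗[k] V →ₗ[k] V ⊗[k] V) (a b : ℕ) :
    Module.End k (TensorAlgebra k V) :=
  ∑ d ∈ shuffles a b, ((-1) ^ len d * q ^ (a * b - len d) : k) • heckeT R d

/-! ### The algebra `Υ(V, R)` -/

/-- The component `Υ^{(n)} = ⋂_i (T_i - q) V^{⊗ n}`; so `Υ^{(0)} = k`, `Υ^{(1)} = V`,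
`Υ^{(2)} = Im (R - q)`. -/
def Upsilon (q : k) (R : V ⊗[k] V →ₗ[k] V ⊗[k] V) (n : ℕ) :
    Submodule k (TensorAlgebra k V) :=
  tensorPow k V n ⊓ ⨅ i : ℕ, ⨅ _ : i + 1 < n,
    (tensorPow k V n).map (gen R i - q • LinearMap.id)

/-- The product `x ⋆ y` in `Υ(V, R)` of `x` of degree `a` and `y` of degree `b`. -/
def star (q : k) (R : V ⊗[k] V →ₗ[k] V ⊗[k] V) (a b : ℕ) (x y : TensorAlgebra k V) :
    TensorAlgebra k V :=
  antisym q R a b (x * y)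

theorem one_mem_Upsilon (q : k) (R : V ⊗[k] V →ₗ[k] V ⊗[k] V) :
    (1 : TensorAlgebra k V) ∈ Upsilon q R 0 := by
  simp [Upsilon, tensorPow]

theorem ι_mem_Upsilon (q : k) (R : V ⊗[k] V →ₗ[k] V ⊗[k] V) (v : V) :
    TensorAlgebra.ι k v ∈ Upsilon q R 1 := by
  simp [Upsilon, tensorPow]

/-- `ν` is the Nakayama automorphism of the graded algebra `Υ(V, R) = ⨁ Υ^{(j)}` with last
nonzero component `Υ^{(n)}`: a unital multiplicative family of linear automorphisms of the
components, such that `y ⋆ x = ν(x) ⋆ y` for `x`, `y` of complementary degrees. -/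
structure IsNakayamaUpsilon (q : k) (R : V ⊗[k] V →ₗ[k] V ⊗[k] V) (n : ℕ)
    (ν : ∀ j : ℕ, Upsilon q R j ≃ₗ[k] Upsilon q R j) : Prop where
  top_ne_bot : Upsilon q R n ≠ ⊥
  above_top : ∀ m, n < m → Upsilon q R m = ⊥
  map_one : (ν 0 ⟨1, one_mem_Upsilon q R⟩ : TensorAlgebra k V) = 1
  map_mul : ∀ (a b : ℕ) (x : Upsilon q R a) (y : Upsilon q R b),
    ∃ z : Upsilon q R (a + b), (z : TensorAlgebra k V) = star q R a b x y ∧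
      (ν (a + b) z : TensorAlgebra k V) = star q R a b (ν a x) (ν b y)
  twist : ∀ (a b : ℕ), a + b = n → ∀ (x : Upsilon q R a) (y : Upsilon q R b),
    star q R b a y x = star q R a b (ν a x) y

/-- `φ` is the degree `1` component of the Nakayama automorphism of `Υ(V, R)`. -/
def IsPhi (q : k) (R : V ⊗[k] V →ₗ[k] V ⊗[k] V) (n : ℕ) (φ : V →ₗ[k] V) : Prop :=
  ∃ ν : ∀ j : ℕ, Upsilon q R j ≃ₗ[k] Upsilon q R j, IsNakayamaUpsilon q R n ν ∧
    ∀ v : V, (ν 1 ⟨TensorAlgebra.ι k v, ι_mem_Upsilon q R v⟩ : TensorAlgebra k V) =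
      TensorAlgebra.ι k (φ v)

/-! ### Quadratic algebras, the quadratic dual of `S(V, R)` -/

/-- The relations `x = 0`, `x ∈ W`, in the tensor algebra, for a subspace `W` of `V ⊗ V`. -/
def quadRel (W : Submodule k (V ⊗[k] V)) (x y : TensorAlgebra k V) : Prop :=
  y = 0 ∧ ∃ w ∈ W, x = LinearMap.mul' k (TensorAlgebra k V)
    (TensorProduct.map (TensorAlgebra.ι k) (TensorAlgebra.ι k) w)

/-- The quadratic algebra `T(V) / (W)` of a subspace `W` of `V ⊗ V`. -/
abbrev QuadAlg (W : Submodule k (V ⊗[k] V)) : Type (max u v) :=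
  RingQuot (quadRel W)

/-- The canonical map from `V` to a quadratic algebra `T(V) / (W)`. -/
def QuadAlg.ι (W : Submodule k (V ⊗[k] V)) : V →ₗ[k] QuadAlg W :=
  (RingQuot.mkAlgHom k (quadRel W)).toLinearMap ∘ₗ TensorAlgebra.ι k

/-- The homogeneous component of degree `j` of a quadratic algebra `T(V) / (W)`. -/
def QuadAlg.component (W : Submodule k (V ⊗[k] V)) (j : ℕ) : Submodule k (QuadAlg W) :=
  LinearMap.range (QuadAlg.ι W) ^ j

/-- The annihilator of `W ⊆ V ⊗ V` in `V* ⊗ V*` under `⟨f ⊗ g, v ⊗ w⟩ = f(v) g(w)`. -/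
def quadPerp (W : Submodule k (V ⊗[k] V)) :
    Submodule k (Module.Dual k V ⊗[k] Module.Dual k V) :=
  W.dualAnnihilator.comap (TensorProduct.dualDistrib k V V)

/-- The `R`-symmetric algebra `S(V, R) = T(V) / (Im (R - q))`. -/
abbrev SymAlg (q : k) (R : V ⊗[k] V →ₗ[k] V ⊗[k] V) := QuadAlg (imRq q R)

/-- The quadratic dual `S(V, R)^! = T(V*) / (Im (R - q)^⊥)` of the algebra `S(V, R)`. -/
abbrev SymDual (q : k) (R : V ⊗[k] V →ₗ[k] V ⊗[k] V) := QuadAlg (quadPerp (imRq q R))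

/-- `ν` is the Nakayama automorphism of the algebra `A` with grading `𝒜` and last nonzero
component `𝒜 n`: it preserves the grading and `b a = ν(a) b` for `a`, `b` of complementary
degrees. -/
structure IsNakayama {A : Type*} [Ring A] [Algebra k A] (𝒜 : ℕ → Submodule k A) (n : ℕ)
    (ν : A ≃ₐ[k] A) : Prop where
  top_ne_bot : 𝒜 n ≠ ⊥
  above_top : ∀ m, n < m → 𝒜 m = ⊥
  map_mem : ∀ j, ∀ a ∈ 𝒜 j, ν a ∈ 𝒜 j
  twist : ∀ i j : ℕ, i + j = n → ∀ a ∈ 𝒜 i, ∀ b ∈ 𝒜 j, b * a = ν a * b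

/-- `ψ` is the operator on `V` whose dual `ψ* : V* → V*` is the degree `1` component of the
Nakayama automorphism of `S(V, R)^!`. -/
def IsPsi (q : k) (R : V ⊗[k] V →ₗ[k] V ⊗[k] V) (n : ℕ) (ψ : V →ₗ[k] V) : Prop :=
  ∃ ν : SymDual q R ≃ₐ[k] SymDual q R,
    IsNakayama (QuadAlg.component (quadPerp (imRq q R))) n ν ∧
    ∀ f : Module.Dual k V,
      ν (QuadAlg.ι (quadPerp (imRq q R)) f) = QuadAlg.ι (quadPerp (imRq q R)) (ψ.dualMap f)

/-! ### The braiding operator -/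

/-- `θ` is the operator with `T_n T_{n-1} ⋯ T_1 (v ⊗ t) = t ⊗ θ(v)` for all `v ∈ V`, where `t`
is a tensor of degree `n`. -/
def IsTheta (R : V ⊗[k] V →ₗ[k] V ⊗[k] V) (n : ℕ) (t : TensorAlgebra k V)
    (θ : V →ₗ[k] V) : Prop :=
  ∀ v : V, cyc R 0 n (TensorAlgebra.ι k v * t) = t * TensorAlgebra.ι k (θ v)

end HeckeSym

/-! Write `T_i` for `gen R i`, with places counted from 0, and let `t` span the top component of Υ.
All three operators come from moving letters past `t`.

Braiding. The crossing `T_{n-1} ⋯ T_0` turns the operator `T_{j+1}` into `T_j`, so it carries V ⊗ t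
into Υ^(n) ⊗ V = t ⊗ V. This defines θ (`IsVolume.exists_theta`), and sliding a crossing of two
strands past `t` shows that θ ⊗ θ commutes with `R` (`IsVolume.theta_comm`). By the Hecke relation,
the double crossing of `v` and `t` is q^(n+1) minus a multiple of v ⋆ t. Since v ⋆ t lies in Υ^(n+1)
= 0, the crossing `T_0 ⋯ T_{n-1}` sends t ⊗ v to θ'(v) ⊗ t with θ' = q^(n+1) θ⁻¹
(`IsVolume.rcycle_mul_ι`).

Frobenius property. For u in Υ^(m) the product u ⋆ t vanishes. Descending from this through the
recursion of the antisymmetrizers gives c t ⊗ θ(u) when u is mixed with only the first n − m letters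
of `t`, for an explicit scalar c ≠ 0, and c θ'(u) ⊗ t in the mirror situation
(`IsVolume.asym_mul_right`, `IsVolume.asym_mul_left`). Contracting the untouched letters with G
yields u ⋆ (t ⌞ G) = c G(θu) t and (G ⌟ t) ⋆ u = c G(θ'u) t. Hence the pairing Υ^(m) × Υ^(n-m) →
Υ^(n) is nondegenerate, every skew tensor of degree at most n is a contraction of `t`, and there is
an invertible ψ with t ⌞ f = (f ∘ ψ) ⌟ t (`IsVolume.exists_psi`).

Nakayama automorphisms. Comparing the two formulas gives w ⋆ u = φ(u) ⋆ w with φ = θ⁻¹ψθ'. As ψ and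
θ commute, this is the identity ψ = q^(-n-1) φθ². Nondegeneracy and associativity show that φ ⊗ φ
commutes with `R` (`IsVolume.phi_comm`), and ψ inherits this from φ and θ. On the dual side, the
degree m component of the quadratic dual is the dual space of Υ^(m) (`symDualMk_eq_zero`,
`ctrL_eq_of_symDualMk_eq`), and the defining property of ψ becomes the Nakayama twist there.

Only q ≠ 0 is ever inverted, never a quantum factorial, so the argument covers roots of unity. -/

namespace HeckeSym

/-! ### Cycles and partial antisymmetrizers built from braid relations -/

section BraidSequences

variable {k : Type*} [Field k] {A : Type*} [Ring A] [Algebra k A]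

/-- A sequence of elements satisfying the braid relations of type `A`. -/
structure IsBraidSeq (T : ℕ → A) : Prop where
  comm : ∀ i j, i + 2 ≤ j → T i * T j = T j * T i
  braid : ∀ i, T i * T (i + 1) * T i = T (i + 1) * T i * T (i + 1)

/-- The product `T_{i+m-1} ⋯ T_{i+1} T_i`. -/
def cycle (T : ℕ → A) (i : ℕ) : ℕ → A
  | 0 => 1
  | m + 1 => T (i + m) * cycle T i m

/-- The product `T_i T_{i+1} ⋯ T_{i+m-1}`. -/
def rcycle (T : ℕ → A) (i : ℕ) : ℕ → A
  | 0 => 1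
  | m + 1 => rcycle T i m * T (i + m)

@[simp] theorem cycle_zero (T : ℕ → A) (i : ℕ) : cycle T i 0 = 1 := rfl

@[simp] theorem rcycle_zero (T : ℕ → A) (i : ℕ) : rcycle T i 0 = 1 := rfl

theorem cycle_succ (T : ℕ → A) (i m : ℕ) : cycle T i (m + 1) = T (i + m) * cycle T i m := rfl

theorem rcycle_succ (T : ℕ → A) (i m : ℕ) : rcycle T i (m + 1) = rcycle T i m * T (i + m) := rfl

theorem cycle_add (T : ℕ → A) (i m n : ℕ) :
    cycle T i (m + n) = cycle T (i + m) n * cycle T i m := by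
  induction n with
  | zero => simp
  | succ n ih => rw [← add_assoc, cycle_succ, ih, cycle_succ, mul_assoc, add_assoc]

theorem rcycle_add (T : ℕ → A) (i m n : ℕ) :
    rcycle T i (m + n) = rcycle T i m * rcycle T (i + m) n := by
  induction n with
  | zero => simp
  | succ n ih => rw [← add_assoc, rcycle_succ, ih, rcycle_succ, mul_assoc, add_assoc]

theorem cycle_one (T : ℕ → A) (i : ℕ) : cycle T i 1 = T i := by simp [cycle_succ]

theorem rcycle_one (T : ℕ → A) (i : ℕ) : rcycle T i 1 = T i := by simp [rcycle_succ]

theorem commute_cycle {T : ℕ → A} {X : A} {i m : ℕ} (h : ∀ j < m, Commute X (T (i + j))) :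
    Commute X (cycle T i m) := by
  induction m with
  | zero => simp
  | succ m ih =>
    exact (h m (by omega)).mul_right (ih fun j hj => h j (by omega))

theorem commute_rcycle {T : ℕ → A} {X : A} {i m : ℕ} (h : ∀ j < m, Commute X (T (i + j))) :
    Commute X (rcycle T i m) := by
  induction m with
  | zero => simp
  | succ m ih =>
    exact (ih fun j hj => h j (by omega)).mul_right (h m (by omega))

theorem IsBraidSeq.commute {T : ℕ → A} (hT : IsBraidSeq T) {i j : ℕ}
    (h : i + 2 ≤ j ∨ j + 2 ≤ i) : Commute (T i) (T j) := by
  rcases h with h | h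
  · exact hT.comm i j h
  · exact (hT.comm j i h).symm

/-- Passing to the opposite algebra exchanges `cycle` and `rcycle`, so an identity for one yields
the mirror identity for the other. -/
theorem IsBraidSeq.op {T : ℕ → A} (hT : IsBraidSeq T) :
    IsBraidSeq fun i => MulOpposite.op (T i) where
  comm i j h := by
    rw [← MulOpposite.op_mul, ← MulOpposite.op_mul, hT.comm i j h]
  braid i := by
    simp only [← MulOpposite.op_mul]
    congr 1
    simpa only [mul_assoc] using hT.braid i

theorem op_rcycle (T : ℕ → A) (i m : ℕ) :
    MulOpposite.op (rcycle T i m) = cycle (fun i => MulOpposite.op (T i)) i m := by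
  induction m with
  | zero => rfl
  | succ m ih => rw [rcycle_succ, MulOpposite.op_mul, ih, cycle_succ]

/-- The new factor commutes with the lower factors of the cycle, loses 1 in its index by one braid
relation, and then commutes with the higher factors. So a cycle shifts the generators inside its
range down by one place. -/
theorem IsBraidSeq.cycle_mul {T : ℕ → A} (hT : IsBraidSeq T) {i j m : ℕ} (hj : j + 1 < m) :
    cycle T i m * T (i + j + 1) = T (i + j) * cycle T i m := by
  induction m with
  | zero => omega
  | succ m ih =>
    rcases Nat.lt_or_ge (j + 1) m with h | h
    · rw [cycle_succ, mul_assoc, ih h, ← mul_assoc, ← mul_assoc,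
        (hT.commute (i := i + m) (j := i + j) (by omega)).eq]
    · obtain rfl : m = j + 1 := by omega
      have hc : Commute (T (i + j + 1)) (cycle T i j) :=
        commute_cycle fun l hl => hT.commute (by omega)
      rw [cycle_succ, cycle_succ, ← add_assoc, mul_assoc, mul_assoc, ← hc.eq, ← mul_assoc,
        ← mul_assoc, ← hT.braid]
      simp only [mul_assoc]

theorem IsBraidSeq.mul_rcycle {T : ℕ → A} (hT : IsBraidSeq T) {i j m : ℕ} (hj : j + 1 < m) :
    T (i + j + 1) * rcycle T i m = rcycle T i m * T (i + j) := by
  apply MulOpposite.op_injective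
  rw [MulOpposite.op_mul, MulOpposite.op_mul, op_rcycle]
  exact hT.op.cycle_mul hj

/-- Two adjacent strands may cross before or after both of them cross a bunch of `b` strands. -/
theorem IsBraidSeq.mul_cycle_mul_cycle {T : ℕ → A} (hT : IsBraidSeq T) (i b : ℕ) :
    T (i + b) * (cycle T i b * cycle T (i + 1) b) =
      cycle T i b * cycle T (i + 1) b * T i := by
  -- The full cycle lowers the second one by a place. For `c = b` its top factor is the crossing on
  -- the left, and splitting off its lowest factor `T i` leaves the right-hand side.
  have key : ∀ c ≤ b, cycle T i (b + 1) * cycle T (i + 1) c = cycle T i c * cycle T i (b + 1) := by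
    intro c hc
    induction c with
    | zero => simp
    | succ c ih =>
      have h := hT.cycle_mul (i := i) (j := c) (m := b + 1) (by omega)
      have hs : cycle T (i + 1) (c + 1) = T (i + c + 1) * cycle T (i + 1) c := by
        rw [cycle_succ, add_right_comm]
      rw [hs, ← mul_assoc, h, mul_assoc, ih (by omega), ← mul_assoc, ← cycle_succ]
  rw [← mul_assoc, ← cycle_succ, key b le_rfl, add_comm b 1, cycle_add, cycle_one, mul_assoc]

/-- The partial antisymmetrizer attached to the places `s, …, s + a + b - 1`, cut into blocks of
`a` and `b` places. -/
def asym (q : k) (T : ℕ → A) (s : ℕ) : ℕ → ℕ → A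
  | 0, _ => 1
  | _ + 1, 0 => 1
  | a + 1, b + 1 => q ^ (a + 1) • asym q T s (a + 1) b +
      (-1 : k) ^ (b + 1) • (asym q T s a (b + 1) * cycle T (s + a) (b + 1))
termination_by a b => a + b

variable (q : k) (T : ℕ → A)

@[simp] theorem asym_zero_left (s b : ℕ) : asym q T s 0 b = 1 := by simp [asym]

@[simp] theorem asym_zero_right (s a : ℕ) : asym q T s a 0 = 1 := by cases a <;> simp [asym]

/-- The summands separate the shuffles that fix the last place from those that bring the last letter
of the first block there. The power of `q` makes up for the exponent `a * b - ℓ(d)`, and the cycle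
has length `b + 1`. -/
theorem asym_succ_succ (s a b : ℕ) :
    asym q T s (a + 1) (b + 1) = q ^ (a + 1) • asym q T s (a + 1) b +
      (-1 : k) ^ (b + 1) • (asym q T s a (b + 1) * cycle T (s + a) (b + 1)) := by
  rw [asym]

theorem cycle_semiconj {T : ℕ → A} {X : A} {s s' m : ℕ}
    (h : ∀ j < m, SemiconjBy X (T (s + j)) (T (s' + j))) :
    SemiconjBy X (cycle T s m) (cycle T s' m) := by
  induction m with
  | zero => simp
  | succ m ih => exact (h m (by omega)).mul_right (ih fun j hj => h j (by omega))

theorem asym_semiconj {T : ℕ → A} {X : A} {s s' : ℕ} (a b : ℕ)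
    (h : ∀ j, j + 1 < a + b → SemiconjBy X (T (s + j)) (T (s' + j))) :
    SemiconjBy X (asym q T s a b) (asym q T s' a b) := by
  induction a generalizing b with
  | zero => simp
  | succ a iha =>
    induction b with
    | zero => simp
    | succ b ihb =>
      rw [asym_succ_succ, asym_succ_succ]
      have h1 := ihb fun j hj => h j (by omega)
      have h2 := (iha (b + 1) fun j hj => h j (by omega)).mul_right
        (cycle_semiconj (T := T) (s := s + a) (s' := s' + a) (m := b + 1) fun j hj => by
          rw [add_assoc, add_assoc]
          exact h _ (by omega))
      simp only [SemiconjBy, mul_add, add_mul, mul_smul_comm, smul_mul_assoc] at h1 h2 ⊢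
      rw [h1, h2]

theorem asym_commute {T : ℕ → A} {X : A} {s : ℕ} (a b : ℕ)
    (h : ∀ j, j + 1 < a + b → Commute X (T (s + j))) : Commute X (asym q T s a b) :=
  asym_semiconj q a b h

/-- The recursion seen from the first place, which is either fixed or filled by the first letter of
the second block. It complements `asym_succ_succ`, whose smaller antisymmetrizers do not involve the
last place. -/
theorem asym_mirror {T : ℕ → A} (hT : IsBraidSeq T) (s a b : ℕ) :
    asym q T s (a + 1) (b + 1) = q ^ (b + 1) • asym q T (s + 1) a (b + 1) +
      (-1 : k) ^ (a + 1) • (asym q T (s + 1) (a + 1) b * rcycle T s (a + 1)) := by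
  induction a generalizing b with
  | zero =>
    induction b with
    | zero => simp [asym_succ_succ, cycle_one, rcycle_one]
    | succ b ihb =>
      rw [asym_succ_succ, ihb, asym_succ_succ]
      have h : cycle T (s + 1) (b + 1) * T s = cycle T s (b + 1 + 1) := by
        rw [show b + 1 + 1 = 1 + (b + 1) by omega, cycle_add T s 1, cycle_one]
      simp only [asym_zero_left, one_mul, zero_add, pow_one, rcycle_one, add_zero, add_mul,
        smul_mul_assoc, h]
      module
  | succ a iha =>
    induction b with
    | zero =>
      rw [asym_succ_succ, iha, asym_succ_succ]
      have e : s + 1 + a = s + (a + 1) := by omega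
      simp only [asym_zero_right, one_mul, zero_add, pow_one, add_mul, cycle_one,
        rcycle_succ T s (a + 1), smul_mul_assoc, e]
      module
    | succ b ihb =>
      have h : rcycle T s (a + 1) * cycle T (s + (a + 1)) (b + 1 + 1) =
          cycle T (s + 1 + (a + 1)) (b + 1) * rcycle T s (a + 1 + 1) := by
        have hc : Commute (rcycle T s (a + 1)) (cycle T (s + (a + 1) + 1) (b + 1)) :=
          commute_cycle fun j hj => (commute_rcycle fun l hl => hT.commute (by omega)).symm
        rw [add_comm (b + 1) 1, cycle_add, cycle_one, ← mul_assoc, hc.eq, rcycle_succ _ _ (a + 1),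
          mul_assoc, add_right_comm]
      have e : s + 1 + a = s + (a + 1) := by omega
      rw [asym_succ_succ, ihb, iha, asym_succ_succ q T (s + 1) a (b + 1),
        asym_succ_succ q T (s + 1) (a + 1) b]
      simp only [add_mul, smul_mul_assoc, mul_assoc, h, e]
      module

/-- Both sides sum over the shuffles of three blocks, factored in two ways. The induction sorts
these shuffles by the block that supplies the letter in the last place. This is the source of the
associativity of ⋆. -/
theorem asym_assoc {T : ℕ → A} (hT : IsBraidSeq T) (s a b c : ℕ) :
    asym q T s (a + b) c * asym q T s a b = asym q T s a (b + c) * asym q T (s + a) b c := by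
  obtain ⟨N, hN⟩ : ∃ N, a + b + c = N := ⟨_, rfl⟩
  induction N using Nat.strong_induction_on generalizing a b c with
  | _ N ih =>
    subst hN
    rcases a with _ | a
    · simp
    rcases b with _ | b
    · simp
    rcases c with _ | c
    · simp
    have h1 := ih _ (by omega) (a + 1) (b + 1) c rfl
    have h2 := ih _ (by omega) (a + 1) b (c + 1) rfl
    have h3 := ih _ (by omega) a (b + 1) (c + 1) rfl
    have e1 : a + 1 + (b + 1) = (a + 1 + b) + 1 := by omega
    have e2 : b + 1 + (c + 1) = (b + 1 + c) + 1 := by omega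
    have c1 : Commute (cycle T (s + (a + 1 + b)) (c + 1)) (asym q T s (a + 1) b) :=
      asym_commute q _ _ fun j hj => (commute_cycle fun l hl => hT.commute (by omega)).symm
    have c2 : Commute (cycle T (s + (a + 1 + b)) (c + 1)) (asym q T s a (b + 1)) :=
      asym_commute q _ _ fun j hj => (commute_cycle fun l hl => hT.commute (by omega)).symm
    have c3 : cycle T (s + (a + 1 + b)) (c + 1) * cycle T (s + a) (b + 1) =
        cycle T (s + a) (b + 1 + c + 1) := by
      rw [add_assoc (b + 1), cycle_add T (s + a) (b + 1)]
      congr 2; omega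
    have c4 : cycle T (s + a) (b + 1 + c + 1) * asym q T (s + (a + 1)) (b + 1) (c + 1) =
        asym q T (s + a) (b + 1) (c + 1) * cycle T (s + a) (b + 1 + c + 1) :=
      asym_semiconj q _ _ fun j hj => by
        have h := hT.cycle_mul (i := s + a) (j := j) (m := b + 1 + c + 1) (by omega)
        rwa [show s + a + j + 1 = s + (a + 1) + j by omega] at h
    -- The three summands, here and in `l2`, have the last letter of the third, second and first
    -- block respectively in the last place.
    have l1 : asym q T s (a + 1 + (b + 1)) (c + 1) * asym q T s (a + 1) (b + 1) =
        q ^ (a + 1 + b + 1) • (asym q T s (a + 1 + (b + 1)) c * asym q T s (a + 1) (b + 1)) +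
        (-1 : k) ^ (c + 1) • q ^ (a + 1) • (asym q T s (a + 1 + b) (c + 1) * asym q T s (a + 1) b *
          cycle T (s + (a + 1 + b)) (c + 1)) +
        (-1 : k) ^ (b + 1 + (c + 1)) • (asym q T s (a + (b + 1)) (c + 1) * asym q T s a (b + 1) *
          cycle T (s + a) (b + 1 + c + 1)) := by
      have t1 : asym q T s (a + 1 + b) (c + 1) * (cycle T (s + (a + 1 + b)) (c + 1) *
          asym q T s (a + 1) b) = asym q T s (a + 1 + b) (c + 1) * asym q T s (a + 1) b *
          cycle T (s + (a + 1 + b)) (c + 1) := by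
        rw [c1.eq, mul_assoc]
      have t2 : asym q T s (a + 1 + b) (c + 1) * (cycle T (s + (a + 1 + b)) (c + 1) *
          (asym q T s a (b + 1) * cycle T (s + a) (b + 1))) =
          asym q T s (a + (b + 1)) (c + 1) * asym q T s a (b + 1) *
          cycle T (s + a) (b + 1 + c + 1) := by
        rw [← mul_assoc (cycle _ _ _), c2.eq, mul_assoc _ _ (cycle T (s + a) (b + 1)), c3,
          show a + (b + 1) = a + 1 + b by omega, mul_assoc]
      have t3 : asym q T s (a + 1 + b + 1) (c + 1) * asym q T s (a + 1) (b + 1) =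
          q ^ (a + 1 + b + 1) • (asym q T s (a + 1 + b + 1) c * asym q T s (a + 1) (b + 1)) +
          (-1 : k) ^ (c + 1) • (asym q T s (a + 1 + b) (c + 1) *
            (cycle T (s + (a + 1 + b)) (c + 1) * asym q T s (a + 1) (b + 1))) := by
        rw [asym_succ_succ q T s (a + 1 + b), add_mul, smul_mul_assoc, smul_mul_assoc, mul_assoc]
      have t4 : asym q T s (a + 1 + b) (c + 1) *
          (cycle T (s + (a + 1 + b)) (c + 1) * asym q T s (a + 1) (b + 1)) =
          q ^ (a + 1) • (asym q T s (a + 1 + b) (c + 1) * asym q T s (a + 1) b *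
            cycle T (s + (a + 1 + b)) (c + 1)) + (-1 : k) ^ (b + 1) •
          (asym q T s (a + (b + 1)) (c + 1) * asym q T s a (b + 1) *
            cycle T (s + a) (b + 1 + c + 1)) := by
        rw [asym_succ_succ q T s a b, mul_add, mul_add, mul_smul_comm, mul_smul_comm,
          mul_smul_comm, mul_smul_comm, t1, t2]
      rw [e1, t3, t4]
      module
    have l2 : asym q T s (a + 1) (b + 1 + (c + 1)) * asym q T (s + (a + 1)) (b + 1) (c + 1) =
        q ^ (a + 1 + b + 1) • (asym q T s (a + 1) (b + 1 + c) *
          asym q T (s + (a + 1)) (b + 1) c) +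
        (-1 : k) ^ (c + 1) • q ^ (a + 1) • (asym q T s (a + 1) (b + (c + 1)) *
          asym q T (s + (a + 1)) b (c + 1) * cycle T (s + (a + 1 + b)) (c + 1)) +
        (-1 : k) ^ (b + 1 + (c + 1)) • (asym q T s a (b + 1 + (c + 1)) *
          asym q T (s + a) (b + 1) (c + 1) * cycle T (s + a) (b + 1 + c + 1)) := by
      rw [e2, asym_succ_succ q T s a (b + 1 + c), add_mul, smul_mul_assoc, smul_mul_assoc,
        mul_assoc (asym q T s a _), c4, asym_succ_succ q T (s + (a + 1)) b c,
        show b + (c + 1) = b + 1 + c by omega, add_assoc s (a + 1) b]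
      simp only [mul_add, mul_smul_comm, mul_assoc]
      module
    rw [l1, l2, h1, h2, h3]

end BraidSequences

/-! ### Shuffles as subsets; the two descriptions of the antisymmetrizer agree -/

section Shuffles

theorem mapIdx_ofFn {α β : Type*} {n : ℕ} (f : Fin n → α) (g : ℕ → α → β) :
    (List.ofFn f).mapIdx g = List.ofFn fun i => g i (f i) := by
  apply List.ext_getElem <;> simp

/-- The sum of the numbers `s_i - i` over the elements `s_0 < s_1 < ⋯` of `S`. -/
def excess (S : Finset ℕ) : ℕ := (S.sort.mapIdx fun i s => s - i).sum

/-- The product of the cycles moving the place `i` to the place `s_i`, over the elements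
`s_0 < s_1 < ⋯` of `S`. -/
def excessProd {A : Type*} [Ring A] (T : ℕ → A) (S : Finset ℕ) : A :=
  (S.sort.mapIdx fun i s => cycle T i (s - i)).prod

theorem sort_insert_last {S : Finset ℕ} {n : ℕ} (h : ∀ m ∈ S, m < n) :
    (insert n S).sort = S.sort ++ [n] := by
  have hl : (S.sort ++ [n]).toFinset = insert n S := by ext; simp
  have hp : (S.sort ++ [n]).Pairwise (· ≤ ·) := by
    rw [List.pairwise_append]
    exact ⟨Finset.pairwise_sort _ _, List.pairwise_singleton _ _,
      fun x hx y hy => by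
        rw [List.mem_singleton] at hy
        exact hy ▸ (h x ((Finset.mem_sort _).1 hx)).le⟩
  have hn : (S.sort ++ [n]).Nodup := by
    rw [List.nodup_append']
    refine ⟨Finset.sort_nodup _ _, List.nodup_singleton _, ?_⟩
    rw [List.disjoint_singleton]
    exact fun hx => (h n ((Finset.mem_sort _).1 hx)).false
  rw [← hl]
  exact (List.toFinset_sort _ hn).2 hp

theorem excess_insert_last {S : Finset ℕ} {n : ℕ} (h : ∀ m ∈ S, m < n) :
    excess (insert n S) = excess S + (n - S.card) := by
  simp [excess, sort_insert_last h]

theorem excessProd_insert_last {A : Type*} [Ring A] (T : ℕ → A) {S : Finset ℕ} {n : ℕ}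
    (h : ∀ m ∈ S, m < n) :
    excessProd T (insert n S) = excessProd T S * cycle T S.card (n - S.card) := by
  simp [excessProd, sort_insert_last h]

theorem lt_of_mem_powersetCard_range {a n : ℕ} {S : Finset ℕ}
    (hS : S ∈ Finset.powersetCard a (Finset.range n)) : ∀ m ∈ S, m < n := fun _ hs =>
  Finset.mem_range.1 ((Finset.mem_powersetCard.1 hS).1 hs)

/-- Pascal's rule: the dichotomy is whether the largest place belongs to the subset, matching the
recursion of `asym`. -/
theorem powersetCard_range_succ (a b : ℕ) :
    Finset.powersetCard (a + 1) (Finset.range (a + 1 + (b + 1))) =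
      Finset.powersetCard (a + 1) (Finset.range (a + 1 + b)) ∪
        (Finset.powersetCard a (Finset.range (a + (b + 1)))).image (insert (a + (b + 1))) := by
  rw [show a + 1 + (b + 1) = a + (b + 1) + 1 by omega, Finset.range_add_one,
    Finset.powersetCard_succ_insert Finset.notMem_range_self,
    show a + (b + 1) = a + 1 + b by omega]

/-- Guarantees that the natural subtraction in `a * b - excess S` is never truncated. -/
theorem excess_le (a b : ℕ) {S : Finset ℕ}
    (hS : S ∈ Finset.powersetCard a (Finset.range (a + b))) : excess S ≤ a * b := by
  induction a generalizing b S with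
  | zero => simp_all [excess]
  | succ a iha =>
    induction b generalizing S with
    | zero =>
      have : S = Finset.range (a + 1) := by
        obtain ⟨h1, h2⟩ := Finset.mem_powersetCard.1 hS
        exact Finset.eq_of_subset_of_card_le h1 (by simp [h2])
      have h0 : (List.range (a + 1)).mapIdx (fun i s => s - i) = List.replicate (a + 1) 0 := by
        apply List.ext_getElem <;> simp
      simp [this, excess, h0]
    | succ b ihb =>
      rw [powersetCard_range_succ, Finset.mem_union, Finset.mem_image] at hS
      rcases hS with hS | ⟨S', hS', rfl⟩
      · exact (ihb hS).trans (Nat.mul_le_mul_left _ (Nat.le_succ b))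
      · have h := iha (b + 1) hS'
        rw [excess_insert_last (lt_of_mem_powersetCard_range hS'),
          (Finset.mem_powersetCard.1 hS').2, Nat.add_sub_cancel_left, Nat.succ_mul]
        omega

variable {k : Type*} [Field k] {A : Type*} [Ring A] [Algebra k A]

/-- A subset avoiding the largest place only has its exponent of `q` raised by `a + 1`. A largest
place that is present adds `b + 1` to the excess and one final cycle to the product. -/
theorem sum_powersetCard_eq_asym (q : k) (T : ℕ → A) (a b : ℕ) :
    ∑ S ∈ Finset.powersetCard a (Finset.range (a + b)),
      ((-1) ^ excess S * q ^ (a * b - excess S) : k) • excessProd T S = asym q T 0 a b := by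
  induction a generalizing b with
  | zero => simp [excess, excessProd]
  | succ a iha =>
    induction b with
    | zero =>
      have h0 : (List.range (a + 1)).mapIdx (fun i s => s - i) = List.replicate (a + 1) 0 := by
        apply List.ext_getElem <;> simp
      have h1 : (List.range (a + 1)).mapIdx (fun i s => cycle T i (s - i)) =
          List.replicate (a + 1) 1 := by
        apply List.ext_getElem <;> simp
      have h2 : Finset.powersetCard (a + 1) (Finset.range (a + 1)) = {Finset.range (a + 1)} := by
        simpa using Finset.powersetCard_self (Finset.range (a + 1))
      simp [excess, excessProd, h0, h1, h2]
    | succ b ihb =>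
      rw [powersetCard_range_succ, Finset.sum_union, Finset.sum_image, asym_succ_succ, ← ihb,
        ← iha, Finset.smul_sum, Finset.sum_mul, Finset.smul_sum]
      · congr 1
        · refine Finset.sum_congr rfl fun S hS => ?_
          have h := excess_le _ _ hS
          rw [smul_smul]
          congr 1
          rw [show (a + 1) * (b + 1) - excess S = (a + 1) + ((a + 1) * b - excess S) by
            rw [Nat.mul_succ]; omega, pow_add q]
          ring
        · refine Finset.sum_congr rfl fun S hS => ?_
          have h := excess_le _ _ hS
          have hc := (Finset.mem_powersetCard.1 hS).2
          have hlt := lt_of_mem_powersetCard_range hS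
          rw [excess_insert_last hlt, excessProd_insert_last T hlt, hc, Nat.add_sub_cancel_left,
            smul_mul_assoc, smul_smul, zero_add]
          congr 1
          rw [show (a + 1) * (b + 1) - (excess S + (b + 1)) = a * (b + 1) - excess S by
            rw [Nat.succ_mul]; omega]
          ring
      · intro S hS S' hS' h
        have h1 : a + (b + 1) ∉ S := fun hm => (lt_of_mem_powersetCard_range hS _ hm).false
        have h2 : a + (b + 1) ∉ S' := fun hm => (lt_of_mem_powersetCard_range hS' _ hm).false
        rw [← Finset.erase_insert h1, ← Finset.erase_insert h2]
        exact congrArg (fun F : Finset ℕ => F.erase (a + (b + 1))) h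
      · rw [Finset.disjoint_left]
        intro S hS hS'
        obtain ⟨S', hS', rfl⟩ := Finset.mem_image.1 hS'
        have := lt_of_mem_powersetCard_range hS _ (Finset.mem_insert_self _ _)
        omega

section Perm

variable {a b : ℕ} {d : Equiv.Perm (Fin (a + b))}

theorem strictMono_left_of_mem_shuffles (hd : d ∈ shuffles a b) :
    StrictMono fun i : Fin a => d (Fin.castAdd b i) := fun i j hij => by
  refine (Finset.mem_filter.1 hd).2 _ _ ?_ (Or.inl ?_)
  · exact hij
  · simp

theorem strictMono_right_of_mem_shuffles (hd : d ∈ shuffles a b) :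
    StrictMono fun i : Fin b => d (Fin.natAdd a i) := fun i j hij => by
  refine (Finset.mem_filter.1 hd).2 _ _ ?_ (Or.inr ?_)
  · simpa using hij
  · simp

theorem mem_shuffles_of_strictMono (h₁ : StrictMono fun i : Fin a => d (Fin.castAdd b i))
    (h₂ : StrictMono fun i : Fin b => d (Fin.natAdd a i)) : d ∈ shuffles a b := by
  refine Finset.mem_filter.2 ⟨Finset.mem_univ _, fun i j hij h => ?_⟩
  induction i using Fin.addCases with
  | left i =>
    induction j using Fin.addCases with
    | left j => exact h₁ hij
    | right j =>
      rcases h with h | h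
      · simp at h
      · have := i.2
        simp at h
        omega
  | right i =>
    induction j using Fin.addCases with
    | left j =>
      have h1 : a + (i : ℕ) < (j : ℕ) := hij
      have := j.2
      omega
    | right j => exact h₂ (by simpa using hij)

theorem lehmer_right (hd : d ∈ shuffles a b) (i : Fin b) : lehmer d (Fin.natAdd a i) = 0 := by
  rw [lehmer, Finset.card_eq_zero, Finset.filter_eq_empty_iff]
  rintro j - ⟨h1, h2⟩
  exact absurd ((Finset.mem_filter.1 hd).2 _ _ h1 (Or.inr (by simp))) h2.not_gt

/-- Among the `d i` entries smaller than `d i`, all `i` earlier ones occur because `d` increases on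
the first block; the Lehmer code counts the others. -/
theorem lehmer_left (hd : d ∈ shuffles a b) (i : Fin a) :
    lehmer d (Fin.castAdd b i) = (d (Fin.castAdd b i) : ℕ) - i := by
  have h1 : (Finset.univ.filter fun j => d j < d (Fin.castAdd b i)).card =
      (d (Fin.castAdd b i) : ℕ) := by
    rw [← Fin.card_Iio]
    refine Finset.card_bij (fun j _ => d j) (fun j hj => ?_) (fun j _ j' _ h => d.injective h)
      fun j hj => ⟨d.symm j, ?_, by simp⟩
    · simpa using hj
    · simpa using hj
  have h2 : (Finset.univ.filter fun j => d j < d (Fin.castAdd b i)) =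
      (Finset.univ.filter fun j => Fin.castAdd b i < j ∧ d j < d (Fin.castAdd b i)) ∪
        Finset.Iio (Fin.castAdd b i) := by
    ext j
    simp only [Finset.mem_filter, Finset.mem_univ, true_and, Finset.mem_union, Finset.mem_Iio]
    constructor
    · intro h
      rcases lt_trichotomy j (Fin.castAdd b i) with hj | hj | hj
      · exact Or.inr hj
      · exact absurd (hj ▸ h) (lt_irrefl _)
      · exact Or.inl ⟨hj, h⟩
    · rintro (h | h)
      · exact h.2
      · exact (Finset.mem_filter.1 hd).2 _ _ h (Or.inl (by simp))
  rw [h2, Finset.card_union_of_disjoint, Fin.card_Iio] at h1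
  · rw [← h1, lehmer]
    simp
  · rw [Finset.disjoint_left]
    intro j hj hj'
    exact absurd (Finset.mem_Iio.1 hj') (Finset.mem_filter.1 hj).2.1.not_gt

theorem len_eq_sum_lehmer {n : ℕ} (σ : Equiv.Perm (Fin n)) : len σ = ∑ i, lehmer σ i := by
  simp only [len, lehmer, Finset.card_filter]
  rw [← Finset.univ_product_univ, Finset.sum_product]

/-- The image of the first block of places under a permutation. -/
def firstImage (d : Equiv.Perm (Fin (a + b))) : Finset ℕ :=
  (List.ofFn fun i : Fin a => (d (Fin.castAdd b i) : ℕ)).toFinset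

theorem sort_firstImage (hd : d ∈ shuffles a b) :
    (firstImage d).sort = List.ofFn fun i : Fin a => (d (Fin.castAdd b i) : ℕ) := by
  have h := (List.sortedLT_ofFn_iff (f := fun i : Fin a => (d (Fin.castAdd b i) : ℕ))).2
    (strictMono_left_of_mem_shuffles hd)
  exact (List.toFinset_sort _ h.nodup).2 h.sortedLE.pairwise

theorem mem_firstImage {d : Equiv.Perm (Fin (a + b))} {x : ℕ} :
    x ∈ firstImage d ↔ ∃ i : Fin a, (d (Fin.castAdd b i) : ℕ) = x := by
  simp [firstImage, List.mem_ofFn]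

theorem firstImage_mem (hd : d ∈ shuffles a b) :
    firstImage d ∈ Finset.powersetCard a (Finset.range (a + b)) := by
  refine Finset.mem_powersetCard.2 ⟨fun x hx => ?_, ?_⟩
  · obtain ⟨i, rfl⟩ := mem_firstImage.1 hx
    exact Finset.mem_range.2 (Fin.is_lt _)
  · rw [← Finset.length_sort (· ≤ ·), sort_firstImage hd, List.length_ofFn]

theorem len_eq_excess (hd : d ∈ shuffles a b) : len d = excess (firstImage d) := by
  rw [len_eq_sum_lehmer, Fin.sum_univ_add, excess, sort_firstImage hd, mapIdx_ofFn, List.sum_ofFn]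
  simp [lehmer_left hd, lehmer_right hd]

end Perm

variable {V : Type*} [AddCommGroup V] [Module k V] (R : V ⊗[k] V →ₗ[k] V ⊗[k] V)

theorem cyc_eq_cycle (i m : ℕ) : cyc R i m = cycle (gen R) i m := by
  induction m with
  | zero => rfl
  | succ m ih => rw [cyc, ih, cycle_succ]

theorem heckeT_eq_excessProd {a b : ℕ} {d : Equiv.Perm (Fin (a + b))} (hd : d ∈ shuffles a b) :
    heckeT R d = excessProd (gen R) (firstImage d) := by
  have h : (fun i : Fin (a + b) => cyc R i (lehmer d i)) =
      Fin.append (fun i : Fin a => cycle (gen R) i ((d (Fin.castAdd b i) : ℕ) - i))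
        (fun _ : Fin b => 1) := by
    ext1 i
    induction i using Fin.addCases with
    | left i => simp [lehmer_left hd, cyc_eq_cycle]
    | right i => simp [lehmer_right hd, cyc_eq_cycle]
  rw [heckeT, h, List.ofFn_fin_append, List.prod_append, excessProd, sort_firstImage hd,
    mapIdx_ofFn]
  simp

/-- A shuffle is determined by the image of its first block: it is increasing on each block, and the
second image is the complement of the first. Length and Hecke operator are read off that image
through the Lehmer code, which vanishes on the second block. -/
theorem antisym_eq_asym (q : k) (a b : ℕ) : antisym q R a b = asym q (gen R) 0 a b := by
  rw [← sum_powersetCard_eq_asym, antisym]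
  refine Finset.sum_nbij firstImage (fun d hd => firstImage_mem hd) ?_ ?_ fun d hd => by
    rw [len_eq_excess hd, heckeT_eq_excessProd R hd]
  · intro d hd d' hd' h
    have h1 : (fun i : Fin a => d (Fin.castAdd b i)) = fun i : Fin a => d' (Fin.castAdd b i) := by
      have := (sort_firstImage hd).symm.trans ((congrArg Finset.sort h).trans (sort_firstImage hd'))
      ext i
      exact congrFun (List.ofFn_injective this) i
    have h2 : (fun i : Fin b => d (Fin.natAdd a i)) = fun i : Fin b => d' (Fin.natAdd a i) := by
      rw [← StrictMono.range_inj (strictMono_right_of_mem_shuffles hd)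
        (strictMono_right_of_mem_shuffles hd')]
      have key : ∀ e : Equiv.Perm (Fin (a + b)), Set.range (fun i : Fin b => e (Fin.natAdd a i)) =
          (Set.range fun i : Fin a => e (Fin.castAdd b i))ᶜ := by
        intro e
        ext x
        constructor
        · rintro ⟨i, rfl⟩ ⟨j, hj⟩
          have := congrArg Fin.val (e.injective hj)
          have := j.2
          simp at *
          omega
        · intro hx
          obtain ⟨i, rfl⟩ := e.surjective x
          induction i using Fin.addCases with
          | left i => exact absurd ⟨i, rfl⟩ hx
          | right i => exact ⟨i, rfl⟩
      rw [key, key, h1]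
    ext i
    induction i using Fin.addCases with
    | left i => exact congrArg Fin.val (congrFun h1 i)
    | right i => exact congrArg Fin.val (congrFun h2 i)
  · intro S hS
    obtain ⟨hS1, hS2⟩ := Finset.mem_powersetCard.1 hS
    have hlt : ∀ s ∈ S, s < a + b := fun s hs => Finset.mem_range.1 (hS1 hs)
    let S' : Finset (Fin (a + b)) := S.attachFin hlt
    have hm : S'.card = a := by rw [Finset.card_attachFin, hS2]
    have hn : S'ᶜ.card = b := by rw [Finset.card_compl, hm, Fintype.card_fin]; omega
    let d : Equiv.Perm (Fin (a + b)) := finSumFinEquiv.symm.trans (finSumEquivOfFinset hm hn)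
    have hl : ∀ i : Fin a, d (Fin.castAdd b i) = S'.orderEmbOfFin hm i := fun i => by simp [d]
    have hr : ∀ i : Fin b, d (Fin.natAdd a i) = S'ᶜ.orderEmbOfFin hn i := fun i => by simp [d]
    refine ⟨d, mem_shuffles_of_strictMono ?_ ?_, ?_⟩
    · simpa only [hl] using (S'.orderEmbOfFin hm).strictMono
    · simpa only [hr] using (S'ᶜ.orderEmbOfFin hn).strictMono
    · ext x
      rw [mem_firstImage]
      simp only [hl]
      constructor
      · rintro ⟨i, rfl⟩
        exact Finset.mem_attachFin hlt |>.1 (S'.orderEmbOfFin_mem hm i)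
      · intro hx
        have : (⟨x, hlt x hx⟩ : Fin (a + b)) ∈ Set.range (S'.orderEmbOfFin hm) := by
          rw [Finset.range_orderEmbOfFin]
          exact (Finset.mem_attachFin hlt).2 hx
        obtain ⟨i, hi⟩ := this
        exact ⟨i, by rw [hi]⟩

end Shuffles

/-! ### Tensor powers, contraction of an end letter, functoriality -/

section TensorAlgebra

variable {k : Type*} [Field k] {V : Type*} [AddCommGroup V] [Module k V]

local notation "ιT" => TensorAlgebra.ι k

/-! ### Tensor powers -/

theorem one_mem_tensorPow : (1 : TensorAlgebra k V) ∈ tensorPow k V 0 := by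
  simp [tensorPow]

theorem ι_mem_tensorPow (v : V) : ιT v ∈ tensorPow k V 1 := by
  simp [tensorPow]

theorem tensorPow_add (m n : ℕ) :
    tensorPow k V (m + n) = tensorPow k V m * tensorPow k V n := pow_add _ _ _

theorem mul_mem_tensorPow {m n : ℕ} {x y : TensorAlgebra k V} (hx : x ∈ tensorPow k V m)
    (hy : y ∈ tensorPow k V n) : x * y ∈ tensorPow k V (m + n) := by
  rw [tensorPow_add]
  exact Submodule.mul_mem_mul hx hy

theorem ι_mul_mem_tensorPow {m : ℕ} (v : V) {x : TensorAlgebra k V} (hx : x ∈ tensorPow k V m) :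
    ιT v * x ∈ tensorPow k V (m + 1) := by
  rw [add_comm]
  exact mul_mem_tensorPow (ι_mem_tensorPow v) hx

theorem tensorPow_zero_iff {x : TensorAlgebra k V} :
    x ∈ tensorPow k V 0 ↔ ∃ c : k, x = c • 1 := by
  rw [tensorPow, pow_zero, Submodule.mem_one]
  simp [Algebra.algebraMap_eq_smul_one, eq_comm]

theorem tensorPow_one_iff {x : TensorAlgebra k V} :
    x ∈ tensorPow k V 1 ↔ ∃ v : V, x = ιT v := by
  rw [tensorPow, pow_one, LinearMap.mem_range]
  simp [eq_comm]

theorem tensorPow_add_induction {m n : ℕ} {P : TensorAlgebra k V → Prop}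
    (hmul : ∀ x ∈ tensorPow k V m, ∀ y ∈ tensorPow k V n, P (x * y))
    (hadd : ∀ x y, P x → P y → P (x + y)) {x : TensorAlgebra k V}
    (hx : x ∈ tensorPow k V (m + n)) : P x := by
  rw [tensorPow_add] at hx
  exact Submodule.mul_induction_on hx hmul hadd

theorem tensorPow_succ_induction_left {m : ℕ} {P : TensorAlgebra k V → Prop}
    (hmul : ∀ v, ∀ y ∈ tensorPow k V m, P (ιT v * y))
    (hadd : ∀ x y, P x → P y → P (x + y)) {x : TensorAlgebra k V}
    (hx : x ∈ tensorPow k V (m + 1)) : P x := by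
  rw [add_comm] at hx
  refine tensorPow_add_induction (fun x hx y hy => ?_) hadd hx
  obtain ⟨v, rfl⟩ := tensorPow_one_iff.1 hx
  exact hmul v y hy

theorem tensorPow_succ_induction_right {m : ℕ} {P : TensorAlgebra k V → Prop}
    (hmul : ∀ v, ∀ y ∈ tensorPow k V m, P (y * ιT v))
    (hadd : ∀ x y, P x → P y → P (x + y)) {x : TensorAlgebra k V}
    (hx : x ∈ tensorPow k V (m + 1)) : P x := by
  refine tensorPow_add_induction (fun y hy x hx => ?_) hadd hx
  obtain ⟨v, rfl⟩ := tensorPow_one_iff.1 hx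
  exact hmul v y hy

theorem iSup_tensorPow : ⨆ m, tensorPow k V m = ⊤ :=
  (DirectSum.Decomposition.isInternal fun m : ℕ =>
    LinearMap.range (ιT : V →ₗ[k] TensorAlgebra k V) ^ m).submodule_iSup_eq_top

theorem linearMap_ext_pow {M : Type*} [AddCommMonoid M] [Module k M]
    {f g : TensorAlgebra k V →ₗ[k] M} (h : ∀ m, ∀ x ∈ tensorPow k V m, f x = g x) : f = g := by
  have : ⨆ m, tensorPow k V m ≤ LinearMap.eqLocus f g := iSup_le fun m x hx => h m x hx
  rw [iSup_tensorPow] at this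
  exact LinearMap.ext fun x => this Submodule.mem_top

theorem linearMap_ext_left {M : Type*} [AddCommMonoid M] [Module k M]
    {f g : TensorAlgebra k V →ₗ[k] M} (h1 : f 1 = g 1)
    (h : ∀ v w, f (ιT v * w) = g (ιT v * w)) : f = g :=
  linearMap_ext_pow fun m x hx => by
    rcases m with _ | m
    · obtain ⟨c, rfl⟩ := tensorPow_zero_iff.1 hx
      simp [h1]
    · refine tensorPow_succ_induction_left (P := fun x => f x = g x) (fun v y _ => h v y) ?_ hx
      intro x y hx hy
      rw [map_add, map_add, hx, hy]

theorem linearMap_ext_right {M : Type*} [AddCommMonoid M] [Module k M]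
    {f g : TensorAlgebra k V →ₗ[k] M} (h1 : f 1 = g 1)
    (h : ∀ v w, f (w * ιT v) = g (w * ιT v)) : f = g :=
  linearMap_ext_pow fun m x hx => by
    rcases m with _ | m
    · obtain ⟨c, rfl⟩ := tensorPow_zero_iff.1 hx
      simp [h1]
    · refine tensorPow_succ_induction_right (P := fun x => f x = g x) (fun v y _ => h v y) ?_ hx
      intro x y hx hy
      rw [map_add, map_add, hx, hy]

/-! ### Contractions -/

variable (k V) in
/-- The reversal of tensors. -/
def rev : TensorAlgebra k V →ₗ[k] TensorAlgebra k V :=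
  (MulOpposite.opLinearEquiv k).symm.toLinearMap ∘ₗ
    (TensorAlgebra.lift k ((MulOpposite.opLinearEquiv k).toLinearMap ∘ₗ
      (ιT : V →ₗ[k] TensorAlgebra k V))).toLinearMap

@[simp] theorem rev_one : rev k V 1 = 1 := by simp [rev]

@[simp] theorem rev_ι (v : V) : rev k V (ιT v) = ιT v := by simp [rev]

@[simp] theorem rev_mul (x y : TensorAlgebra k V) : rev k V (x * y) = rev k V y * rev k V x := by
  simp [rev]

/-- The contraction of the first letter with a functional. -/
def conL (f : Module.Dual k V) : Module.End k (TensorAlgebra k V) :=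
  (TensorProduct.lid k _).toLinearMap ∘ₗ f.rTensor _ ∘ₗ splitFirst k V

/-- The contraction of the last letter with a functional. -/
def conR (f : Module.Dual k V) : Module.End k (TensorAlgebra k V) :=
  rev k V ∘ₗ conL f ∘ₗ rev k V

@[simp] theorem rev_rev (x : TensorAlgebra k V) : rev k V (rev k V x) = x := by
  have : rev k V ∘ₗ rev k V = LinearMap.id := linearMap_ext_pow fun m => by
    induction m with
    | zero =>
      intro x hx
      obtain ⟨c, rfl⟩ := tensorPow_zero_iff.1 hx
      simp
    | succ m ih =>
      intro x hx
      refine tensorPow_succ_induction_left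
        (P := fun x => (rev k V ∘ₗ rev k V) x = LinearMap.id (R := k) x) (fun v y hy => ?_) ?_ hx
      · have := ih y hy
        simp_all
      · intro x y hx hy
        rw [map_add, map_add, hx, hy]
  exact LinearMap.congr_fun this x

variable (f g : Module.Dual k V)

@[simp] theorem conL_one : conL f (1 : TensorAlgebra k V) = 0 := by
  simp [conL, splitFirst_one]

@[simp] theorem conL_ι_mul (v : V) (x : TensorAlgebra k V) : conL f (ιT v * x) = f v • x := by
  simp [conL, splitFirst_ι_mul]

@[simp] theorem conL_ι (v : V) : conL f (ιT v) = f v • 1 := by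
  rw [← mul_one (ιT v), conL_ι_mul]

@[simp] theorem conR_one : conR f (1 : TensorAlgebra k V) = 0 := by
  simp [conR]

@[simp] theorem conR_mul_ι (v : V) (x : TensorAlgebra k V) : conR f (x * ιT v) = f v • x := by
  simp [conR]

@[simp] theorem conR_ι (v : V) : conR f (ιT v) = f v • 1 := by
  rw [← one_mul (ιT v), conR_mul_ι]

/-- Positive degree is essential: for `x = 1` the contraction would hit the appended letter. The
same holds for `conL_mul` and `conR_mul`. -/
theorem conL_mul_ι_aux (v : V) {m : ℕ} {x : TensorAlgebra k V} (hx : x ∈ tensorPow k V (m + 1)) :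
    conL f (x * ιT v) = conL f x * ιT v := by
  refine tensorPow_succ_induction_left (P := fun x => conL f (x * ιT v) = conL f x * ιT v)
    (fun u y _ => ?_) (fun x y hx hy => ?_) hx
  · simp [mul_assoc]
  · simp [add_mul, hx, hy]

theorem conL_conR (x : TensorAlgebra k V) : conL f (conR g x) = conR g (conL f x) := by
  suffices h : conL f ∘ₗ conR g = conR g ∘ₗ conL f from LinearMap.congr_fun h x
  refine linearMap_ext_pow fun m x hx => ?_
  rcases m with _ | _ | m
  · obtain ⟨c, rfl⟩ := tensorPow_zero_iff.1 hx
    simp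
  · obtain ⟨v, rfl⟩ := tensorPow_one_iff.1 hx
    simp
  · refine tensorPow_succ_induction_right
      (P := fun x => (conL f ∘ₗ conR g) x = (conR g ∘ₗ conL f) x)
      (fun v y hy => ?_) (fun x y hx hy => ?_) hx
    · simp [conL_mul_ι_aux f v hy]
    · rw [map_add, map_add, hx, hy]

theorem commute_conL_conR : Commute (conL f) (conR g) := LinearMap.ext fun x => conL_conR f g x

theorem conL_mem {m : ℕ} {x : TensorAlgebra k V} (hx : x ∈ tensorPow k V (m + 1)) :
    conL f x ∈ tensorPow k V m := by
  refine tensorPow_succ_induction_left (P := fun x => conL f x ∈ tensorPow k V m)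
    (fun u y hy => ?_) (fun x y hx hy => ?_) hx
  · simpa using Submodule.smul_mem _ _ hy
  · rw [map_add]
    exact add_mem hx hy

theorem conR_mem {m : ℕ} {x : TensorAlgebra k V} (hx : x ∈ tensorPow k V (m + 1)) :
    conR f x ∈ tensorPow k V m := by
  refine tensorPow_succ_induction_right (P := fun x => conR f x ∈ tensorPow k V m)
    (fun u y hy => ?_) (fun x y hx hy => ?_) hx
  · simpa using Submodule.smul_mem _ _ hy
  · rw [map_add]
    exact add_mem hx hy

theorem conL_mul {m : ℕ} {x : TensorAlgebra k V} (hx : x ∈ tensorPow k V (m + 1))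
    (y : TensorAlgebra k V) : conL f (x * y) = conL f x * y := by
  refine tensorPow_succ_induction_left (P := fun x => conL f (x * y) = conL f x * y)
    (fun u z _ => ?_) (fun x z hx hz => ?_) hx
  · simp [mul_assoc]
  · simp [add_mul, hx, hz]

theorem conR_mul {m : ℕ} (y : TensorAlgebra k V) {x : TensorAlgebra k V}
    (hx : x ∈ tensorPow k V (m + 1)) : conR f (y * x) = y * conR f x := by
  refine tensorPow_succ_induction_right (P := fun x => conR f (y * x) = y * conR f x)
    (fun u z _ => ?_) (fun x z hx hz => ?_) hx
  · simp [← mul_assoc]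
  · simp [mul_add, hx, hz]

theorem conL_add (f g : Module.Dual k V) : conL (f + g) = conL f + conL g := by
  ext x; simp [conL, LinearMap.rTensor_add]

theorem conL_smul (c : k) (f : Module.Dual k V) : conL (c • f) = c • conL f := by
  ext x; simp [conL, LinearMap.rTensor_smul]

theorem conR_add (f g : Module.Dual k V) : conR (f + g) = conR f + conR g := by
  ext x; simp [conR, conL_add]

theorem conR_smul (c : k) (f : Module.Dual k V) : conR (c • f) = c • conR f := by
  ext x; simp [conR, conL_smul]

section Basis

variable {κ : Type*} [Fintype κ] (e : Module.Basis κ k V)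

theorem sum_ι_mul_conL {m : ℕ} {x : TensorAlgebra k V} (hx : x ∈ tensorPow k V (m + 1)) :
    ∑ i, ιT (e i) * conL (e.coord i) x = x := by
  refine tensorPow_succ_induction_left (P := fun x => ∑ i, ιT (e i) * conL (e.coord i) x = x)
    (fun u z _ => ?_) (fun x z hx hz => ?_) hx
  · conv_rhs => rw [← e.sum_repr u]
    simp [map_sum, Finset.sum_mul, -Module.Basis.sum_repr]
  · simp only [map_add, mul_add, Finset.sum_add_distrib, hx, hz]

theorem sum_conR_mul_ι {m : ℕ} {x : TensorAlgebra k V} (hx : x ∈ tensorPow k V (m + 1)) :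
    ∑ i, conR (e.coord i) x * ιT (e i) = x := by
  refine tensorPow_succ_induction_right (P := fun x => ∑ i, conR (e.coord i) x * ιT (e i) = x)
    (fun u z _ => ?_) (fun x z hx hz => ?_) hx
  · conv_rhs => rw [← e.sum_repr u]
    simp [map_sum, Finset.mul_sum, -Module.Basis.sum_repr]
  · simp only [map_add, add_mul, Finset.sum_add_distrib, hx, hz]

end Basis

/-! ### The functoriality of the tensor algebra -/

/-- The algebra homomorphism `T(V) → T(W)` induced by a linear map. -/
def tmap {W : Type*} [AddCommGroup W] [Module k W] (χ : V →ₗ[k] W) :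
    TensorAlgebra k V →ₐ[k] TensorAlgebra k W :=
  TensorAlgebra.lift k (ιT ∘ₗ χ)

@[simp] theorem tmap_ι {W : Type*} [AddCommGroup W] [Module k W] (χ : V →ₗ[k] W) (v : V) :
    tmap χ (ιT v) = ιT (χ v) := by
  simp [tmap]

theorem tmap_comp {W X : Type*} [AddCommGroup W] [Module k W] [AddCommGroup X] [Module k X]
    (χ : V →ₗ[k] W) (ξ : W →ₗ[k] X) (x : TensorAlgebra k V) :
    tmap (ξ ∘ₗ χ) x = tmap ξ (tmap χ x) := by
  have : tmap (ξ ∘ₗ χ) = (tmap ξ).comp (tmap χ) := by ext; simp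
  rw [this]; rfl

theorem tmap_id (x : TensorAlgebra k V) : tmap (LinearMap.id : V →ₗ[k] V) x = x := by
  have : tmap (LinearMap.id : V →ₗ[k] V) = AlgHom.id k _ := by ext; simp
  rw [this]; rfl

theorem tmap_mem {W : Type*} [AddCommGroup W] [Module k W] (χ : V →ₗ[k] W) {m : ℕ}
    {x : TensorAlgebra k V} (hx : x ∈ tensorPow k V m) : tmap χ x ∈ tensorPow k W m := by
  induction m generalizing x with
  | zero =>
    obtain ⟨c, rfl⟩ := tensorPow_zero_iff.1 hx
    exact tensorPow_zero_iff.2 ⟨c, by simp⟩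
  | succ m ih =>
    refine tensorPow_succ_induction_left (P := fun x => tmap χ x ∈ tensorPow k W (m + 1))
      (fun v y hy => ?_) (fun x y hx hy => ?_) hx
    · rw [map_mul, tmap_ι]
      exact ι_mul_mem_tensorPow _ (ih hy)
    · rw [map_add]
      exact add_mem hx hy

theorem conL_tmap (f : Module.Dual k V) (χ : V →ₗ[k] V) (x : TensorAlgebra k V) :
    conL f (tmap χ x) = tmap χ (conL (f ∘ₗ χ) x) := by
  suffices h : conL f ∘ₗ (tmap χ).toLinearMap = (tmap χ).toLinearMap ∘ₗ conL (f ∘ₗ χ) from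
    LinearMap.congr_fun h x
  refine linearMap_ext_left (by simp) fun v w => by simp

theorem conR_tmap (f : Module.Dual k V) (χ : V →ₗ[k] V) (x : TensorAlgebra k V) :
    conR f (tmap χ x) = tmap χ (conR (f ∘ₗ χ) x) := by
  suffices h : conR f ∘ₗ (tmap χ).toLinearMap = (tmap χ).toLinearMap ∘ₗ conR (f ∘ₗ χ) from
    LinearMap.congr_fun h x
  refine linearMap_ext_right (by simp) fun v w => by simp

/-! ### Tensors of degree two -/

variable (k V) in
/-- The identification of `V ⊗ V` with the component of degree `2` of `T(V)`. -/
def pairEmb : V ⊗[k] V →ₗ[k] TensorAlgebra k V :=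
  LinearMap.mul' k (TensorAlgebra k V) ∘ₗ TensorProduct.map ιT ιT

@[simp] theorem pairEmb_tmul (v w : V) : pairEmb k V (v ⊗ₜ w) = ιT v * ιT w := by
  simp [pairEmb]

theorem pairEmb_mem (z : V ⊗[k] V) : pairEmb k V z ∈ tensorPow k V 2 := by
  induction z using TensorProduct.induction_on with
  | zero => simp
  | tmul v w => simpa using mul_mem_tensorPow (ι_mem_tensorPow v) (ι_mem_tensorPow w)
  | add x y hx hy => rw [map_add]; exact add_mem hx hy

theorem exists_pairEmb {x : TensorAlgebra k V} (hx : x ∈ tensorPow k V 2) :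
    ∃ z, pairEmb k V z = x := by
  refine tensorPow_succ_induction_left (P := fun x => ∃ z, pairEmb k V z = x)
    (fun u y hy => ?_) (fun x y hx hy => ?_) hx
  · obtain ⟨v, rfl⟩ := tensorPow_one_iff.1 hy
    exact ⟨u ⊗ₜ v, by simp⟩
  · obtain ⟨a, rfl⟩ := hx
    obtain ⟨b, rfl⟩ := hy
    exact ⟨a + b, by simp⟩

/-- A left inverse splits off the first letter and reads the remainder as a vector. -/
theorem pairEmb_injective : Function.Injective (pairEmb k V) := by
  have h : (TensorAlgebra.ιInv.lTensor V ∘ₗ splitFirst k V) ∘ₗ pairEmb k V = LinearMap.id := by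
    ext v w
    simp [splitFirst_ι_mul, TensorAlgebra.ι_leftInverse w]
  exact Function.LeftInverse.injective (g := TensorAlgebra.ιInv.lTensor V ∘ₗ splitFirst k V)
    fun z => LinearMap.congr_fun h z

theorem tmap_pairEmb {W : Type*} [AddCommGroup W] [Module k W] (χ : V →ₗ[k] W) (z : V ⊗[k] V) :
    tmap χ (pairEmb k V z) = pairEmb k W (TensorProduct.map χ χ z) := by
  induction z using TensorProduct.induction_on with
  | zero => simp
  | tmul v w => simp
  | add x y hx hy => simp [hx, hy]

end TensorAlgebra

/-! ### The Hecke generators acting on tensors -/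

section Generators

variable {k : Type*} [Field k] {V : Type*} [AddCommGroup V] [Module k V]
  (R : V ⊗[k] V →ₗ[k] V ⊗[k] V)

local notation "ιT" => TensorAlgebra.ι k

theorem gen_zero_pairEmb (z : V ⊗[k] V) (w : TensorAlgebra k V) :
    gen R 0 (pairEmb k V z * w) = pairEmb k V (R z) * w := by
  induction z using TensorProduct.induction_on with
  | zero => simp
  | tmul x y => rw [pairEmb_tmul, mul_assoc, gen_zero_apply]; rfl
  | add x y hx hy => simp only [map_add, add_mul, hx, hy]

theorem gen_mul_left {m : ℕ} (i : ℕ) {x : TensorAlgebra k V} (hx : x ∈ tensorPow k V m)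
    (w : TensorAlgebra k V) : gen R (m + i) (x * w) = x * gen R i w := by
  induction m generalizing x with
  | zero =>
    obtain ⟨c, rfl⟩ := tensorPow_zero_iff.1 hx
    simp
  | succ m ih =>
    refine tensorPow_succ_induction_left
      (P := fun x => gen R (m + 1 + i) (x * w) = x * gen R i w)
      (fun v y hy => ?_) (fun x y hx hy => ?_) hx
    · rw [mul_assoc, add_right_comm, gen_succ_apply, ih hy, mul_assoc]
    · rw [add_mul, map_add, hx, hy, add_mul]

/-- Thanks to this default value the commutation and braid relations hold on all of T(V). The
quadratic relation, and with it injectivity, holds only on tensors with enough letters. -/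
theorem gen_apply_zero_of_lt {m i : ℕ} (h : m < i + 2) {x : TensorAlgebra k V}
    (hx : x ∈ tensorPow k V m) : gen R i x = 0 := by
  induction m generalizing i x with
  | zero =>
    obtain ⟨c, rfl⟩ := tensorPow_zero_iff.1 hx
    cases i <;> simp [gen, splitFirst_one]
  | succ m ih =>
    refine tensorPow_succ_induction_left (P := fun x => gen R i x = 0)
      (fun v y hy => ?_) (fun x y hx hy => ?_) hx
    · rcases i with _ | i
      · obtain rfl : m = 0 := by omega
        obtain ⟨c, rfl⟩ := tensorPow_zero_iff.1 hy
        have h1 : splitFirst k V (ιT v) = v ⊗ₜ 1 := by rw [← mul_one (ιT v), splitFirst_ι_mul]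
        simp [gen, h1, splitFirst_one]
      · rw [gen_succ_apply, ih (by omega) hy, mul_zero]
    · rw [map_add, hx, hy, add_zero]

theorem gen_zero_mem {m : ℕ} {x : TensorAlgebra k V} (hx : x ∈ tensorPow k V (2 + m)) :
    gen R 0 x ∈ tensorPow k V (2 + m) := by
  refine tensorPow_add_induction (P := fun x => gen R 0 x ∈ tensorPow k V (2 + m))
    (fun y hy w hw => ?_) (fun x y hx hy => ?_) hx
  · obtain ⟨z, rfl⟩ := exists_pairEmb hy
    rw [gen_zero_pairEmb]
    exact mul_mem_tensorPow (pairEmb_mem _) hw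
  · rw [map_add]
    exact add_mem hx hy

theorem gen_mem {m i : ℕ} {x : TensorAlgebra k V} (hx : x ∈ tensorPow k V m) :
    gen R i x ∈ tensorPow k V m := by
  rcases Nat.lt_or_ge m (i + 2) with h | h
  · rw [gen_apply_zero_of_lt R h hx]
    exact zero_mem _
  · obtain ⟨l, rfl⟩ := Nat.exists_eq_add_of_le h
    rw [add_assoc] at hx ⊢
    refine tensorPow_add_induction (P := fun x => gen R i x ∈ tensorPow k V (i + (2 + l)))
      (fun y hy w hw => ?_) (fun x y hx hy => ?_) hx
    · rw [← add_zero i, gen_mul_left R 0 hy, add_zero]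
      exact mul_mem_tensorPow hy (gen_zero_mem R hw)
    · rw [map_add]
      exact add_mem hx hy

theorem gen_zero_mul {m : ℕ} {x : TensorAlgebra k V} (hx : x ∈ tensorPow k V (2 + m))
    (w : TensorAlgebra k V) : gen R 0 (x * w) = gen R 0 x * w := by
  refine tensorPow_add_induction (P := fun x => gen R 0 (x * w) = gen R 0 x * w)
    (fun y hy u _ => ?_) (fun x y hx hy => ?_) hx
  · obtain ⟨z, rfl⟩ := exists_pairEmb hy
    rw [mul_assoc, gen_zero_pairEmb, gen_zero_pairEmb, mul_assoc]
  · rw [add_mul, map_add, hx, hy, map_add, add_mul]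

theorem gen_mul_right {m i : ℕ} (h : i + 2 ≤ m) {x : TensorAlgebra k V}
    (hx : x ∈ tensorPow k V m) (w : TensorAlgebra k V) : gen R i (x * w) = gen R i x * w := by
  obtain ⟨l, rfl⟩ := Nat.exists_eq_add_of_le h
  rw [add_assoc] at hx
  refine tensorPow_add_induction (P := fun x => gen R i (x * w) = gen R i x * w)
    (fun y hy u hu => ?_) (fun x y hx hy => ?_) hx
  · have h1 := gen_mul_left R 0 hy
    rw [add_zero] at h1
    rw [mul_assoc, h1, h1, gen_zero_mul R hu, mul_assoc]
  · rw [add_mul, map_add, hx, hy, map_add, add_mul]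

theorem gen_comm {i j : ℕ} (h : i + 2 ≤ j) : gen R i * gen R j = gen R j * gen R i := by
  refine linearMap_ext_pow fun m x hx => ?_
  simp only [Module.End.mul_apply]
  rcases Nat.lt_or_ge m (j + 2) with hm | hm
  · rw [gen_apply_zero_of_lt R hm hx, gen_apply_zero_of_lt R hm (gen_mem R hx), map_zero]
  · obtain ⟨l, rfl⟩ := Nat.exists_eq_add_of_le h
    obtain ⟨l', rfl⟩ := Nat.exists_eq_add_of_le hm
    rw [show i + 2 + l + 2 + l' = i + 2 + (l + 2 + l') by omega] at hx
    rw [show i + 2 + l = i + 2 + l from rfl]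
    refine tensorPow_add_induction
      (P := fun x => gen R i (gen R (i + 2 + l) x) = gen R (i + 2 + l) (gen R i x))
      (fun y hy u hu => ?_) (fun x y hx hy => ?_) hx
    · rw [gen_mul_left R l hy, gen_mul_right R le_rfl hy, gen_mul_right R le_rfl hy,
        gen_mul_left R l (gen_mem R hy)]
    · simp only [map_add, hx, hy]

/-- The identification of `(V ⊗ V) ⊗ V` with the component of degree `3` of `T(V)`. -/
def tripleEmb : (V ⊗[k] V) ⊗[k] V →ₗ[k] TensorAlgebra k V :=
  LinearMap.mul' k (TensorAlgebra k V) ∘ₗ TensorProduct.map (pairEmb k V) ιT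

@[simp] theorem tripleEmb_tmul (z : V ⊗[k] V) (v : V) :
    tripleEmb (z ⊗ₜ v) = pairEmb k V z * ιT v := by
  simp [tripleEmb]

theorem exists_tripleEmb {x : TensorAlgebra k V} (hx : x ∈ tensorPow k V 3) :
    ∃ z : (V ⊗[k] V) ⊗[k] V, tripleEmb z = x := by
  refine tensorPow_succ_induction_right
    (P := fun x => ∃ z : (V ⊗[k] V) ⊗[k] V, tripleEmb z = x)
    (fun u y hy => ?_) (fun x y hx hy => ?_) hx
  · obtain ⟨v, rfl⟩ := exists_pairEmb hy
    exact ⟨v ⊗ₜ u, by simp⟩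
  · obtain ⟨a, rfl⟩ := hx
    obtain ⟨b, rfl⟩ := hy
    exact ⟨a + b, by simp⟩

theorem gen_zero_tripleEmb (z : (V ⊗[k] V) ⊗[k] V) (w : TensorAlgebra k V) :
    gen R 0 (tripleEmb z * w) = tripleEmb (onLeft R z) * w := by
  induction z using TensorProduct.induction_on with
  | zero => simp
  | tmul x y => simp [mul_assoc, gen_zero_pairEmb, onLeft]
  | add x y hx hy => simp only [map_add, add_mul, hx, hy]

theorem tripleEmb_assoc_symm (v : V) (z : V ⊗[k] V) :
    tripleEmb ((TensorProduct.assoc k V V V).symm (v ⊗ₜ z)) = ιT v * pairEmb k V z := by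
  induction z using TensorProduct.induction_on with
  | zero => simp
  | tmul x y => simp [mul_assoc]
  | add x y hx hy => simp only [map_add, TensorProduct.tmul_add, mul_add, hx, hy]

theorem gen_one_tripleEmb (z : (V ⊗[k] V) ⊗[k] V) (w : TensorAlgebra k V) :
    gen R 1 (tripleEmb z * w) = tripleEmb (onRight R z) * w := by
  induction z using TensorProduct.induction_on with
  | zero => simp
  | tmul x y =>
    induction x using TensorProduct.induction_on with
    | zero => simp
    | tmul u v =>
      have h1 : tripleEmb ((u ⊗ₜ[k] v) ⊗ₜ[k] y) * w = ιT u * (pairEmb k V (v ⊗ₜ y) * w) := by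
        simp [mul_assoc]
      have h2 : onRight R ((u ⊗ₜ[k] v) ⊗ₜ[k] y) =
          (TensorProduct.assoc k V V V).symm (u ⊗ₜ R (v ⊗ₜ y)) := by
        simp [onRight]
      rw [h1, h2, gen_succ_apply, gen_zero_pairEmb, tripleEmb_assoc_symm, mul_assoc]
    | add x z hx hz => simp only [map_add, TensorProduct.add_tmul, add_mul, hx, hz]
  | add x y hx hy => simp only [map_add, add_mul, hx, hy]

variable {R} {q : k}

theorem IsHeckeSymmetry.isBraidSeq (hR : IsHeckeSymmetry q R) : IsBraidSeq (gen R) where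
  comm i j h := gen_comm R h
  braid i := by
    refine linearMap_ext_pow fun m x hx => ?_
    simp only [Module.End.mul_apply]
    rcases Nat.lt_or_ge m (i + 3) with hm | hm
    · rw [gen_apply_zero_of_lt R (i := i + 1) (by omega) (gen_mem R hx),
        gen_apply_zero_of_lt R (i := i + 1) (by omega) hx]
      simp
    · obtain ⟨l, rfl⟩ := Nat.exists_eq_add_of_le hm
      rw [add_assoc] at hx
      refine tensorPow_add_induction (P := fun x => gen R i (gen R (i + 1) (gen R i x)) =
        gen R (i + 1) (gen R i (gen R (i + 1) x))) (fun y hy u hu => ?_) (fun x y hx hy => ?_) hx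
      · have h0 := gen_mul_left R 0 hy
        have h1 := gen_mul_left R 1 hy
        rw [add_zero] at h0
        rw [h0, h1, h0, h1, h0, h1]
        congr 1
        refine tensorPow_add_induction (P := fun x => gen R 0 (gen R 1 (gen R 0 x)) =
          gen R 1 (gen R 0 (gen R 1 x))) (fun y hy u _ => ?_) (fun x y hx hy => ?_) hu
        · obtain ⟨z, rfl⟩ := exists_tripleEmb hy
          simp only [gen_zero_tripleEmb, gen_one_tripleEmb]
          have := LinearMap.congr_fun hR.braid z
          simp only [Module.End.mul_apply] at this
          rw [this]
        · simp only [map_add, hx, hy]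
      · simp only [map_add, hx, hy]

theorem IsHeckeSymmetry.sq_apply (hR : IsHeckeSymmetry q R) (z : V ⊗[k] V) :
    R (R z) = (q - 1) • R z + q • z := by
  have := LinearMap.congr_fun hR.hecke z
  simp only [LinearMap.comp_apply, LinearMap.add_apply, LinearMap.sub_apply, map_add,
    LinearMap.smul_apply, LinearMap.id_apply, LinearMap.zero_apply] at this
  rw [← sub_eq_zero, ← this]
  module

theorem IsHeckeSymmetry.gen_gen (hR : IsHeckeSymmetry q R) {m i : ℕ} (h : i + 2 ≤ m)
    {x : TensorAlgebra k V} (hx : x ∈ tensorPow k V m) :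
    gen R i (gen R i x) = (q - 1) • gen R i x + q • x := by
  obtain ⟨l, rfl⟩ := Nat.exists_eq_add_of_le h
  rw [add_assoc] at hx
  refine tensorPow_add_induction
    (P := fun x => gen R i (gen R i x) = (q - 1) • gen R i x + q • x)
    (fun y hy u hu => ?_) (fun x y hx hy => ?_) hx
  · have h0 := gen_mul_left R 0 hy
    rw [add_zero] at h0
    rw [h0, h0, ← mul_smul_comm, ← mul_smul_comm, ← mul_add]
    congr 1
    refine tensorPow_add_induction
      (P := fun x => gen R 0 (gen R 0 x) = (q - 1) • gen R 0 x + q • x)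
      (fun y hy u _ => ?_) (fun x y hx hy => ?_) hu
    · obtain ⟨z, rfl⟩ := exists_pairEmb hy
      simp only [gen_zero_pairEmb, hR.sq_apply, map_add, map_smul, add_mul, smul_mul_assoc]
    · simp only [map_add, hx, hy, smul_add]
      abel
  · simp only [map_add, hx, hy, smul_add]
    abel

/-- The Hecke relation reads `T_i (T_i - (q - 1)) = q` with `q ≠ 0`. Injectivity of generators, and
so of cycles, is used below to cancel crossings. -/
theorem IsHeckeSymmetry.gen_injOn (hR : IsHeckeSymmetry q R) {m i : ℕ} (h : i + 2 ≤ m)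
    {x : TensorAlgebra k V} (hx : x ∈ tensorPow k V m) (h0 : gen R i x = 0) : x = 0 := by
  have := hR.gen_gen h hx
  rw [h0, map_zero, smul_zero, zero_add] at this
  exact (smul_eq_zero.1 this.symm).resolve_left hR.q_ne_zero

theorem cycle_gen_mem {m : ℕ} (i l : ℕ) {x : TensorAlgebra k V} (hx : x ∈ tensorPow k V m) :
    cycle (gen R) i l x ∈ tensorPow k V m := by
  induction l with
  | zero => simpa using hx
  | succ l ih => rw [cycle_succ]; exact gen_mem R ih

theorem rcycle_gen_mem {m : ℕ} (i l : ℕ) {x : TensorAlgebra k V} (hx : x ∈ tensorPow k V m) :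
    rcycle (gen R) i l x ∈ tensorPow k V m := by
  induction l generalizing x with
  | zero => simpa using hx
  | succ l ih => rw [rcycle_succ]; exact ih (gen_mem R hx)

theorem asym_gen_mem {m : ℕ} (s a b : ℕ) {x : TensorAlgebra k V} (hx : x ∈ tensorPow k V m) :
    asym q (gen R) s a b x ∈ tensorPow k V m := by
  induction a generalizing b x with
  | zero => simpa using hx
  | succ a iha =>
    induction b with
    | zero => simpa using hx
    | succ b ihb =>
      rw [asym_succ_succ]
      exact add_mem (Submodule.smul_mem _ _ ihb)
        (Submodule.smul_mem _ _ (iha _ (cycle_gen_mem _ _ hx)))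

theorem IsHeckeSymmetry.cycle_injOn (hR : IsHeckeSymmetry q R) {m i l : ℕ} (h : i + l + 1 ≤ m)
    {x : TensorAlgebra k V} (hx : x ∈ tensorPow k V m) (h0 : cycle (gen R) i l x = 0) :
    x = 0 := by
  induction l with
  | zero => simpa using h0
  | succ l ih =>
    exact ih (by omega) (hR.gen_injOn (i := i + l) (by omega) (cycle_gen_mem _ _ hx) h0)

theorem IsHeckeSymmetry.rcycle_injOn (hR : IsHeckeSymmetry q R) {m i l : ℕ} (h : i + l + 1 ≤ m)
    {x : TensorAlgebra k V} (hx : x ∈ tensorPow k V m) (h0 : rcycle (gen R) i l x = 0) :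
    x = 0 := by
  induction l generalizing x with
  | zero => simpa using h0
  | succ l ih =>
    exact hR.gen_injOn (i := i + l) (by omega) hx (ih (by omega) (gen_mem R hx) h0)

variable (R) in
theorem conL_gen (f : Module.Dual k V) (i : ℕ) (x : TensorAlgebra k V) :
    conL f (gen R (i + 1) x) = gen R i (conL f x) := by
  suffices h : conL f ∘ₗ gen R (i + 1) = gen R i ∘ₗ conL f from LinearMap.congr_fun h x
  refine linearMap_ext_left ?_ fun v w => by simp [gen_succ_apply]
  simp [gen_apply_zero_of_lt R (i := i + 1) (by omega) one_mem_tensorPow]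

variable (R) in
theorem conR_gen (f : Module.Dual k V) {i m : ℕ} (h : i + 2 ≤ m) {x : TensorAlgebra k V}
    (hx : x ∈ tensorPow k V (m + 1)) : conR f (gen R i x) = gen R i (conR f x) := by
  refine tensorPow_succ_induction_right
    (P := fun x => conR f (gen R i x) = gen R i (conR f x))
    (fun v y hy => ?_) (fun x y hx hy => ?_) hx
  · rw [gen_mul_right R h hy]
    simp
  · simp only [map_add, hx, hy]

theorem tmap_gen {χ : V →ₗ[k] V}
    (hχ : TensorProduct.map χ χ ∘ₗ R = R ∘ₗ TensorProduct.map χ χ) (i : ℕ)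
    (x : TensorAlgebra k V) : tmap χ (gen R i x) = gen R i (tmap χ x) := by
  suffices h : (tmap χ).toLinearMap ∘ₗ gen R i = gen R i ∘ₗ (tmap χ).toLinearMap from
    LinearMap.congr_fun h x
  induction i with
  | zero =>
    refine linearMap_ext_pow fun m x hx => ?_
    rcases Nat.lt_or_ge m 2 with hm | hm
    · simp [gen_apply_zero_of_lt R hm hx, gen_apply_zero_of_lt R hm (tmap_mem χ hx)]
    · obtain ⟨l, rfl⟩ := Nat.exists_eq_add_of_le hm
      refine tensorPow_add_induction (P := fun x => ((tmap χ).toLinearMap ∘ₗ gen R 0) x =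
        (gen R 0 ∘ₗ (tmap χ).toLinearMap) x) (fun y hy u _ => ?_) (fun x y hx hy => ?_) hx
      · obtain ⟨z, rfl⟩ := exists_pairEmb hy
        have := LinearMap.congr_fun hχ z
        simp only [LinearMap.comp_apply] at this
        simp [gen_zero_pairEmb, tmap_pairEmb, this]
      · rw [map_add, hx, hy, map_add]
  | succ i ih =>
    refine linearMap_ext_left ?_ fun v w => ?_
    · simp [gen_apply_zero_of_lt R (i := i + 1) (by omega) one_mem_tensorPow]
    · have := LinearMap.congr_fun ih w
      simp only [LinearMap.comp_apply, AlgHom.toLinearMap_apply] at this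
      simp [gen_succ_apply, this]

/-! ### Intertwining maps for antisymmetrizers -/

/-- A linear map `f` with `f (T_{s+j} x) = T_{s'+j} f x` on an invariant subspace carries over to
the antisymmetrizers. -/
theorem asym_intertwine {M N : Type*} [AddCommGroup M] [Module k M] [AddCommGroup N] [Module k N]
    {T : ℕ → Module.End k M} {T' : ℕ → Module.End k N} (P : Submodule k M) (f : M →ₗ[k] N)
    {s s' : ℕ} (a b : ℕ) (hP : ∀ j, j + 1 < a + b → ∀ x ∈ P, T (s + j) x ∈ P)
    (h : ∀ j, j + 1 < a + b → ∀ x ∈ P, f (T (s + j) x) = T' (s' + j) (f x)) {x : M} (hx : x ∈ P) :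
    f (asym q T s a b x) = asym q T' s' a b (f x) := by
  have hc : ∀ i l, i + l < a + b → ∀ x ∈ P, cycle T (s + i) l x ∈ P ∧
      f (cycle T (s + i) l x) = cycle T' (s' + i) l (f x) := by
    intro i l
    induction l with
    | zero => intro _ x hx; simpa using hx
    | succ l ih =>
      intro hl x hx
      obtain ⟨h1, h2⟩ := ih (by omega) x hx
      rw [cycle_succ, cycle_succ, Module.End.mul_apply, Module.End.mul_apply, ← h2, add_assoc,
        add_assoc]
      exact ⟨hP _ (by omega) _ h1, h _ (by omega) _ h1⟩
  induction a generalizing b x with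
  | zero => simp
  | succ a iha =>
    induction b generalizing x with
    | zero => simp
    | succ b ihb =>
      rw [asym_succ_succ, asym_succ_succ]
      obtain ⟨h1, h2⟩ := hc a (b + 1) (by omega) x hx
      simp only [LinearMap.add_apply, LinearMap.smul_apply, map_add, map_smul,
        Module.End.mul_apply]
      rw [ihb (fun j hj => hP j (by omega)) (fun j hj => h j (by omega)) hx
        (fun i l hl => hc i l (by omega)),
        iha (b + 1) (fun j hj => hP j (by omega)) (fun j hj => h j (by omega)) h1
        (fun i l hl => hc i l (by omega)), h2]

theorem cycle_gen_mul_left {m : ℕ} (s l : ℕ) {x : TensorAlgebra k V} (hx : x ∈ tensorPow k V m)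
    (w : TensorAlgebra k V) : cycle (gen R) (m + s) l (x * w) = x * cycle (gen R) s l w := by
  induction l with
  | zero => simp
  | succ l ih =>
    rw [cycle_succ, cycle_succ, Module.End.mul_apply, Module.End.mul_apply, ih, add_assoc,
      gen_mul_left R _ hx]

theorem cycle_gen_mul_right {m s l : ℕ} (h : s + l + 1 ≤ m) {x : TensorAlgebra k V}
    (hx : x ∈ tensorPow k V m) (w : TensorAlgebra k V) :
    cycle (gen R) s l (x * w) = cycle (gen R) s l x * w := by
  induction l with
  | zero => simp
  | succ l ih =>
    rw [cycle_succ, Module.End.mul_apply, Module.End.mul_apply, ih (by omega),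
      gen_mul_right R (by omega) (cycle_gen_mem _ _ hx)]

theorem rcycle_gen_mul_left {m : ℕ} (s l : ℕ) {x : TensorAlgebra k V} (hx : x ∈ tensorPow k V m)
    (w : TensorAlgebra k V) : rcycle (gen R) (m + s) l (x * w) = x * rcycle (gen R) s l w := by
  induction l generalizing w with
  | zero => simp
  | succ l ih =>
    rw [rcycle_succ, rcycle_succ, Module.End.mul_apply, Module.End.mul_apply, add_assoc,
      gen_mul_left R _ hx, ih]

theorem rcycle_gen_mul_right {m s l : ℕ} (h : s + l + 1 ≤ m) {x : TensorAlgebra k V}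
    (hx : x ∈ tensorPow k V m) (w : TensorAlgebra k V) :
    rcycle (gen R) s l (x * w) = rcycle (gen R) s l x * w := by
  induction l generalizing x with
  | zero => simp
  | succ l ih =>
    rw [rcycle_succ, Module.End.mul_apply, Module.End.mul_apply, gen_mul_right R (by omega) hx,
      ih (by omega) (gen_mem R hx)]

variable (q)

theorem asym_gen_mul_left {m : ℕ} (s a b : ℕ) {x : TensorAlgebra k V} (hx : x ∈ tensorPow k V m)
    (w : TensorAlgebra k V) :
    asym q (gen R) (m + s) a b (x * w) = x * asym q (gen R) s a b w := by
  refine (asym_intertwine (T := gen R) (T' := gen R) (s := s) (s' := m + s) ⊤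
    (LinearMap.mulLeft k x) a b (fun _ _ _ _ => Submodule.mem_top) (fun j _ w _ => ?_)
    Submodule.mem_top).symm
  rw [LinearMap.mulLeft_apply, LinearMap.mulLeft_apply, add_assoc, gen_mul_left R _ hx]

theorem asym_gen_mul_right {m s a b : ℕ} (h : s + a + b ≤ m) {x : TensorAlgebra k V}
    (hx : x ∈ tensorPow k V m) (w : TensorAlgebra k V) :
    asym q (gen R) s a b (x * w) = asym q (gen R) s a b x * w := by
  refine (asym_intertwine (T := gen R) (T' := gen R) (s := s) (s' := s) (tensorPow k V m)
    (LinearMap.mulRight k w) a b (fun _ _ _ hx => gen_mem R hx) (fun j hj x hx => ?_) hx).symm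
  rw [LinearMap.mulRight_apply, LinearMap.mulRight_apply, gen_mul_right R (by omega) hx]

theorem tmap_asym {χ : V →ₗ[k] V}
    (hχ : TensorProduct.map χ χ ∘ₗ R = R ∘ₗ TensorProduct.map χ χ) (s a b : ℕ)
    (x : TensorAlgebra k V) :
    tmap χ (asym q (gen R) s a b x) = asym q (gen R) s a b (tmap χ x) :=
  asym_intertwine (T := gen R) (T' := gen R) ⊤ (tmap χ).toLinearMap a b
    (fun _ _ _ _ => Submodule.mem_top) (fun _ _ x _ => tmap_gen hχ _ x) Submodule.mem_top

end Generators

/-! ### The spaces Υ^(m) and the algebra structure on them -/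

section SkewTensors

variable {k : Type*} [Field k] {V : Type*} [AddCommGroup V] [Module k V]
  (q : k) (R : V ⊗[k] V →ₗ[k] V ⊗[k] V)

local notation "ιT" => TensorAlgebra.ι k

/-- The subspace `(T_i - q) V^{⊗ m}`. -/
def imGen (m i : ℕ) : Submodule k (TensorAlgebra k V) :=
  (tensorPow k V m).map (gen R i - q • LinearMap.id)

variable {q R}

theorem mem_imGen {m i : ℕ} {x : TensorAlgebra k V} :
    x ∈ imGen q R m i ↔ ∃ y ∈ tensorPow k V m, gen R i y - q • y = x := Iff.rfl

theorem mem_Upsilon {n : ℕ} {x : TensorAlgebra k V} :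
    x ∈ Upsilon q R n ↔ x ∈ tensorPow k V n ∧ ∀ i, i + 1 < n → x ∈ imGen q R n i := by
  simp only [Upsilon, Submodule.mem_inf, Submodule.mem_iInf]
  rfl

theorem mem_tensorPow_of_mem_Upsilon {n : ℕ} {x : TensorAlgebra k V} (hx : x ∈ Upsilon q R n) :
    x ∈ tensorPow k V n := (mem_Upsilon.1 hx).1

theorem mem_Upsilon_zero {x : TensorAlgebra k V} : x ∈ Upsilon q R 0 ↔ x ∈ tensorPow k V 0 := by
  simp [mem_Upsilon]

theorem mem_Upsilon_one {x : TensorAlgebra k V} : x ∈ Upsilon q R 1 ↔ x ∈ tensorPow k V 1 := by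
  simp [mem_Upsilon]

theorem imGen_of_semiconj {m i j : ℕ} {X : Module.End k (TensorAlgebra k V)}
    (hX : ∀ x ∈ tensorPow k V m, X x ∈ tensorPow k V m)
    (h : X * gen R j = gen R i * X) {x : TensorAlgebra k V} (hx : x ∈ imGen q R m j) :
    X x ∈ imGen q R m i := by
  obtain ⟨y, hy, rfl⟩ := mem_imGen.1 hx
  refine mem_imGen.2 ⟨X y, hX y hy, ?_⟩
  rw [map_sub, map_smul]
  congr 1
  exact (LinearMap.congr_fun h y).symm

/-- Antisymmetrizing a tensor that is skew within each block makes it skew everywhere, including at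
the boundary of the blocks. The recursion at the last place handles every generator except the last;
the mirror recursion handles that one. The cycles involved carry the conditions inside blocks to
conditions inside the new blocks. No division occurs. -/
theorem asym_mem_imGen (hR : IsHeckeSymmetry q R) {m s a b : ℕ} {x : TensorAlgebra k V}
    (hx : x ∈ tensorPow k V m)
    (h : ∀ j, j + 1 < a + b → j + 1 ≠ a → x ∈ imGen q R m (s + j)) {i : ℕ} (hi : i + 1 < a + b) :
    asym q (gen R) s a b x ∈ imGen q R m (s + i) := by
  have hT := hR.isBraidSeq
  obtain ⟨N, hN⟩ : ∃ N, a + b = N := ⟨_, rfl⟩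
  induction N using Nat.strong_induction_on generalizing s a b x i with
  | _ N ih =>
    subst hN
    rcases a with _ | a
    · simpa using h i hi (by omega)
    rcases b with _ | b
    · simpa using h i hi (by omega)
    rcases Nat.lt_or_ge (i + 1) (a + 1 + b) with hi' | hi'
    · rw [asym_succ_succ]
      refine add_mem (Submodule.smul_mem _ _ ?_) (Submodule.smul_mem _ _ ?_)
      · exact ih _ (by omega) hx (fun j hj hj' => h j (by omega) hj') hi' rfl
      · refine ih _ (by omega) (cycle_gen_mem _ _ hx) (fun j hj hj' => ?_) (by omega) rfl
        rcases Nat.lt_or_ge (j + 1) a with hja | hja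
        · refine imGen_of_semiconj (fun x hx => cycle_gen_mem _ _ hx) ?_
            (h j (by omega) (by omega))
          exact (commute_cycle fun l _ => hT.commute (by omega)).symm
        · obtain ⟨l, rfl⟩ := Nat.exists_eq_add_of_le (show a ≤ j by omega)
          refine imGen_of_semiconj (fun x hx => cycle_gen_mem _ _ hx) ?_
            (h (a + l + 1) (by omega) (by omega))
          have := hT.cycle_mul (i := s + a) (j := l) (m := b + 1) (by omega)
          simpa only [add_assoc] using this
    · rcases i with _ | i
      -- With two letters in all, the antisymmetrizer is `q - T`, so its value at `x` is `T - q` at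
      -- `-x`.
      · obtain ⟨rfl, rfl⟩ : a = 0 ∧ b = 0 := by omega
        refine mem_imGen.2 ⟨-x, neg_mem hx, ?_⟩
        simp only [asym_succ_succ, asym_zero_left, asym_zero_right, cycle_one, map_neg,
          LinearMap.add_apply, LinearMap.smul_apply, Module.End.mul_apply, Module.End.one_apply,
          zero_add, pow_one, add_zero]
        module
      · rw [asym_mirror q hT, show s + (i + 1) = s + 1 + i by omega]
        refine add_mem (Submodule.smul_mem _ _ ?_) (Submodule.smul_mem _ _ ?_)
        · refine ih _ (by omega) hx (fun j hj hj' => ?_) (by omega) rfl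
          rw [add_assoc, add_comm 1 j]
          exact h _ (by omega) (by omega)
        · refine ih _ (by omega) (rcycle_gen_mem _ _ hx) (fun j hj hj' => ?_) (by omega) rfl
          rw [add_assoc, add_comm 1 j]
          rcases Nat.lt_or_ge (j + 1) (a + 1) with hja | hja
          · refine imGen_of_semiconj (fun x hx => rcycle_gen_mem _ _ hx) ?_
              (h j (by omega) (by omega))
            exact (hT.mul_rcycle hja).symm
          · refine imGen_of_semiconj (fun x hx => rcycle_gen_mem _ _ hx) ?_
              (h (j + 1) (by omega) (by omega))
            exact (commute_rcycle fun l _ => hT.commute (by omega)).symm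

theorem mul_right_mem_imGen {m i : ℕ} (h : i + 2 ≤ m) {x : TensorAlgebra k V}
    (hx : x ∈ imGen q R m i) {l : ℕ} {w : TensorAlgebra k V} (hw : w ∈ tensorPow k V l) :
    x * w ∈ imGen q R (m + l) i := by
  obtain ⟨y, hy, rfl⟩ := mem_imGen.1 hx
  refine mem_imGen.2 ⟨y * w, mul_mem_tensorPow hy hw, ?_⟩
  rw [gen_mul_right R h hy, sub_mul, smul_mul_assoc]

theorem mul_left_mem_imGen {m i : ℕ} {x : TensorAlgebra k V}
    (hx : x ∈ imGen q R m i) {l : ℕ} {w : TensorAlgebra k V} (hw : w ∈ tensorPow k V l) :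
    w * x ∈ imGen q R (l + m) (l + i) := by
  obtain ⟨y, hy, rfl⟩ := mem_imGen.1 hx
  refine mem_imGen.2 ⟨w * y, mul_mem_tensorPow hw hy, ?_⟩
  rw [gen_mul_left R _ hw, mul_sub, mul_smul_comm]

theorem asym_mul_mem_Upsilon (hR : IsHeckeSymmetry q R) {a b : ℕ} {x y : TensorAlgebra k V}
    (hx : x ∈ Upsilon q R a) (hy : y ∈ Upsilon q R b) :
    asym q (gen R) 0 a b (x * y) ∈ Upsilon q R (a + b) := by
  obtain ⟨hx, hx'⟩ := mem_Upsilon.1 hx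
  obtain ⟨hy, hy'⟩ := mem_Upsilon.1 hy
  refine mem_Upsilon.2 ⟨asym_gen_mem _ _ _ (mul_mem_tensorPow hx hy), fun i hi => ?_⟩
  rw [← zero_add i]
  refine asym_mem_imGen hR (mul_mem_tensorPow hx hy) (fun j hj hja => ?_) hi
  rw [zero_add]
  rcases Nat.lt_or_ge (j + 1) a with h | h
  · exact mul_right_mem_imGen (by omega) (hx' j h) hy
  · obtain ⟨l, rfl⟩ := Nat.exists_eq_add_of_le (show a ≤ j by omega)
    exact mul_left_mem_imGen (hy' l (by omega)) hx

theorem star_eq_asym (a b : ℕ) (x y : TensorAlgebra k V) :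
    star q R a b x y = asym q (gen R) 0 a b (x * y) := by
  rw [star, antisym_eq_asym]

theorem star_mem_Upsilon (hR : IsHeckeSymmetry q R) {a b : ℕ} {x y : TensorAlgebra k V}
    (hx : x ∈ Upsilon q R a) (hy : y ∈ Upsilon q R b) :
    star q R a b x y ∈ Upsilon q R (a + b) := by
  rw [star_eq_asym]
  exact asym_mul_mem_Upsilon hR hx hy

theorem star_assoc (hR : IsHeckeSymmetry q R) {a b c : ℕ} {x y z : TensorAlgebra k V}
    (hx : x ∈ Upsilon q R a) (hy : y ∈ Upsilon q R b) :
    star q R (a + b) c (star q R a b x y) z = star q R a (b + c) x (star q R b c y z) := by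
  have hx := mem_tensorPow_of_mem_Upsilon hx
  have hy := mem_tensorPow_of_mem_Upsilon hy
  have h := LinearMap.congr_fun (asym_assoc q hR.isBraidSeq 0 a b c) (x * y * z)
  simp only [Module.End.mul_apply, zero_add] at h
  have h1 := asym_gen_mul_left (R := R) q 0 b c hx (y * z)
  rw [add_zero] at h1
  rw [asym_gen_mul_right q (by omega) (mul_mem_tensorPow hx hy), mul_assoc, h1] at h
  simp only [star_eq_asym]
  exact h

/-- The product of vectors recovers `R`, so an operator compatible with ⋆ in degree 2 commutes with
`R`. -/
theorem star_one_one (v w : V) :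
    star q R 1 1 (ιT v) (ιT w) = pairEmb k V (q • (v ⊗ₜ w) - R (v ⊗ₜ w)) := by
  have h := gen_zero_pairEmb R (v ⊗ₜ w) 1
  simp only [mul_one, pairEmb_tmul] at h
  simp [star_eq_asym, asym_succ_succ q (gen R) 0 0 0, h, cycle_one, sub_eq_add_neg]

/-- This is `(T_i + 1)(T_i - q) = 0`. The image of `T_i - q` may be smaller than the kernel of `T_i
+ 1` when `q = -1`, so membership in Υ has to be tracked through images. -/
theorem gen_eq_neg (hR : IsHeckeSymmetry q R) {n i : ℕ} (hi : i + 1 < n) {x : TensorAlgebra k V}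
    (hx : x ∈ Upsilon q R n) : gen R i x = -x := by
  obtain ⟨y, hy, rfl⟩ := mem_imGen.1 ((mem_Upsilon.1 hx).2 i hi)
  rw [map_sub, map_smul, hR.gen_gen (by omega) hy]
  module

theorem cycle_eq_neg_one_pow (hR : IsHeckeSymmetry q R) {n i l : ℕ} (hi : i + l < n)
    {x : TensorAlgebra k V} (hx : x ∈ Upsilon q R n) :
    cycle (gen R) i l x = (-1 : k) ^ l • x := by
  induction l with
  | zero => simp
  | succ l ih =>
    rw [cycle_succ, Module.End.mul_apply, ih (by omega), map_smul, gen_eq_neg hR (by omega) hx]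
    module

theorem rcycle_eq_neg_one_pow (hR : IsHeckeSymmetry q R) {n i l : ℕ} (hi : i + l < n)
    {x : TensorAlgebra k V} (hx : x ∈ Upsilon q R n) :
    rcycle (gen R) i l x = (-1 : k) ^ l • x := by
  induction l with
  | zero => simp
  | succ l ih =>
    rw [rcycle_succ, Module.End.mul_apply, gen_eq_neg hR (by omega) hx, map_neg, ih (by omega)]
    module

theorem conL_mem_Upsilon (f : Module.Dual k V) {n : ℕ} {x : TensorAlgebra k V}
    (hx : x ∈ Upsilon q R (n + 1)) : conL f x ∈ Upsilon q R n := by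
  obtain ⟨hx, hx'⟩ := mem_Upsilon.1 hx
  refine mem_Upsilon.2 ⟨conL_mem f hx, fun i hi => ?_⟩
  obtain ⟨y, hy, rfl⟩ := mem_imGen.1 (hx' (i + 1) (by omega))
  exact mem_imGen.2 ⟨conL f y, conL_mem f hy, by rw [map_sub, map_smul, conL_gen]⟩

/-- Skewness is asked only in the first `n` letters. This form is needed for the braiding of a
vector past the volume element, which is not skew at its last letter. -/
theorem conR_mem_Upsilon' (f : Module.Dual k V) {n : ℕ} {x : TensorAlgebra k V}
    (hx : x ∈ tensorPow k V (n + 1)) (hx' : ∀ i, i + 1 < n → x ∈ imGen q R (n + 1) i) :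
    conR f x ∈ Upsilon q R n := by
  refine mem_Upsilon.2 ⟨conR_mem f hx, fun i hi => ?_⟩
  obtain ⟨y, hy, rfl⟩ := mem_imGen.1 (hx' i hi)
  exact mem_imGen.2 ⟨conR f y, conR_mem f hy, by
    rw [map_sub, map_smul, conR_gen R f (by omega) hy]⟩

theorem conR_mem_Upsilon (f : Module.Dual k V) {n : ℕ} {x : TensorAlgebra k V}
    (hx : x ∈ Upsilon q R (n + 1)) : conR f x ∈ Upsilon q R n :=
  conR_mem_Upsilon' f (mem_Upsilon.1 hx).1 fun i hi => (mem_Upsilon.1 hx).2 i (by omega)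

theorem Upsilon_eq_bot_of_lt [FiniteDimensional k V] {n m : ℕ} (h : Upsilon q R (n + 1) = ⊥)
    (hm : n < m) : Upsilon q R m = ⊥ := by
  induction m, hm using Nat.le_induction with
  | base => exact h
  | succ m _ ih =>
    refine (Submodule.eq_bot_iff _).2 fun x hx => ?_
    rw [← sum_ι_mul_conL (Module.finBasis k V) (mem_tensorPow_of_mem_Upsilon hx)]
    refine Finset.sum_eq_zero fun i _ => ?_
    have := conL_mem_Upsilon ((Module.finBasis k V).coord i) hx
    rw [ih, Submodule.mem_bot] at this
    rw [this, mul_zero]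

theorem tmap_mem_Upsilon {χ : V →ₗ[k] V}
    (hχ : TensorProduct.map χ χ ∘ₗ R = R ∘ₗ TensorProduct.map χ χ) {n : ℕ}
    {x : TensorAlgebra k V} (hx : x ∈ Upsilon q R n) : tmap χ x ∈ Upsilon q R n := by
  obtain ⟨hx, hx'⟩ := mem_Upsilon.1 hx
  refine mem_Upsilon.2 ⟨tmap_mem χ hx, fun i hi => ?_⟩
  obtain ⟨y, hy, rfl⟩ := mem_imGen.1 (hx' i hi)
  exact mem_imGen.2 ⟨tmap χ y, tmap_mem χ hy, by rw [map_sub, map_smul, tmap_gen hχ]⟩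

theorem tmap_star {χ : V →ₗ[k] V}
    (hχ : TensorProduct.map χ χ ∘ₗ R = R ∘ₗ TensorProduct.map χ χ) (a b : ℕ)
    (x y : TensorAlgebra k V) :
    tmap χ (star q R a b x y) = star q R a b (tmap χ x) (tmap χ y) := by
  rw [star_eq_asym, star_eq_asym, tmap_asym q hχ, map_mul]

end SkewTensors

/-! ### Contractions with tensors on the dual space and the pairing -/

section Contractions

variable {k : Type*} [Field k] {V : Type*} [AddCommGroup V] [Module k V]

local notation "ιT" => TensorAlgebra.ι k

variable (k V) in
/-- The contraction of a tensor with a tensor on the dual space from the left, characterized by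
`(F G) ⌟ x = G ⌟ (F ⌟ x)`. -/
def ctrL : TensorAlgebra k (Module.Dual k V) →ₗ[k] Module.End k (TensorAlgebra k V) :=
  (MulOpposite.opLinearEquiv k).symm.toLinearMap ∘ₗ
    (TensorAlgebra.lift k ((MulOpposite.opLinearEquiv k).toLinearMap ∘ₗ
      ({ toFun := conL, map_add' := conL_add, map_smul' := conL_smul } :
        Module.Dual k V →ₗ[k] Module.End k (TensorAlgebra k V)))).toLinearMap

variable (k V) in
/-- The contraction of a tensor with a tensor on the dual space from the right, characterized by
`x ⌞ (F G) = (x ⌞ G) ⌞ F`. -/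
def ctrR : TensorAlgebra k (Module.Dual k V) →ₐ[k] Module.End k (TensorAlgebra k V) :=
  TensorAlgebra.lift k
      ({ toFun := conR, map_add' := conR_add, map_smul' := conR_smul } :
        Module.Dual k V →ₗ[k] Module.End k (TensorAlgebra k V))

@[simp] theorem ctrL_one : ctrL k V 1 = 1 := by simp [ctrL]

@[simp] theorem ctrL_ι (f : Module.Dual k V) : ctrL k V (ιT f) = conL f := by simp [ctrL]

@[simp] theorem ctrL_mul (F G : TensorAlgebra k (Module.Dual k V)) :
    ctrL k V (F * G) = ctrL k V G * ctrL k V F := by simp [ctrL]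

@[simp] theorem ctrR_ι (f : Module.Dual k V) : ctrR k V (ιT f) = conR f := by simp [ctrR]

theorem commute_conL_ctrR (f : Module.Dual k V) (G : TensorAlgebra k (Module.Dual k V)) :
    Commute (conL f) (ctrR k V G) := by
  induction G using TensorAlgebra.induction with
  | algebraMap r =>
    rw [AlgHom.commutes]
    exact Algebra.commute_algebraMap_right _ _
  | ι g => rw [ctrR_ι]; exact commute_conL_conR f g
  | mul a b ha hb => rw [map_mul]; exact ha.mul_right hb
  | add a b ha hb => rw [map_add]; exact ha.add_right hb

theorem commute_ctrL_ctrR (F G : TensorAlgebra k (Module.Dual k V)) :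
    Commute (ctrL k V F) (ctrR k V G) := by
  induction F using TensorAlgebra.induction with
  | algebraMap r =>
    rw [Algebra.algebraMap_eq_smul_one, map_smul, ctrL_one]
    exact (Commute.one_left _).smul_left _
  | ι g => rw [ctrL_ι]; exact commute_conL_ctrR g G
  | mul a b ha hb => rw [ctrL_mul]; exact hb.mul_left ha
  | add a b ha hb => rw [map_add]; exact ha.add_left hb

theorem ctrL_ctrR (F G : TensorAlgebra k (Module.Dual k V)) (x : TensorAlgebra k V) :
    ctrL k V F (ctrR k V G x) = ctrR k V G (ctrL k V F x) :=
  LinearMap.congr_fun (commute_ctrL_ctrR F G) x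

variable (k V) in
/-- The pairing of `T(V*)` with `T(V)`. -/
def ev : TensorAlgebra k (Module.Dual k V) →ₗ[k] TensorAlgebra k V →ₗ[k] k :=
  (LinearMap.llcomp k _ _ _ (TensorAlgebra.algebraMapInv (M := V)).toLinearMap) ∘ₗ ctrL k V

theorem ev_apply (F : TensorAlgebra k (Module.Dual k V)) (x : TensorAlgebra k V) :
    ev k V F x = TensorAlgebra.algebraMapInv (ctrL k V F x) := rfl

theorem algebraMapInv_conR (f : Module.Dual k V) (x : TensorAlgebra k V) :
    (TensorAlgebra.algebraMapInv (conR f x) : k) = TensorAlgebra.algebraMapInv (conL f x) := by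
  suffices h : TensorAlgebra.algebraMapInv.toLinearMap ∘ₗ conR f =
      TensorAlgebra.algebraMapInv.toLinearMap ∘ₗ conL f from LinearMap.congr_fun h x
  have h0 : ∀ v : V, TensorAlgebra.algebraMapInv (ιT v) = (0 : k) := fun v => by
    simp [TensorAlgebra.algebraMapInv]
  refine linearMap_ext_pow fun m x hx => ?_
  rcases m with _ | _ | m
  · obtain ⟨c, rfl⟩ := tensorPow_zero_iff.1 hx
    simp
  · obtain ⟨v, rfl⟩ := tensorPow_one_iff.1 hx
    simp
  · refine tensorPow_succ_induction_right
      (P := fun x => (TensorAlgebra.algebraMapInv.toLinearMap ∘ₗ conR f) x =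
        (TensorAlgebra.algebraMapInv.toLinearMap ∘ₗ conL f) x)
      (fun v y hy => ?_) (fun x y hx hy => ?_) hx
    · have h1 : (TensorAlgebra.algebraMapInv y : k) = 0 := by
        refine tensorPow_succ_induction_left
          (P := fun y => (TensorAlgebra.algebraMapInv y : k) = 0)
          (fun v z _ => by rw [map_mul, h0, zero_mul]) (fun x y hx hy => by
            rw [map_add, hx, hy, add_zero]) hy
      simp [conL_mul_ι_aux f v hy, h0, h1]
    · rw [map_add, hx, hy, map_add]

/-- Left and right contractions commute and have the same constant term for a single functional. So
the pairing may be evaluated from either end, and a factor of a product on the dual side can be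
moved onto the tensor from its own side. -/
theorem ev_eq_ctrR (F : TensorAlgebra k (Module.Dual k V)) (x : TensorAlgebra k V) :
    ev k V F x = TensorAlgebra.algebraMapInv (ctrR k V F x) := by
  rw [ev_apply]
  induction F using TensorAlgebra.induction generalizing x with
  | algebraMap r => simp [Algebra.algebraMap_eq_smul_one]
  | ι g => rw [ctrL_ι, ctrR_ι, algebraMapInv_conR]
  | mul a b ha hb =>
    rw [ctrL_mul, map_mul, Module.End.mul_apply, Module.End.mul_apply, hb, ← ctrL_ctrR, ha]
  | add a b ha hb =>
    rw [map_add, LinearMap.add_apply, map_add, ha, hb, map_add, LinearMap.add_apply, map_add]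

theorem ev_mul_left (F G : TensorAlgebra k (Module.Dual k V)) (x : TensorAlgebra k V) :
    ev k V (F * G) x = ev k V G (ctrL k V F x) := by
  rw [ev_apply, ctrL_mul, Module.End.mul_apply, ev_apply]

theorem ev_mul_right (F G : TensorAlgebra k (Module.Dual k V)) (x : TensorAlgebra k V) :
    ev k V (F * G) x = ev k V F (ctrR k V G x) := by
  rw [ev_eq_ctrR, map_mul, Module.End.mul_apply, ev_eq_ctrR]

theorem ctrL_mem {a b : ℕ} {F : TensorAlgebra k (Module.Dual k V)}
    (hF : F ∈ tensorPow k (Module.Dual k V) a) {x : TensorAlgebra k V}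
    (hx : x ∈ tensorPow k V (a + b)) : ctrL k V F x ∈ tensorPow k V b := by
  induction a generalizing F x with
  | zero =>
    obtain ⟨c, rfl⟩ := tensorPow_zero_iff.1 hF
    rw [zero_add] at hx
    simpa using Submodule.smul_mem _ _ hx
  | succ a ih =>
    refine tensorPow_succ_induction_left (P := fun F => ctrL k V F x ∈ tensorPow k V b)
      (fun f G hG => ?_) (fun F G hF hG => ?_) hF
    · rw [ctrL_mul, Module.End.mul_apply, ctrL_ι]
      exact ih hG (conL_mem f (by rwa [add_right_comm]))
    · rw [map_add]
      exact add_mem hF hG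

theorem ctrR_mem {a b : ℕ} {F : TensorAlgebra k (Module.Dual k V)}
    (hF : F ∈ tensorPow k (Module.Dual k V) a) {x : TensorAlgebra k V}
    (hx : x ∈ tensorPow k V (b + a)) : ctrR k V F x ∈ tensorPow k V b := by
  induction a generalizing F x with
  | zero =>
    obtain ⟨c, rfl⟩ := tensorPow_zero_iff.1 hF
    rw [add_zero] at hx
    simpa using Submodule.smul_mem _ _ hx
  | succ a ih =>
    refine tensorPow_succ_induction_right (P := fun F => ctrR k V F x ∈ tensorPow k V b)
      (fun f G hG => ?_) (fun F G hF hG => ?_) hF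
    · rw [map_mul, Module.End.mul_apply, ctrR_ι]
      exact ih hG (conR_mem f hx)
    · rw [map_add]
      exact add_mem hF hG

theorem ctrL_mem_Upsilon {q : k} {R : V ⊗[k] V →ₗ[k] V ⊗[k] V} {a b : ℕ}
    {F : TensorAlgebra k (Module.Dual k V)}
    (hF : F ∈ tensorPow k (Module.Dual k V) a) {x : TensorAlgebra k V}
    (hx : x ∈ Upsilon q R (a + b)) : ctrL k V F x ∈ Upsilon q R b := by
  induction a generalizing F x with
  | zero =>
    obtain ⟨c, rfl⟩ := tensorPow_zero_iff.1 hF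
    rw [zero_add] at hx
    simpa using Submodule.smul_mem _ _ hx
  | succ a ih =>
    refine tensorPow_succ_induction_left (P := fun F => ctrL k V F x ∈ Upsilon q R b)
      (fun f G hG => ?_) (fun F G hF hG => ?_) hF
    · rw [ctrL_mul, Module.End.mul_apply, ctrL_ι]
      exact ih hG (conL_mem_Upsilon f (by rwa [add_right_comm]))
    · rw [map_add]
      exact add_mem hF hG

theorem ctrR_mem_Upsilon {q : k} {R : V ⊗[k] V →ₗ[k] V ⊗[k] V} {a b : ℕ}
    {F : TensorAlgebra k (Module.Dual k V)}
    (hF : F ∈ tensorPow k (Module.Dual k V) a) {x : TensorAlgebra k V}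
    (hx : x ∈ Upsilon q R (b + a)) : ctrR k V F x ∈ Upsilon q R b := by
  induction a generalizing F x with
  | zero =>
    obtain ⟨c, rfl⟩ := tensorPow_zero_iff.1 hF
    rw [add_zero] at hx
    simpa using Submodule.smul_mem _ _ hx
  | succ a ih =>
    refine tensorPow_succ_induction_right (P := fun F => ctrR k V F x ∈ Upsilon q R b)
      (fun f G hG => ?_) (fun F G hF hG => ?_) hF
    · rw [map_mul, Module.End.mul_apply, ctrR_ι]
      exact ih hG (conR_mem_Upsilon f hx)
    · rw [map_add]
      exact add_mem hF hG

theorem ctrL_mul_apply {a b : ℕ} {F : TensorAlgebra k (Module.Dual k V)}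
    (hF : F ∈ tensorPow k (Module.Dual k V) a) {x : TensorAlgebra k V}
    (hx : x ∈ tensorPow k V (a + b)) (y : TensorAlgebra k V) :
    ctrL k V F (x * y) = ctrL k V F x * y := by
  induction a generalizing F x with
  | zero =>
    obtain ⟨c, rfl⟩ := tensorPow_zero_iff.1 hF
    simp
  | succ a ih =>
    rw [add_right_comm] at hx
    refine tensorPow_succ_induction_left (P := fun F => ctrL k V F (x * y) = ctrL k V F x * y)
      (fun f G hG => ?_) (fun F G hF hG => ?_) hF
    · rw [ctrL_mul, Module.End.mul_apply, Module.End.mul_apply, ctrL_ι, conL_mul f hx,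
        ih hG (conL_mem f hx)]
    · rw [map_add, LinearMap.add_apply, hF, hG, LinearMap.add_apply, add_mul]

theorem ctrR_mul_apply {a b : ℕ} {F : TensorAlgebra k (Module.Dual k V)}
    (hF : F ∈ tensorPow k (Module.Dual k V) a) {x : TensorAlgebra k V}
    (hx : x ∈ tensorPow k V (b + a)) (y : TensorAlgebra k V) :
    ctrR k V F (y * x) = y * ctrR k V F x := by
  induction a generalizing F x with
  | zero =>
    obtain ⟨c, rfl⟩ := tensorPow_zero_iff.1 hF
    simp
  | succ a ih =>
    refine tensorPow_succ_induction_right (P := fun F => ctrR k V F (y * x) = y * ctrR k V F x)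
      (fun f G hG => ?_) (fun F G hF hG => ?_) hF
    · rw [map_mul (ctrR k V), Module.End.mul_apply, Module.End.mul_apply, ctrR_ι, conR_mul f y hx,
        ih hG (conR_mem f hx)]
    · rw [map_add, LinearMap.add_apply, hF, hG, LinearMap.add_apply, mul_add]

theorem ctrL_eq_ev_smul {a : ℕ} {F : TensorAlgebra k (Module.Dual k V)}
    (hF : F ∈ tensorPow k (Module.Dual k V) a) {x : TensorAlgebra k V}
    (hx : x ∈ tensorPow k V a) : ctrL k V F x = ev k V F x • 1 := by
  obtain ⟨c, hc⟩ := tensorPow_zero_iff.1 (ctrL_mem (b := 0) hF hx)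
  rw [ev_apply, hc]
  simp

theorem ctrR_eq_ev_smul {a : ℕ} {F : TensorAlgebra k (Module.Dual k V)}
    (hF : F ∈ tensorPow k (Module.Dual k V) a) {x : TensorAlgebra k V}
    (hx : x ∈ tensorPow k V a) : ctrR k V F x = ev k V F x • 1 := by
  obtain ⟨c, hc⟩ := tensorPow_zero_iff.1 (ctrR_mem (b := 0) hF (by rwa [zero_add]))
  rw [ev_eq_ctrR, hc]
  simp

theorem ctrL_mul_eq_smul {a : ℕ} {F : TensorAlgebra k (Module.Dual k V)}
    (hF : F ∈ tensorPow k (Module.Dual k V) a) {x : TensorAlgebra k V}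
    (hx : x ∈ tensorPow k V a) (y : TensorAlgebra k V) :
    ctrL k V F (x * y) = ev k V F x • y := by
  rw [ctrL_mul_apply (b := 0) hF hx, ctrL_eq_ev_smul hF hx, smul_one_mul]

theorem ctrR_mul_eq_smul {a : ℕ} {F : TensorAlgebra k (Module.Dual k V)}
    (hF : F ∈ tensorPow k (Module.Dual k V) a) {x : TensorAlgebra k V}
    (hx : x ∈ tensorPow k V a) (y : TensorAlgebra k V) :
    ctrR k V F (y * x) = ev k V F x • y := by
  rw [ctrR_mul_apply (b := 0) hF (by rwa [zero_add]), ctrR_eq_ev_smul hF hx, mul_smul_one]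

section

variable (R : V ⊗[k] V →ₗ[k] V ⊗[k] V)

theorem ctrL_gen {a : ℕ} {F : TensorAlgebra k (Module.Dual k V)}
    (hF : F ∈ tensorPow k (Module.Dual k V) a) (i : ℕ) (x : TensorAlgebra k V) :
    ctrL k V F (gen R (a + i) x) = gen R i (ctrL k V F x) := by
  induction a generalizing F x with
  | zero =>
    obtain ⟨c, rfl⟩ := tensorPow_zero_iff.1 hF
    simp
  | succ a ih =>
    refine tensorPow_succ_induction_left
      (P := fun F => ctrL k V F (gen R (a + 1 + i) x) = gen R i (ctrL k V F x))
      (fun f G hG => ?_) (fun F G hF hG => ?_) hF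
    · rw [ctrL_mul, Module.End.mul_apply, Module.End.mul_apply, ctrL_ι, add_right_comm, conL_gen,
        ih hG]
    · simp only [map_add, LinearMap.add_apply, hF, hG]

theorem ctrR_gen {a m i : ℕ} (h : i + 2 ≤ m) {F : TensorAlgebra k (Module.Dual k V)}
    (hF : F ∈ tensorPow k (Module.Dual k V) a) {x : TensorAlgebra k V}
    (hx : x ∈ tensorPow k V (m + a)) :
    ctrR k V F (gen R i x) = gen R i (ctrR k V F x) := by
  induction a generalizing F x with
  | zero =>
    obtain ⟨c, rfl⟩ := tensorPow_zero_iff.1 hF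
    simp
  | succ a ih =>
    refine tensorPow_succ_induction_right
      (P := fun F => ctrR k V F (gen R i x) = gen R i (ctrR k V F x))
      (fun f G hG => ?_) (fun F G hF hG => ?_) hF
    · rw [map_mul, Module.End.mul_apply, Module.End.mul_apply, ctrR_ι,
        conR_gen R f (m := m + a) (by omega) hx, ih hG (conR_mem f hx)]
    · simp only [map_add, LinearMap.add_apply, hF, hG]

theorem ctrL_asym (q : k) {c : ℕ} {F : TensorAlgebra k (Module.Dual k V)}
    (hF : F ∈ tensorPow k (Module.Dual k V) c) (s a b : ℕ) (x : TensorAlgebra k V) :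
    ctrL k V F (asym q (gen R) (c + s) a b x) = asym q (gen R) s a b (ctrL k V F x) := by
  refine asym_intertwine (T := gen R) (T' := gen R) ⊤ (ctrL k V F) a b
    (fun _ _ _ _ => Submodule.mem_top) (fun j _ x _ => ?_) Submodule.mem_top
  rw [add_assoc, ctrL_gen R hF]

theorem ctrR_asym (q : k) {c m s a b : ℕ} (h : s + a + b ≤ m)
    {F : TensorAlgebra k (Module.Dual k V)}
    (hF : F ∈ tensorPow k (Module.Dual k V) c) {x : TensorAlgebra k V}
    (hx : x ∈ tensorPow k V (m + c)) :
    ctrR k V F (asym q (gen R) s a b x) = asym q (gen R) s a b (ctrR k V F x) := by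
  refine asym_intertwine (T := gen R) (T' := gen R) (tensorPow k V (m + c)) (ctrR k V F) a b
    (fun _ _ _ hx => gen_mem R hx) (fun j _ x hx => ?_) hx
  exact ctrR_gen R (by omega) hF hx

end

theorem ctrL_tmap (χ : V →ₗ[k] V) (F : TensorAlgebra k (Module.Dual k V))
    (x : TensorAlgebra k V) :
    ctrL k V F (tmap χ x) = tmap χ (ctrL k V (tmap χ.dualMap F) x) := by
  induction F using TensorAlgebra.induction generalizing x with
  | algebraMap r => simp [Algebra.algebraMap_eq_smul_one]
  | ι g => rw [ctrL_ι, conL_tmap, tmap_ι, ctrL_ι]; rfl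
  | mul a b ha hb =>
    rw [map_mul (tmap χ.dualMap), ctrL_mul, ctrL_mul, Module.End.mul_apply, Module.End.mul_apply, ha, hb]
  | add a b ha hb => simp only [map_add, LinearMap.add_apply, ha, hb]

theorem algebraMapInv_tmap (χ : V →ₗ[k] V) (x : TensorAlgebra k V) :
    (TensorAlgebra.algebraMapInv (tmap χ x) : k) = TensorAlgebra.algebraMapInv x := by
  have : TensorAlgebra.algebraMapInv.comp (tmap χ) =
      (TensorAlgebra.algebraMapInv : TensorAlgebra k V →ₐ[k] k) := by
    ext; simp [TensorAlgebra.algebraMapInv]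
  exact AlgHom.congr_fun this x

theorem ev_tmap (χ : V →ₗ[k] V) (F : TensorAlgebra k (Module.Dual k V))
    (x : TensorAlgebra k V) : ev k V F (tmap χ x) = ev k V (tmap χ.dualMap F) x := by
  rw [ev_apply, ctrL_tmap, algebraMapInv_tmap, ev_apply]

theorem ev_ι (f : Module.Dual k V) (v : V) : ev k V (ιT f) (ιT v) = f v := by
  simp [ev_apply]

/-- Contracting a tensor on V* with a vector is adjoint to multiplication by that vector. Together
with `dualBasis_coord` this allows the basis expansions of tensors to be used on the dual side. -/
theorem ev_conL_eval (v : V) {m : ℕ} {F : TensorAlgebra k (Module.Dual k V)}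
    (hF : F ∈ tensorPow k (Module.Dual k V) (m + 1)) (x : TensorAlgebra k V) :
    ev k V (conL (Module.Dual.eval k V v) F) x = ev k V F (ιT v * x) := by
  refine tensorPow_succ_induction_left
    (P := fun F => ev k V (conL (Module.Dual.eval k V v) F) x = ev k V F (ιT v * x))
    (fun f G hG => ?_) (fun F G hF hG => ?_) hF
  · rw [conL_ι_mul, ev_mul_left, ctrL_ι, conL_ι_mul, map_smul, map_smul]
    rfl
  · simp only [map_add, LinearMap.add_apply, hF, hG]

theorem ev_conR_eval (v : V) {m : ℕ} {F : TensorAlgebra k (Module.Dual k V)}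
    (hF : F ∈ tensorPow k (Module.Dual k V) (m + 1)) (x : TensorAlgebra k V) :
    ev k V (conR (Module.Dual.eval k V v) F) x = ev k V F (x * ιT v) := by
  refine tensorPow_succ_induction_right
    (P := fun F => ev k V (conR (Module.Dual.eval k V v) F) x = ev k V F (x * ιT v))
    (fun f G hG => ?_) (fun F G hF hG => ?_) hF
  · rw [conR_mul_ι, ev_mul_right, ctrR_ι, conR_mul_ι, map_smul, map_smul]
    rfl
  · simp only [map_add, LinearMap.add_apply, hF, hG]

theorem dualBasis_coord {κ : Type*} [Fintype κ] [DecidableEq κ] (e : Module.Basis κ k V) (i : κ) :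
    e.dualBasis.coord i = Module.Dual.eval k V (e i) := by
  ext f
  simp

variable [FiniteDimensional k V]

/-- Perfectness of the pairing in one degree: the first letter is expanded in a basis, and each
component of `α` is represented by induction. -/
theorem exists_ev_eq (m : ℕ) (α : TensorAlgebra k V →ₗ[k] k) :
    ∃ F ∈ tensorPow k (Module.Dual k V) m, ∀ x ∈ tensorPow k V m, ev k V F x = α x := by
  induction m generalizing α with
  | zero =>
    refine ⟨α 1 • 1, tensorPow_zero_iff.2 ⟨_, rfl⟩, fun x hx => ?_⟩
    obtain ⟨c, rfl⟩ := tensorPow_zero_iff.1 hx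
    simp [ev_apply, mul_comm]
  | succ m ih =>
    let e := Module.finBasis k V
    choose F hF hF' using fun i => ih (α ∘ₗ LinearMap.mulLeft k (ιT (e i)))
    refine ⟨∑ i, ιT (e.coord i) * F i, sum_mem fun i _ => ι_mul_mem_tensorPow _ (hF i),
      fun x hx => ?_⟩
    conv_rhs => rw [← sum_ι_mul_conL e hx]
    rw [map_sum, map_sum, LinearMap.sum_apply]
    refine Finset.sum_congr rfl fun i _ => ?_
    rw [ev_mul_left, ctrL_ι, hF' i _ (conL_mem _ hx)]
    rfl

theorem eq_zero_of_forall_ev_eq_zero {m : ℕ} {x : TensorAlgebra k V}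
    (hx : x ∈ tensorPow k V m)
    (h : ∀ F ∈ tensorPow k (Module.Dual k V) m, ev k V F x = 0) : x = 0 := by
  refine (Module.forall_dual_apply_eq_zero_iff k x).1 fun α => ?_
  obtain ⟨F, hF, hF'⟩ := exists_ev_eq m α
  rw [← hF' x hx, h F hF]

theorem eq_of_forall_ev_eq {m : ℕ} {x y : TensorAlgebra k V}
    (hx : x ∈ tensorPow k V m) (hy : y ∈ tensorPow k V m)
    (h : ∀ F ∈ tensorPow k (Module.Dual k V) m, ev k V F x = ev k V F y) : x = y :=
  sub_eq_zero.1 (eq_zero_of_forall_ev_eq_zero (sub_mem hx hy) fun F hF => by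
    rw [map_sub, h F hF, sub_self])

theorem eq_zero_of_forall_ev_apply_eq_zero {m : ℕ} {F : TensorAlgebra k (Module.Dual k V)}
    (hF : F ∈ tensorPow k (Module.Dual k V) m)
    (h : ∀ x ∈ tensorPow k V m, ev k V F x = 0) : F = 0 := by
  induction m generalizing F with
  | zero =>
    obtain ⟨c, rfl⟩ := tensorPow_zero_iff.1 hF
    have := h 1 one_mem_tensorPow
    simp only [ev_apply, map_smul, ctrL_one, LinearMap.smul_apply, Module.End.one_apply, map_one,
      smul_eq_mul, mul_one] at this
    rw [this, zero_smul]
  | succ m ih =>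
    rw [← sum_ι_mul_conL (Module.finBasis k V).dualBasis hF]
    refine Finset.sum_eq_zero fun i _ => ?_
    rw [dualBasis_coord, ih (conL_mem _ hF) fun x hx => ?_, mul_zero]
    rw [ev_conL_eval _ hF]
    exact h _ (ι_mul_mem_tensorPow _ hx)

end Contractions

/-! ### Moving tensors past the volume element -/

section Volume

variable {k : Type*} [Field k] {V : Type*} [AddCommGroup V] [Module k V]
  {q : k} {R : V ⊗[k] V →ₗ[k] V ⊗[k] V} {n : ℕ} {t : TensorAlgebra k V}

local notation "ιT" => TensorAlgebra.ι k

/-- `t` spans the last nonzero component `Υ^{(n)}` of `Υ(V, R)`. -/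
structure IsVolume (q : k) (R : V ⊗[k] V →ₗ[k] V ⊗[k] V) (n : ℕ) (t : TensorAlgebra k V) :
    Prop where
  hecke : IsHeckeSymmetry q R
  pos : 0 < n
  mem : t ∈ Upsilon q R n
  ne_zero : t ≠ 0
  span : ∀ x ∈ Upsilon q R n, ∃ c : k, x = c • t
  above : ∀ m, n < m → Upsilon q R m = ⊥

theorem IsVolume.mem_tensorPow (h : IsVolume q R n t) : t ∈ tensorPow k V n :=
  mem_tensorPow_of_mem_Upsilon h.mem

theorem cycle_mul_pairEmb {θ : V →ₗ[k] V} (ht : t ∈ tensorPow k V n)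
    (hθ : ∀ v, cycle (gen R) 0 n (ιT v * t) = t * ιT (θ v)) (z : V ⊗[k] V) :
    cycle (gen R) 0 n (cycle (gen R) 1 n (pairEmb k V z * t)) =
      t * pairEmb k V (TensorProduct.map θ θ z) := by
  induction z using TensorProduct.induction_on with
  | zero => simp
  | tmul v w =>
    rw [pairEmb_tmul, mul_assoc]
    have h1 := cycle_gen_mul_left (R := R) 0 n (ι_mem_tensorPow v) (ιT w * t)
    rw [add_zero] at h1
    rw [h1, hθ, ← mul_assoc, cycle_gen_mul_right (m := n + 1) (by omega)
      (ι_mul_mem_tensorPow v ht), hθ, mul_assoc, TensorProduct.map_tmul, pairEmb_tmul]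
  | add x y hx hy => simp only [map_add, add_mul, mul_add, hx, hy]

theorem asym_one_left (T : ℕ → Module.End k (TensorAlgebra k V)) (b : ℕ) :
    asym q T 0 1 (b + 1) = q • asym q T 0 1 b + (-1 : k) ^ (b + 1) • cycle T 0 (b + 1) := by
  rw [asym_succ_succ]
  simp

/-- The Hecke relation resolves the innermost square of the double crossing, and the correction
terms accumulate, letter by letter, to the partial antisymmetrizer `asym q (gen R) 0 1 b`. -/
theorem rcycle_cycle (h : IsHeckeSymmetry q R) (ht : t ∈ Upsilon q R n) (v : V) {b : ℕ}
    (hb : b ≤ n) :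
    rcycle (gen R) 0 b (cycle (gen R) 0 b (ιT v * t)) =
      q ^ (b + 1) • (ιT v * t) - (q - 1) • asym q (gen R) 0 1 b (ιT v * t) := by
  have htm := mem_tensorPow_of_mem_Upsilon ht
  have hvt := ι_mul_mem_tensorPow v htm
  induction b with
  | zero => simp only [rcycle_zero, cycle_zero, asym_zero_right, Module.End.one_apply]; module
  | succ b ih =>
    have h1 : rcycle (gen R) 0 b (cycle (gen R) 0 (b + 1) (ιT v * t)) =
        (-1 : k) ^ b • cycle (gen R) 0 (b + 1) (ιT v * t) := by
      -- The product `T_0 ⋯ T_{b-1}` passes through the cycle and becomes `T_1 ⋯ T_b`. That acts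
      -- inside the skew tensor `t`, hence as (-1)^b.
      have hs : ∀ l ≤ b, rcycle (gen R) 0 l * cycle (gen R) 0 (b + 1) =
          cycle (gen R) 0 (b + 1) * rcycle (gen R) 1 l := by
        intro l hl
        induction l with
        | zero => simp
        | succ l ihl =>
          have := h.isBraidSeq.cycle_mul (i := 0) (j := l) (m := b + 1) (by omega)
          rw [rcycle_succ, mul_assoc, ← this, ← mul_assoc, ihl (by omega), mul_assoc,
            rcycle_succ, zero_add, add_comm 1 l]
      have h2 := rcycle_gen_mul_left (R := R) 0 b (ι_mem_tensorPow v) t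
      rw [add_zero, rcycle_eq_neg_one_pow h (by omega) ht] at h2
      have := LinearMap.congr_fun (hs b le_rfl) (ιT v * t)
      rw [Module.End.mul_apply, Module.End.mul_apply, h2] at this
      rw [this, mul_smul_comm, map_smul]
    rw [rcycle_succ, Module.End.mul_apply]
    have h3 : gen R (0 + b) (cycle (gen R) 0 (b + 1) (ιT v * t)) =
        (q - 1) • cycle (gen R) 0 (b + 1) (ιT v * t) + q • cycle (gen R) 0 b (ιT v * t) := by
      rw [cycle_succ, Module.End.mul_apply]
      exact h.gen_gen (by omega) (cycle_gen_mem _ _ hvt)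
    rw [h3, map_add, map_smul, map_smul, h1, ih (by omega), asym_one_left]
    simp only [LinearMap.add_apply, LinearMap.smul_apply]
    module

theorem IsVolume.star_eq_zero (h : IsVolume q R n t) {a b : ℕ} (hab : n < a + b)
    {x y : TensorAlgebra k V} (hx : x ∈ Upsilon q R a) (hy : y ∈ Upsilon q R b) :
    asym q (gen R) 0 a b (x * y) = 0 := by
  have := asym_mul_mem_Upsilon h.hecke hx hy
  rwa [h.above _ hab, Submodule.mem_bot] at this

/-- For a full pass the correction term in `rcycle_cycle` is a multiple of v ⋆ t, which has degree
above the top and vanishes. So the two crossings are inverse to each other up to q^(n+1). -/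
theorem IsVolume.rcycle_mul_ι (h : IsVolume q R n t) {θ : V ≃ₗ[k] V}
    (hθ : ∀ v, cycle (gen R) 0 n (ιT v * t) = t * ιT (θ v)) (v : V) :
    rcycle (gen R) 0 n (t * ιT v) = ιT ((q ^ (n + 1) • θ.symm.toLinearMap) v) * t := by
  have h1 := rcycle_cycle h.hecke h.mem (θ.symm v) le_rfl
  rw [hθ, LinearEquiv.apply_symm_apply, h.star_eq_zero (by omega)
    (mem_Upsilon_one.2 (ι_mem_tensorPow _)) h.mem, smul_zero, sub_zero] at h1
  rw [h1]
  simp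

variable [FiniteDimensional k V]

theorem IsVolume.exists_ev_eq_one (h : IsVolume q R n t) :
    ∃ F ∈ tensorPow k (Module.Dual k V) n, ev k V F t = 1 := by
  by_contra! hF
  refine h.ne_zero (eq_zero_of_forall_ev_eq_zero h.mem_tensorPow fun F hF' => ?_)
  by_contra h0
  exact hF ((ev k V F t)⁻¹ • F) (Submodule.smul_mem _ _ hF') (by simp [h0])

/-- A functional taking the value `1` on `t`. -/
noncomputable def IsVolume.functional (h : IsVolume q R n t) :
    TensorAlgebra k V →ₗ[k] k := ev k V h.exists_ev_eq_one.choose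

theorem IsVolume.functional_smul (h : IsVolume q R n t) {x : TensorAlgebra k V}
    (hx : x ∈ Upsilon q R n) : h.functional x • t = x := by
  obtain ⟨c, rfl⟩ := h.span x hx
  have : h.functional t = 1 := h.exists_ev_eq_one.choose_spec.2
  rw [map_smul, this, smul_eq_mul, mul_one]

theorem IsVolume.functional_self (h : IsVolume q R n t) : h.functional t = 1 :=
  h.exists_ev_eq_one.choose_spec.2

theorem IsVolume.mul_left_cancel (h : IsVolume q R n t) {x y : TensorAlgebra k V}
    (hxy : t * x = t * y) : x = y := by
  obtain ⟨F, hF, hF1⟩ := h.exists_ev_eq_one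
  have := congrArg (ctrL k V F) hxy
  rwa [ctrL_mul_eq_smul hF h.mem_tensorPow, ctrL_mul_eq_smul hF h.mem_tensorPow, hF1, one_smul,
    one_smul] at this

/-! ### The braiding with the volume element -/

/-- The cycle moves the skewness of `t` from the last `n` letters to the first `n`, so the image
lies in t ⊗ V. Invertibility follows from injectivity of the crossings in finite dimension. -/
theorem IsVolume.exists_theta (h : IsVolume q R n t) :
    ∃ θ : V ≃ₗ[k] V, ∀ v, cycle (gen R) 0 n (ιT v * t) = t * ιT (θ v) := by
  have hT := h.hecke.isBraidSeq
  let e := Module.finBasis k V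
  let c : Module.End k (TensorAlgebra k V) := cycle (gen R) 0 n
  -- Contracting the last letter of the image with a coordinate leaves a multiple of `t`; the
  -- coefficient, read by `h.functional`, is that coordinate of θ(v).
  let θ : V →ₗ[k] V := ∑ i, (h.functional ∘ₗ conR (e.coord i) ∘ₗ c ∘ₗ
    LinearMap.mulRight k t ∘ₗ ιT).smulRight (e i)
  have hθ : ∀ v, cycle (gen R) 0 n (ιT v * t) = t * ιT (θ v) := by
    intro v
    have hm : c (ιT v * t) ∈ tensorPow k V (n + 1) :=
      cycle_gen_mem _ _ (ι_mul_mem_tensorPow v h.mem_tensorPow)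
    have hi : ∀ i, i + 1 < n → c (ιT v * t) ∈ imGen q R (n + 1) i := by
      intro i hi
      refine imGen_of_semiconj (j := i + 1) (fun x hx => cycle_gen_mem _ _ hx) ?_ ?_
      · have := hT.cycle_mul (i := 0) (j := i) (m := n) hi
        rwa [zero_add] at this
      · have := mul_left_mem_imGen ((mem_Upsilon.1 h.mem).2 i hi) (ι_mem_tensorPow v)
        rwa [add_comm 1, add_comm 1] at this
    rw [← sum_conR_mul_ι e hm]
    simp only [θ, LinearMap.sum_apply, map_sum, LinearMap.smulRight_apply, map_smul,
      Finset.mul_sum]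
    refine Finset.sum_congr rfl fun i _ => ?_
    rw [← h.functional_smul (conR_mem_Upsilon' (e.coord i) hm hi), smul_mul_assoc, mul_smul_comm]
    rfl
  have hinj : Function.Injective θ := by
    refine (injective_iff_map_eq_zero θ).2 fun v hv => ?_
    have h0 : cycle (gen R) 0 n (ιT v * t) = 0 := by rw [hθ, hv, map_zero, mul_zero]
    have h1 := h.hecke.cycle_injOn (by omega) (ι_mul_mem_tensorPow v h.mem_tensorPow) h0
    obtain ⟨F, hF, hF1⟩ := h.exists_ev_eq_one
    have := congrArg (ctrR k V F) h1
    rw [ctrR_mul_eq_smul hF h.mem_tensorPow, hF1, one_smul, map_zero] at this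
    exact (TensorAlgebra.ι_eq_zero_iff k v).1 this
  exact ⟨LinearEquiv.ofInjectiveEndo θ hinj, hθ⟩

/-- Two strands may cross before or after both pass `t`, which is `IsBraidSeq.mul_cycle_mul_cycle`;
then `t` is cancelled on the left. -/
theorem IsVolume.theta_comm (h : IsVolume q R n t) {θ : V →ₗ[k] V}
    (hθ : ∀ v, cycle (gen R) 0 n (ιT v * t) = t * ιT (θ v)) :
    TensorProduct.map θ θ ∘ₗ R = R ∘ₗ TensorProduct.map θ θ := by
  ext1
  ext1 v
  ext1 w
  have hb := LinearMap.congr_fun (h.hecke.isBraidSeq.mul_cycle_mul_cycle 0 n)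
    (pairEmb k V (v ⊗ₜ w) * t)
  simp only [Module.End.mul_apply, zero_add] at hb
  rw [gen_zero_pairEmb, cycle_mul_pairEmb h.mem_tensorPow hθ,
    cycle_mul_pairEmb h.mem_tensorPow hθ] at hb
  have h1 := gen_mul_left R 0 h.mem_tensorPow
    (pairEmb k V (TensorProduct.map θ θ (v ⊗ₜ[k] w)) * 1)
  rw [gen_zero_pairEmb, add_zero, mul_one, mul_one, hb] at h1
  exact pairEmb_injective (h.mul_left_cancel h1)

/-! ### Products with the volume element -/

/-- The start is u ⋆ t = 0 for degree reasons. Each step shortens the part of `t` that is mixed with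
`u` by one letter: in `asym_succ_succ` the left side is known to vanish and so does the last
summand, leaving an invertible multiple of the wanted term. -/
theorem IsVolume.asym_mul_right_eq_zero (h : IsVolume q R n t) {θ : V →ₗ[k] V}
    (hθ : ∀ v, cycle (gen R) 0 n (ιT v * t) = t * ιT (θ v)) {j l m : ℕ} (hl : l + j = n)
    (hm : j < m) {u : TensorAlgebra k V} (hu : u ∈ Upsilon q R m) :
    asym q (gen R) 0 m l (u * t) = 0 := by
  have hT := h.hecke.isBraidSeq
  induction j generalizing l m u with
  | zero =>
    obtain rfl : l = n := by omega
    exact h.star_eq_zero (by omega) hu h.mem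
  | succ j ih =>
    obtain ⟨m, rfl⟩ := Nat.exists_eq_succ_of_ne_zero (show m ≠ 0 by omega)
    have hut := mul_mem_tensorPow (mem_tensorPow_of_mem_Upsilon hu) h.mem_tensorPow
    have h0 := ih (l := l + 1) (by omega) (by omega) hu
    -- The crossing is completed over the remaining `j` letters of `t`, which commutes with the
    -- antisymmetrizer and is injective. Now the last letter of `u` has passed all of `t`, and the
    -- inductive hypothesis applies to the shortened `u`.
    have hz : asym q (gen R) 0 m (l + 1) (cycle (gen R) m (l + 1) (u * t)) = 0 := by
      refine h.hecke.cycle_injOn (i := m + (l + 1)) (l := j) (by omega)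
        (asym_gen_mem _ _ _ (cycle_gen_mem _ _ hut)) ?_
      have hc : Commute (cycle (gen R) (m + (l + 1)) j) (asym q (gen R) 0 m (l + 1)) :=
        asym_commute q _ _ fun i hi => (commute_cycle fun i' _ => hT.commute (by omega)).symm
      have h1 := LinearMap.congr_fun hc.eq (cycle (gen R) m (l + 1) (u * t))
      have h2 := LinearMap.congr_fun (cycle_add (gen R) m (l + 1) j) (u * t)
      rw [Module.End.mul_apply] at h2
      rw [Module.End.mul_apply, Module.End.mul_apply, ← h2, show l + 1 + j = n by omega] at h1
      rw [h1]
      rw [← sum_conR_mul_ι (Module.finBasis k V) (mem_tensorPow_of_mem_Upsilon hu)]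
      simp only [Finset.sum_mul, map_sum]
      refine Finset.sum_eq_zero fun i _ => ?_
      have hu' := conR_mem_Upsilon ((Module.finBasis k V).coord i) hu
      have hum := mem_tensorPow_of_mem_Upsilon hu'
      have h3 := cycle_gen_mul_left (R := R) 0 n hum
        (ιT (Module.finBasis k V i) * t)
      rw [add_zero] at h3
      rw [mul_assoc, h3, hθ, ← mul_assoc, asym_gen_mul_right q (m := m + n) (by omega)
        (mul_mem_tensorPow hum h.mem_tensorPow), ih (l := l + 1) (by omega) (by omega) hu',
        zero_mul]
    rw [asym_succ_succ] at h0
    simp only [LinearMap.add_apply, LinearMap.smul_apply, Module.End.mul_apply, zero_add, hz,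
      smul_zero, add_zero] at h0
    exact (smul_eq_zero.1 h0).resolve_left (pow_ne_zero _ h.hecke.q_ne_zero)

/-- The factor appearing in products with the volume element. -/
def volFactor (q : k) (n : ℕ) : ℕ → k
  | 0 => 1
  | m + 1 => (-1) ^ (n + 1) * (q ^ (m + 1))⁻¹ * volFactor q n m

theorem volFactor_ne_zero (hq : q ≠ 0) (n m : ℕ) : volFactor q n m ≠ 0 := by
  induction m with
  | zero => simp [volFactor]
  | succ m ih => simp [volFactor, ih, hq]

/-- Solves the recursion for its first summand, which is where the sign and the power of `q` in
`volFactor` come from. -/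
theorem eq_volFactor_smul {M : Type*} [AddCommGroup M] [Module k M] (hq : q ≠ 0) {l m : ℕ}
    (hl : l + (m + 1) = n) {x y z : M}
    (h : q ^ (m + 1) • x + (-1 : k) ^ (l + 1) • y = 0)
    (hy : y = (-1 : k) ^ m • volFactor q n m • z) : x = volFactor q n (m + 1) • z := by
  have hq' := pow_ne_zero (m + 1) hq
  have h1 : q ^ (m + 1) • (x - volFactor q n (m + 1) • z) = 0 := by
    rw [← h, hy, volFactor, ← hl, smul_sub, smul_smul, ← sub_eq_zero]
    have : q ^ (m + 1) * ((-1 : k) ^ (l + (m + 1) + 1) * (q ^ (m + 1))⁻¹ *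
        volFactor q (l + (m + 1)) m) = (-1 : k) ^ (l + (m + 1) + 1) *
        volFactor q (l + (m + 1)) m := by
      field_simp
    rw [this]
    module
  exact sub_eq_zero.1 ((smul_eq_zero.1 h1).resolve_left hq')

/-- The borderline case, one step past the vanishing range. The recursion now equates two terms up
to a scalar, one of them with the last letter of `u` sent through `t` by θ. So induction on the
degree of `u` gradually replaces u ⊗ t by t ⊗ θ(u). -/
theorem IsVolume.asym_mul_right (h : IsVolume q R n t) {θ : V →ₗ[k] V}
    (hθ : ∀ v, cycle (gen R) 0 n (ιT v * t) = t * ιT (θ v)) {l m : ℕ} (hl : l + m = n)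
    {u : TensorAlgebra k V} (hu : u ∈ Upsilon q R m) :
    asym q (gen R) 0 m l (u * t) = volFactor q n m • (t * tmap θ u) := by
  have hT := h.hecke.isBraidSeq
  have hθR := h.theta_comm hθ
  induction m generalizing l u with
  | zero =>
    obtain ⟨c, rfl⟩ := tensorPow_zero_iff.1 (mem_tensorPow_of_mem_Upsilon hu)
    simp [volFactor]
  | succ m ih =>
    have hut := mul_mem_tensorPow (mem_tensorPow_of_mem_Upsilon hu) h.mem_tensorPow
    have hθu := tmap_mem_Upsilon hθR hu
    have hθut := mul_mem_tensorPow h.mem_tensorPow (mem_tensorPow_of_mem_Upsilon hθu)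
    have h0 := h.asym_mul_right_eq_zero hθ (j := m) (l := l + 1) (by omega) (by omega) hu
    rw [asym_succ_succ] at h0
    simp only [LinearMap.add_apply, LinearMap.smul_apply, Module.End.mul_apply, zero_add] at h0
    refine eq_volFactor_smul h.hecke.q_ne_zero hl h0 (sub_eq_zero.1 ?_)
    -- The completing crossing is injective and commutes with the antisymmetrizer. On the expected
    -- value it acts within the skew tensor θ(u), by (-1)^m, which cancels the sign inserted by
    -- `eq_volFactor_smul`.
    refine h.hecke.cycle_injOn (m := m + 1 + n) (i := n) (l := m) (by omega)
      (sub_mem (asym_gen_mem _ _ _ (cycle_gen_mem _ _ hut)) (Submodule.smul_mem _ _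
        (Submodule.smul_mem _ _ (by rwa [add_comm (m + 1)])))) ?_
    have hc : Commute (cycle (gen R) n m) (asym q (gen R) 0 m (l + 1)) :=
      asym_commute q _ _ fun i hi => (commute_cycle fun i' _ => hT.commute (by omega)).symm
    have h1 := LinearMap.congr_fun hc.eq (cycle (gen R) m (l + 1) (u * t))
    have h2 := LinearMap.congr_fun (cycle_add (gen R) m (l + 1) m) (u * t)
    rw [Module.End.mul_apply, show l + 1 + m = n by omega, show m + (l + 1) = n by omega] at h2
    rw [Module.End.mul_apply, Module.End.mul_apply, ← h2] at h1
    have h3 := cycle_gen_mul_left (R := R) 0 m h.mem_tensorPow (tmap θ u)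
    rw [add_zero, cycle_eq_neg_one_pow h.hecke (by omega) hθu] at h3
    have h4 : asym q (gen R) 0 m (l + 1) (cycle (gen R) m n (u * t)) =
        volFactor q n m • (t * tmap θ u) := by
      have hs := sum_conR_mul_ι (Module.finBasis k V) (mem_tensorPow_of_mem_Upsilon hu)
      conv_lhs => rw [← hs]
      conv_rhs => rw [← hs]
      simp only [Finset.sum_mul, map_sum, Finset.mul_sum, Finset.smul_sum]
      refine Finset.sum_congr rfl fun i _ => ?_
      have hu' := conR_mem_Upsilon ((Module.finBasis k V).coord i) hu
      have hum := mem_tensorPow_of_mem_Upsilon hu'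
      have h3 := cycle_gen_mul_left (R := R) 0 n hum (ιT (Module.finBasis k V i) * t)
      rw [add_zero] at h3
      rw [mul_assoc, h3, hθ, ← mul_assoc, asym_gen_mul_right q (m := m + n) (by omega)
        (mul_mem_tensorPow hum h.mem_tensorPow), ih (by omega) hu', map_mul, tmap_ι,
        smul_mul_assoc, mul_assoc]
    rw [map_sub, h1, h4, map_smul, map_smul, h3, mul_smul_comm, smul_smul, smul_smul,
      mul_right_comm, ← mul_pow]
    simp

/-- Mirror image of `IsVolume.asym_mul_right_eq_zero`, by `asym_mirror`. Here the first `j` letters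
of `t` stay outside, hence the offset of the antisymmetrizer. -/
theorem IsVolume.asym_mul_left_eq_zero (h : IsVolume q R n t) {θ : V →ₗ[k] V}
    (hθ : ∀ v, rcycle (gen R) 0 n (t * ιT v) = ιT (θ v) * t) {j l m : ℕ} (hl : l + j = n)
    (hm : j < m) {u : TensorAlgebra k V} (hu : u ∈ Upsilon q R m) :
    asym q (gen R) j l m (t * u) = 0 := by
  have hT := h.hecke.isBraidSeq
  induction j generalizing l m u with
  | zero =>
    obtain rfl : l = n := by omega
    exact h.star_eq_zero (by omega) h.mem hu
  | succ j ih =>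
    obtain ⟨m, rfl⟩ := Nat.exists_eq_succ_of_ne_zero (show m ≠ 0 by omega)
    have hut := mul_mem_tensorPow h.mem_tensorPow (mem_tensorPow_of_mem_Upsilon hu)
    have h0 := ih (l := l + 1) (by omega) (by omega) hu
    have hz : asym q (gen R) (j + 1) (l + 1) m (rcycle (gen R) j (l + 1) (t * u)) = 0 := by
      refine h.hecke.rcycle_injOn (i := 0) (l := j) (by omega)
        (asym_gen_mem _ _ _ (rcycle_gen_mem _ _ hut)) ?_
      have hc : Commute (rcycle (gen R) 0 j) (asym q (gen R) (j + 1) (l + 1) m) :=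
        asym_commute q _ _ fun i hi => (commute_rcycle fun i' _ => hT.commute (by omega)).symm
      have h1 := LinearMap.congr_fun hc.eq (rcycle (gen R) j (l + 1) (t * u))
      have h2 := LinearMap.congr_fun (rcycle_add (gen R) 0 j (l + 1)) (t * u)
      rw [Module.End.mul_apply, zero_add] at h2
      rw [Module.End.mul_apply, Module.End.mul_apply, ← h2, show j + (l + 1) = n by omega] at h1
      rw [h1]
      rw [← sum_ι_mul_conL (Module.finBasis k V) (mem_tensorPow_of_mem_Upsilon hu)]
      simp only [Finset.mul_sum, map_sum]
      refine Finset.sum_eq_zero fun i _ => ?_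
      have hu' := conL_mem_Upsilon ((Module.finBasis k V).coord i) hu
      have hum := mem_tensorPow_of_mem_Upsilon hu'
      rw [← mul_assoc, rcycle_gen_mul_right (m := n + 1) (by omega)
        (mul_mem_tensorPow h.mem_tensorPow (ι_mem_tensorPow _)), hθ, mul_assoc, add_comm j 1,
        asym_gen_mul_left q _ _ _ (ι_mem_tensorPow _), ih (l := l + 1) (by omega) (by omega) hu',
        mul_zero]
    rw [asym_mirror q hT] at h0
    simp only [LinearMap.add_apply, LinearMap.smul_apply, Module.End.mul_apply, hz,
      smul_zero, add_zero] at h0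
    exact (smul_eq_zero.1 h0).resolve_left (pow_ne_zero _ h.hecke.q_ne_zero)

theorem IsVolume.asym_mul_left (h : IsVolume q R n t) {θ : V →ₗ[k] V}
    (hθR : TensorProduct.map θ θ ∘ₗ R = R ∘ₗ TensorProduct.map θ θ)
    (hθ : ∀ v, rcycle (gen R) 0 n (t * ιT v) = ιT (θ v) * t) {l m : ℕ} (hl : l + m = n)
    {u : TensorAlgebra k V} (hu : u ∈ Upsilon q R m) :
    asym q (gen R) m l m (t * u) = volFactor q n m • (tmap θ u * t) := by
  have hT := h.hecke.isBraidSeq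
  induction m generalizing l u with
  | zero =>
    obtain ⟨c, rfl⟩ := tensorPow_zero_iff.1 (mem_tensorPow_of_mem_Upsilon hu)
    simp [volFactor]
  | succ m ih =>
    have hut := mul_mem_tensorPow h.mem_tensorPow (mem_tensorPow_of_mem_Upsilon hu)
    have hθu := tmap_mem_Upsilon hθR hu
    have hθum := mem_tensorPow_of_mem_Upsilon hθu
    have hθut := mul_mem_tensorPow hθum h.mem_tensorPow
    have h0 := h.asym_mul_left_eq_zero hθ (j := m) (l := l + 1) (by omega) (by omega) hu
    rw [asym_mirror q hT] at h0
    simp only [LinearMap.add_apply, LinearMap.smul_apply, Module.End.mul_apply] at h0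
    refine eq_volFactor_smul h.hecke.q_ne_zero hl h0 (sub_eq_zero.1 ?_)
    refine h.hecke.rcycle_injOn (m := n + (m + 1)) (i := 0) (l := m) (by omega)
      (sub_mem (asym_gen_mem _ _ _ (rcycle_gen_mem _ _ hut)) (Submodule.smul_mem _ _
        (Submodule.smul_mem _ _ (by rwa [add_comm n])))) ?_
    have hc : Commute (rcycle (gen R) 0 m) (asym q (gen R) (m + 1) (l + 1) m) :=
      asym_commute q _ _ fun i hi => (commute_rcycle fun i' _ => hT.commute (by omega)).symm
    have h1 := LinearMap.congr_fun hc.eq (rcycle (gen R) m (l + 1) (t * u))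
    have h2 := LinearMap.congr_fun (rcycle_add (gen R) 0 m (l + 1)) (t * u)
    rw [Module.End.mul_apply, show m + (l + 1) = n by omega, zero_add] at h2
    rw [Module.End.mul_apply, Module.End.mul_apply, ← h2] at h1
    have h3 := rcycle_gen_mul_right (R := R) (s := 0) (l := m) (by omega) hθum t
    rw [rcycle_eq_neg_one_pow h.hecke (by omega) hθu] at h3
    have h4 : asym q (gen R) (m + 1) (l + 1) m (rcycle (gen R) 0 n (t * u)) =
        volFactor q n m • (tmap θ u * t) := by
      have hs := sum_ι_mul_conL (Module.finBasis k V) (mem_tensorPow_of_mem_Upsilon hu)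
      conv_lhs => rw [← hs]
      conv_rhs => rw [← hs]
      simp only [Finset.sum_mul, map_sum, Finset.mul_sum, Finset.smul_sum]
      refine Finset.sum_congr rfl fun i _ => ?_
      have hu' := conL_mem_Upsilon ((Module.finBasis k V).coord i) hu
      rw [← mul_assoc, rcycle_gen_mul_right (m := n + 1) (by omega)
        (mul_mem_tensorPow h.mem_tensorPow (ι_mem_tensorPow _)), hθ, mul_assoc, add_comm m 1,
        asym_gen_mul_left q _ _ _ (ι_mem_tensorPow _), ih (by omega) hu', map_mul, tmap_ι,
        mul_smul_comm, mul_assoc]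
    rw [map_sub, h1, h4, map_smul, map_smul, h3, smul_mul_assoc, smul_smul, smul_smul,
      mul_right_comm, ← mul_pow]
    simp

end Volume

/-! ### Nondegeneracy of the product and its Nakayama automorphism -/

section Frobenius

variable {k : Type*} [Field k] {V : Type*} [AddCommGroup V] [Module k V]
  {q : k} {R : V ⊗[k] V →ₗ[k] V ⊗[k] V} {n : ℕ} {t : TensorAlgebra k V}

local notation "ιT" => TensorAlgebra.ι k

theorem star_sub_left (a b : ℕ) (x x' y : TensorAlgebra k V) :
    star q R a b (x - x') y = star q R a b x y - star q R a b x' y := by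
  simp [star, sub_mul]

theorem mem_commutingGL {χ : V ≃ₗ[k] V} : χ ∈ commutingGL R ↔
    TensorProduct.map χ.toLinearMap χ.toLinearMap ∘ₗ R =
      R ∘ₗ TensorProduct.map χ.toLinearMap χ.toLinearMap := Iff.rfl

theorem symm_mem_commutingGL {χ : V ≃ₗ[k] V} (h : χ ∈ commutingGL R) :
    χ.symm ∈ commutingGL R := (commutingGL R).inv_mem h

/-- Multiplication by a nonzero scalar as an element of `GL(V)`. -/
theorem smulOfNeZero_mem_commutingGL {c : k} (hc : c ≠ 0) :
    LinearEquiv.smulOfNeZero k V c hc ∈ commutingGL R := by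
  rw [mem_commutingGL]
  have : (LinearEquiv.smulOfNeZero k V c hc).toLinearMap = c • LinearMap.id := by
    ext; rfl
  rw [this]
  ext v w
  simp [TensorProduct.map_smul_left, TensorProduct.map_smul_right]

theorem tmap_symm_apply (χ : V ≃ₗ[k] V) (x : TensorAlgebra k V) :
    tmap χ.toLinearMap (tmap χ.symm.toLinearMap x) = x := by
  rw [← tmap_comp, LinearEquiv.comp_symm, tmap_id]

theorem symm_tmap_apply (χ : V ≃ₗ[k] V) (x : TensorAlgebra k V) :
    tmap χ.symm.toLinearMap (tmap χ.toLinearMap x) = x := by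
  rw [← tmap_comp, LinearEquiv.symm_comp, tmap_id]

theorem tmap_injective (χ : V ≃ₗ[k] V) : Function.Injective (tmap χ.toLinearMap) :=
  Function.LeftInverse.injective (symm_tmap_apply χ)

theorem tmap_dualMap_symm (χ : V ≃ₗ[k] V) (F : TensorAlgebra k (Module.Dual k V)) :
    tmap χ.toLinearMap.dualMap (tmap χ.symm.toLinearMap.dualMap F) = F := by
  rw [← tmap_comp, LinearMap.dualMap_comp_dualMap, LinearEquiv.symm_comp,
    LinearMap.dualMap_id, tmap_id]

/-- The automorphism of `Υ^{(j)}` induced by an element of `commutingGL R`. -/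
def upsilonEquiv (q : k) {χ : V ≃ₗ[k] V} (h : χ ∈ commutingGL R) (j : ℕ) :
    Upsilon q R j ≃ₗ[k] Upsilon q R j :=
  LinearEquiv.ofLinearMap
    ((tmap χ.toLinearMap).toLinearMap.restrict fun _ hx => tmap_mem_Upsilon h hx)
    ((tmap χ.symm.toLinearMap).toLinearMap.restrict fun _ hx =>
      tmap_mem_Upsilon (symm_mem_commutingGL h) hx)
    (by ext x; exact tmap_symm_apply χ x) (by ext x; exact symm_tmap_apply χ x)

theorem coe_upsilonEquiv {χ : V ≃ₗ[k] V} (h : χ ∈ commutingGL R) (j : ℕ) (x : Upsilon q R j) :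
    (upsilonEquiv q h j x : TensorAlgebra k V) = tmap χ.toLinearMap x := rfl

theorem ctrR_eq_ctrL_tmap {ψ : V ≃ₗ[k] V}
    (hψ : ∀ f : Module.Dual k V, conR f t = conL (f ∘ₗ ψ.toLinearMap) t)
    (F : TensorAlgebra k (Module.Dual k V)) :
    ctrR k V F t = ctrL k V (tmap ψ.toLinearMap.dualMap F) t := by
  induction F using TensorAlgebra.induction with
  | algebraMap r => simp [Algebra.algebraMap_eq_smul_one]
  | ι g => rw [ctrR_ι, hψ, tmap_ι, ctrL_ι]; rfl
  | mul a b ha hb =>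
    rw [map_mul, Module.End.mul_apply, hb, ← ctrL_ctrR, ha, map_mul, ctrL_mul,
      Module.End.mul_apply]
  | add a b ha hb => simp only [map_add, LinearMap.add_apply, ha, hb]

theorem isTheta_iff_cycle (χ : V →ₗ[k] V) :
    IsTheta R n t χ ↔ ∀ v, cycle (gen R) 0 n (ιT v * t) = t * ιT (χ v) := by
  simp only [IsTheta, cyc_eq_cycle]

variable [FiniteDimensional k V]

/-- The antisymmetrizer in `IsVolume.asym_mul_right` does not touch the last `m` letters.
Contracting them with `G` turns `t` into t ⌞ G on one side and evaluates `G` at θ(u) on the other.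
-/
theorem IsVolume.star_ctrR (h : IsVolume q R n t) {θ : V →ₗ[k] V}
    (hθ : ∀ v, cycle (gen R) 0 n (ιT v * t) = t * ιT (θ v)) {l m : ℕ} (hl : l + m = n)
    {u : TensorAlgebra k V} (hu : u ∈ Upsilon q R m) {G : TensorAlgebra k (Module.Dual k V)}
    (hG : G ∈ tensorPow k (Module.Dual k V) m) :
    star q R m l u (ctrR k V G t) = (volFactor q n m * ev k V G (tmap θ u)) • t := by
  have hum := mem_tensorPow_of_mem_Upsilon hu
  have ht := h.mem_tensorPow
  have h1 := congrArg (ctrR k V G) (h.asym_mul_right hθ hl hu)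
  have hm : u * t ∈ tensorPow k V (m + l + m) := by
    rw [add_assoc, hl]
    exact mul_mem_tensorPow hum ht
  rw [ctrR_asym R q (by omega) hG hm, ctrR_mul_apply (b := l) hG (by rwa [hl]), map_smul,
    ctrR_mul_eq_smul hG (tmap_mem θ hum), smul_smul] at h1
  rw [star_eq_asym, h1]

theorem IsVolume.star_ctrL (h : IsVolume q R n t) {θ : V →ₗ[k] V}
    (hθR : TensorProduct.map θ θ ∘ₗ R = R ∘ₗ TensorProduct.map θ θ)
    (hθ : ∀ v, rcycle (gen R) 0 n (t * ιT v) = ιT (θ v) * t) {l m : ℕ} (hl : l + m = n)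
    {u : TensorAlgebra k V} (hu : u ∈ Upsilon q R m) {G : TensorAlgebra k (Module.Dual k V)}
    (hG : G ∈ tensorPow k (Module.Dual k V) m) :
    star q R l m (ctrL k V G t) u = (volFactor q n m * ev k V G (tmap θ u)) • t := by
  have hum := mem_tensorPow_of_mem_Upsilon hu
  have ht := h.mem_tensorPow
  have h1 := congrArg (ctrL k V G) (h.asym_mul_left hθR hθ hl hu)
  have h2 := ctrL_asym R q hG 0 l m (t * u)
  rw [add_zero] at h2
  rw [h2, ctrL_mul_apply (b := l) hG (by rwa [add_comm, hl]), map_smul,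
    ctrL_mul_eq_smul hG (tmap_mem θ hum), smul_smul] at h1
  rw [star_eq_asym, h1]

/-- Every element of `Υ^{(m)}` is a contraction of the volume element from the left. -/
theorem IsVolume.exists_ctrL_eq (h : IsVolume q R n t) {θ : V ≃ₗ[k] V}
    (hθ : ∀ v, cycle (gen R) 0 n (ιT v * t) = t * ιT (θ v)) {l m : ℕ} (hl : l + m = n)
    {w : TensorAlgebra k V} (hw : w ∈ Upsilon q R m) :
    ∃ F ∈ tensorPow k (Module.Dual k V) l, ctrL k V F t = w := by
  have hθR : θ ∈ commutingGL R := h.theta_comm hθ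
  have hu := tmap_mem_Upsilon (symm_mem_commutingGL hθR) hw
  set u := tmap θ.symm.toLinearMap w with hu'
  -- `F` represents the coefficient of `t` in u ⋆ x, with u = θ⁻¹(w). Pairing F ⌟ t with any `G`
  -- then equals pairing `F` with t ⌞ G, which `IsVolume.star_ctrR` computes as a nonzero constant
  -- times G(w).
  obtain ⟨F, hF, hF'⟩ := exists_ev_eq l
    (h.functional ∘ₗ asym q (gen R) 0 m l ∘ₗ LinearMap.mulLeft k u)
  have hc := volFactor_ne_zero h.hecke.q_ne_zero n m
  refine ⟨(volFactor q n m)⁻¹ • F, Submodule.smul_mem _ _ hF, ?_⟩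
  have ht := h.mem_tensorPow
  have key : ctrL k V F t = volFactor q n m • w := by
    refine eq_of_forall_ev_eq (ctrL_mem hF (by rwa [hl]))
      (Submodule.smul_mem _ _ (mem_tensorPow_of_mem_Upsilon hw)) fun G hG => ?_
    have h1 := h.star_ctrR hθ hl hu hG
    rw [star_eq_asym] at h1
    rw [← ev_mul_left, ev_mul_right, hF' _ (ctrR_mem hG (by rwa [hl]))]
    simp only [LinearMap.comp_apply, LinearMap.mulLeft_apply]
    rw [h1, hu', tmap_symm_apply, map_smul, h.functional_self, map_smul]
    simp
  rw [map_smul, LinearMap.smul_apply, key, inv_smul_smul₀ hc]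

theorem IsVolume.rcycle_comm (h : IsVolume q R n t) {θ : V ≃ₗ[k] V}
    (hθ : ∀ v, cycle (gen R) 0 n (ιT v * t) = t * ιT (θ v)) :
    LinearEquiv.smulOfNeZero k V (q ^ (n + 1)) (pow_ne_zero _ h.hecke.q_ne_zero) * θ⁻¹ ∈
      commutingGL R := by
  have hθR : θ ∈ commutingGL R := h.theta_comm hθ
  exact mul_mem (smulOfNeZero_mem_commutingGL _) (inv_mem hθR)

/-- Every element of `Υ^{(m)}` is a contraction of the volume element from the right. -/
theorem IsVolume.exists_ctrR_eq (h : IsVolume q R n t) {θ : V ≃ₗ[k] V}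
    (hθR : θ ∈ commutingGL R)
    (hθ : ∀ v, rcycle (gen R) 0 n (t * ιT v) = ιT (θ v) * t) {l m : ℕ} (hl : l + m = n)
    {w : TensorAlgebra k V} (hw : w ∈ Upsilon q R m) :
    ∃ F ∈ tensorPow k (Module.Dual k V) l, ctrR k V F t = w := by
  have hu := tmap_mem_Upsilon (symm_mem_commutingGL hθR) hw
  set u := tmap θ.symm.toLinearMap w with hu'
  obtain ⟨F, hF, hF'⟩ := exists_ev_eq l
    (h.functional ∘ₗ asym q (gen R) 0 l m ∘ₗ LinearMap.mulRight k u)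
  have hc := volFactor_ne_zero h.hecke.q_ne_zero n m
  refine ⟨(volFactor q n m)⁻¹ • F, Submodule.smul_mem _ _ hF, ?_⟩
  have ht := h.mem_tensorPow
  have key : ctrR k V F t = volFactor q n m • w := by
    refine eq_of_forall_ev_eq (ctrR_mem hF (by rwa [add_comm, hl]))
      (Submodule.smul_mem _ _ (mem_tensorPow_of_mem_Upsilon hw)) fun G hG => ?_
    have h1 := h.star_ctrL hθR hθ hl hu hG
    rw [star_eq_asym] at h1
    rw [← ev_mul_right, ev_mul_left, hF' _ (ctrL_mem hG (by rwa [add_comm, hl]))]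
    simp only [LinearMap.comp_apply, LinearMap.mulRight_apply]
    rw [h1, hu', tmap_symm_apply, map_smul, h.functional_self, map_smul]
    simp
  rw [map_smul, LinearMap.smul_apply, key, inv_smul_smul₀ hc]

theorem IsVolume.eq_zero_of_star_eq_zero (h : IsVolume q R n t) {θ : V ≃ₗ[k] V}
    (hθ : ∀ v, cycle (gen R) 0 n (ιT v * t) = t * ιT (θ v)) {l m : ℕ} (hl : l + m = n)
    {u : TensorAlgebra k V} (hu : u ∈ Upsilon q R m)
    (h0 : ∀ w ∈ Upsilon q R l, star q R m l u w = 0) : u = 0 := by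
  have hum := mem_tensorPow_of_mem_Upsilon hu
  have : tmap θ.toLinearMap u = 0 := by
    refine eq_zero_of_forall_ev_eq_zero (tmap_mem _ hum) fun G hG => ?_
    have ht := h.mem
    have h1 := h.star_ctrR hθ hl hu hG
    rw [h0 _ (ctrR_mem_Upsilon hG (by rwa [hl])), eq_comm, smul_eq_zero, mul_eq_zero] at h1
    exact (h1.resolve_right h.ne_zero).resolve_left (volFactor_ne_zero h.hecke.q_ne_zero n m)
  exact tmap_injective θ (by rw [this, map_zero])

theorem IsVolume.conL_injective (h : IsVolume q R n t) {θ : V ≃ₗ[k] V}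
    (hθ : ∀ v, cycle (gen R) 0 n (ιT v * t) = t * ιT (θ v)) {f g : Module.Dual k V}
    (hf : conL f t = conL g t) : f = g := by
  obtain ⟨l, rfl⟩ := Nat.exists_eq_succ_of_ne_zero h.pos.ne'
  let θ' : V ≃ₗ[k] V :=
    LinearEquiv.smulOfNeZero k V (q ^ (l + 1 + 1)) (pow_ne_zero _ h.hecke.q_ne_zero) * θ⁻¹
  have hθ' : ∀ v, rcycle (gen R) 0 (l + 1) (t * ιT v) = ιT (θ' v) * t := h.rcycle_mul_ι hθ
  ext v
  have key : ∀ f : Module.Dual k V, star q R l 1 (conL f t) (ιT (θ'.symm v)) =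
      (volFactor q (l + 1) 1 * f v) • t := by
    intro f
    have := h.star_ctrL (θ := θ'.toLinearMap) (h.rcycle_comm hθ) hθ' rfl
      (ι_mem_Upsilon q R (θ'.symm v)) (ι_mem_tensorPow f)
    rwa [ctrL_ι, tmap_ι, ev_ι, LinearEquiv.coe_coe, LinearEquiv.apply_symm_apply] at this
  have h1 := key f
  rw [hf, key g] at h1
  have h2 := smul_left_injective k h.ne_zero h1
  exact (mul_left_cancel₀ (volFactor_ne_zero h.hecke.q_ne_zero _ _) h2).symm

theorem IsVolume.conR_injective (h : IsVolume q R n t) {θ : V ≃ₗ[k] V}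
    (hθ : ∀ v, cycle (gen R) 0 n (ιT v * t) = t * ιT (θ v)) {f g : Module.Dual k V}
    (hf : conR f t = conR g t) : f = g := by
  obtain ⟨l, rfl⟩ := Nat.exists_eq_succ_of_ne_zero h.pos.ne'
  ext v
  have key : ∀ f : Module.Dual k V, star q R 1 l (ιT (θ.symm v)) (conR f t) =
      (volFactor q (l + 1) 1 * f v) • t := by
    intro f
    have := h.star_ctrR (θ := θ.toLinearMap) hθ rfl
      (ι_mem_Upsilon q R (θ.symm v)) (ι_mem_tensorPow f)
    rwa [ctrR_ι, tmap_ι, ev_ι, LinearEquiv.coe_coe, LinearEquiv.apply_symm_apply] at this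
  have h1 := key f
  rw [hf, key g] at h1
  have h2 := smul_left_injective k h.ne_zero h1
  exact (mul_left_cancel₀ (volFactor_ne_zero h.hecke.q_ne_zero _ _) h2).symm

/-- The operator relating the left and the right contractions of the volume element with
functionals. -/
theorem IsVolume.exists_psi (h : IsVolume q R n t) {θ : V ≃ₗ[k] V}
    (hθ : ∀ v, cycle (gen R) 0 n (ιT v * t) = t * ιT (θ v)) :
    ∃ ψ : V ≃ₗ[k] V, ∀ f : Module.Dual k V, conR f t = conL (f ∘ₗ ψ.toLinearMap) t := by
  obtain ⟨l, rfl⟩ := Nat.exists_eq_succ_of_ne_zero h.pos.ne'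
  let α : Module.Dual k V →ₗ[k] Upsilon q R l :=
    { toFun := fun f => ⟨conL f t, conL_mem_Upsilon f h.mem⟩
      map_add' := fun f g => by ext; simp [conL_add]
      map_smul' := fun c f => by ext; simp [conL_smul] }
  let β : Module.Dual k V →ₗ[k] Upsilon q R l :=
    { toFun := fun f => ⟨conR f t, conR_mem_Upsilon f h.mem⟩
      map_add' := fun f g => by ext; simp [conR_add]
      map_smul' := fun c f => by ext; simp [conR_smul] }
  have hα : Function.Bijective α := by
    refine ⟨fun f g hf => h.conL_injective hθ (congrArg Subtype.val hf), fun w => ?_⟩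
    obtain ⟨F, hF, hw⟩ := h.exists_ctrL_eq hθ (l := 1) (add_comm _ _) w.2
    obtain ⟨f, rfl⟩ := tensorPow_one_iff.1 hF
    exact ⟨f, Subtype.ext (by rw [← hw, ctrL_ι]; rfl)⟩
  have hβ : Function.Bijective β := by
    refine ⟨fun f g hf => h.conR_injective hθ (congrArg Subtype.val hf), fun w => ?_⟩
    obtain ⟨F, hF, hw⟩ := h.exists_ctrR_eq (h.rcycle_comm hθ) (h.rcycle_mul_ι hθ) (l := 1)
      (add_comm _ _) w.2
    obtain ⟨f, rfl⟩ := tensorPow_one_iff.1 hF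
    exact ⟨f, Subtype.ext (by rw [← hw, ctrR_ι]; rfl)⟩
  -- Functionals parametrize the component of degree one below the top bijectively, by left and by
  -- right contractions of `t`. The transition between the two is the transpose of ψ, recovered
  -- through biduality.
  let L : Module.Dual k V ≃ₗ[k] Module.Dual k V :=
    (LinearEquiv.ofBijective β hβ).trans (LinearEquiv.ofBijective α hα).symm
  have hL : ∀ f, α (L f) = β f := fun f =>
    (LinearEquiv.ofBijective α hα).apply_symm_apply (β f)
  let ψ : V ≃ₗ[k] V :=
    (Module.evalEquiv k V).trans (L.dualMap.trans (Module.evalEquiv k V).symm)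
  have hψ : ∀ (f : Module.Dual k V) (v : V), f (ψ v) = L f v := by
    intro f v
    have h1 : Module.evalEquiv k V (ψ v) = L.dualMap (Module.evalEquiv k V v) :=
      (Module.evalEquiv k V).apply_symm_apply _
    exact LinearMap.congr_fun h1 f
  refine ⟨ψ, fun f => ?_⟩
  have : f ∘ₗ ψ.toLinearMap = L f := LinearMap.ext (hψ f)
  rw [this]
  exact (congrArg Subtype.val (hL f)).symm

variable {θ ψ : V ≃ₗ[k] V}

/-- By `ctrR_eq_ctrL_tmap`, contracting all `n` letters from the right is contracting them from the
left after applying ψ*, and both evaluate the same pairing. -/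
theorem IsVolume.tmap_psi (h : IsVolume q R n t)
    (hψ : ∀ f : Module.Dual k V, conR f t = conL (f ∘ₗ ψ.toLinearMap) t) :
    tmap ψ.toLinearMap t = t := by
  refine eq_of_forall_ev_eq (tmap_mem _ h.mem_tensorPow) h.mem_tensorPow fun F _ => ?_
  rw [ev_tmap, ev_apply, ← ctrR_eq_ctrL_tmap hψ, ← ev_eq_ctrR]

/-- θ preserves the line of `t`, so contractions of θ(t) can be rewritten from right to left either
before or after θ is moved onto the functional. Injectivity of left contraction gives the
commutation. -/
theorem IsVolume.psi_comp_theta (h : IsVolume q R n t)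
    (hθ : ∀ v, cycle (gen R) 0 n (ιT v * t) = t * ιT (θ v))
    (hψ : ∀ f : Module.Dual k V, conR f t = conL (f ∘ₗ ψ.toLinearMap) t) : ψ * θ = θ * ψ := by
  have hθR : θ ∈ commutingGL R := h.theta_comm hθ
  obtain ⟨c, hc⟩ := h.span _ (tmap_mem_Upsilon hθR h.mem)
  have key : ∀ f : Module.Dual k V, f ∘ₗ θ.toLinearMap ∘ₗ ψ.toLinearMap =
      f ∘ₗ ψ.toLinearMap ∘ₗ θ.toLinearMap := by
    intro f
    refine h.conL_injective hθ (tmap_injective θ ?_)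
    have h1 := conR_tmap f θ.toLinearMap t
    have h2 := conL_tmap (f ∘ₗ ψ.toLinearMap) θ.toLinearMap t
    rw [hψ] at h1
    rw [hc, map_smul] at h1 h2
    rw [hψ] at h1
    exact h1.symm.trans h2
  ext v
  refine (Module.forall_dual_apply_eq_zero_iff k _).1 ?_ |> sub_eq_zero.1
  intro f
  rw [map_sub, sub_eq_zero]
  exact (LinearMap.congr_fun (key f) v).symm

/-- Here ψ is not yet known to commute with `R`. Instead, skew tensors are contractions of `t`, and
ψ fixes `t`. -/
theorem IsVolume.tmap_psi_mem_Upsilon (h : IsVolume q R n t)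
    (hθ : ∀ v, cycle (gen R) 0 n (ιT v * t) = t * ιT (θ v))
    (hψ : ∀ f : Module.Dual k V, conR f t = conL (f ∘ₗ ψ.toLinearMap) t) {l m : ℕ}
    (hl : l + m = n) {x : TensorAlgebra k V} (hx : x ∈ Upsilon q R m) :
    tmap ψ.toLinearMap x ∈ Upsilon q R m := by
  obtain ⟨F, hF, rfl⟩ := h.exists_ctrL_eq hθ hl hx
  have h1 := ctrL_tmap ψ.toLinearMap (tmap ψ.symm.toLinearMap.dualMap F) t
  rw [tmap_dualMap_symm, h.tmap_psi hψ] at h1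
  rw [← h1]
  have ht := h.mem
  exact ctrL_mem_Upsilon (tmap_mem _ hF) (by rwa [hl])

/-- The degree `1` component of the Nakayama automorphism of `Υ(V, R)`, expressed by the operators
`θ` and `ψ`. -/
def nakayamaPhi (hq : q ≠ 0) (n : ℕ) (θ ψ : V ≃ₗ[k] V) : V ≃ₗ[k] V :=
  θ⁻¹ * ψ * (LinearEquiv.smulOfNeZero k V (q ^ (n + 1)) (pow_ne_zero _ hq) * θ⁻¹)

theorem IsVolume.tmap_phi_mem_Upsilon (h : IsVolume q R n t)
    (hθ : ∀ v, cycle (gen R) 0 n (ιT v * t) = t * ιT (θ v))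
    (hψ : ∀ f : Module.Dual k V, conR f t = conL (f ∘ₗ ψ.toLinearMap) t) {l m : ℕ}
    (hl : l + m = n) {x : TensorAlgebra k V} (hx : x ∈ Upsilon q R m) :
    tmap (nakayamaPhi h.hecke.q_ne_zero n θ ψ).toLinearMap x ∈ Upsilon q R m := by
  have hθR : θ ∈ commutingGL R := h.theta_comm hθ
  have : (nakayamaPhi h.hecke.q_ne_zero n θ ψ).toLinearMap = θ.symm.toLinearMap ∘ₗ
      (ψ.toLinearMap ∘ₗ (LinearEquiv.smulOfNeZero k V (q ^ (n + 1))
        (pow_ne_zero _ h.hecke.q_ne_zero) * θ⁻¹ : V ≃ₗ[k] V).toLinearMap) := rfl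
  rw [this, tmap_comp, tmap_comp]
  exact tmap_mem_Upsilon (symm_mem_commutingGL hθR) (h.tmap_psi_mem_Upsilon hθ hψ hl
    (tmap_mem_Upsilon (h.rcycle_comm hθ) hx))

/-- Write w = t ⌞ G = (ψ*G) ⌟ t. The two products are the same constant times G(ψθ'u) t and G(θφu)
t, and θφ = ψθ' by the choice of φ. -/
theorem IsVolume.star_eq_star_phi (h : IsVolume q R n t)
    (hθ : ∀ v, cycle (gen R) 0 n (ιT v * t) = t * ιT (θ v))
    (hψ : ∀ f : Module.Dual k V, conR f t = conL (f ∘ₗ ψ.toLinearMap) t) {l m : ℕ}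
    (hl : l + m = n) {u w : TensorAlgebra k V} (hu : u ∈ Upsilon q R m)
    (hw : w ∈ Upsilon q R l) :
    star q R l m w u =
      star q R m l (tmap (nakayamaPhi h.hecke.q_ne_zero n θ ψ).toLinearMap u) w := by
  obtain ⟨G, hG, rfl⟩ := h.exists_ctrR_eq (h.rcycle_comm hθ) (h.rcycle_mul_ι hθ)
    (l := m) (by omega) hw
  have h1 : θ.toLinearMap ∘ₗ (nakayamaPhi h.hecke.q_ne_zero n θ ψ).toLinearMap =
      ψ.toLinearMap ∘ₗ (LinearEquiv.smulOfNeZero k V (q ^ (n + 1))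
        (pow_ne_zero _ h.hecke.q_ne_zero) * θ⁻¹ : V ≃ₗ[k] V).toLinearMap := by
    ext v
    exact θ.apply_symm_apply _
  rw [h.star_ctrR hθ hl (h.tmap_phi_mem_Upsilon hθ hψ hl hu) hG, ctrR_eq_ctrL_tmap hψ,
    h.star_ctrL (h.rcycle_comm hθ) (h.rcycle_mul_ι hθ) hl hu (tmap_mem _ hG), ← ev_tmap,
    ← tmap_comp, ← tmap_comp, h1]

/-- By `star_one_one` it suffices that φ be multiplicative on products of two vectors. By
nondegeneracy this may be tested against x in Υ^(n-2), where v and w can be moved around x jointly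
or one at a time. -/
theorem IsVolume.phi_comm (h : IsVolume q R n t)
    (hθ : ∀ v, cycle (gen R) 0 n (ιT v * t) = t * ιT (θ v))
    (hψ : ∀ f : Module.Dual k V, conR f t = conL (f ∘ₗ ψ.toLinearMap) t) :
    nakayamaPhi h.hecke.q_ne_zero n θ ψ ∈ commutingGL R := by
  rw [mem_commutingGL]
  set φ := nakayamaPhi h.hecke.q_ne_zero n θ ψ with hφ
  have key : ∀ v w, tmap φ.toLinearMap (star q R 1 1 (ιT v) (ιT w)) =
      star q R 1 1 (ιT (φ v)) (ιT (φ w)) := by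
    intro v w
    have hmem : ∀ v w, star q R 1 1 (ιT v) (ιT w) ∈ Upsilon q R 2 := fun v w =>
      star_mem_Upsilon h.hecke (ι_mem_Upsilon q R v) (ι_mem_Upsilon q R w)
    rcases Nat.lt_or_ge n 2 with hn | hn
    -- Below degree 2 there is no complementary `x`, but then Υ^(2) is zero and the claim is
    -- trivial.
    · have h2 := h.above 2 hn
      simp only [h2, Submodule.mem_bot] at hmem
      rw [hmem, hmem, map_zero]
    · obtain ⟨l, rfl⟩ := Nat.exists_eq_add_of_le' hn
      refine sub_eq_zero.1 (h.eq_zero_of_star_eq_zero hθ rfl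
        (sub_mem (h.tmap_phi_mem_Upsilon hθ hψ rfl (hmem v w)) (hmem _ _)) fun x hx => ?_)
      have tw : ∀ v y, y ∈ Upsilon q R (l + 1) →
          star q R (l + 1) 1 y (ιT v) = star q R 1 (l + 1) (ιT (φ v)) y := by
        intro v y hy
        have := h.star_eq_star_phi hθ hψ (l := l + 1) (m := 1) rfl (ι_mem_Upsilon q R v) hy
        rwa [tmap_ι] at this
      have hv := ι_mem_Upsilon q R v
      have hw := ι_mem_Upsilon q R w
      have hφv := ι_mem_Upsilon q R (φ v)
      have hφw := ι_mem_Upsilon q R (φ w)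
      have m1 := star_mem_Upsilon h.hecke hφw hx
      have m2 := star_mem_Upsilon h.hecke hx hv
      rw [add_comm 1 l] at m1
      have a1 := star_assoc (c := l) (z := x) h.hecke hφv hφw
      have a2 := star_assoc (c := 1) (z := ιT v) h.hecke hφw hx
      have a3 := star_assoc (c := 1) (z := ιT w) h.hecke hx hv
      rw [add_comm 1 l] at a1 a2
      rw [star_sub_left, ← h.star_eq_star_phi hθ hψ rfl (hmem v w) hx, sub_eq_zero]
      calc star q R l 2 x (star q R 1 1 (ιT v) (ιT w))
          = star q R (l + 1) 1 (star q R l 1 x (ιT v)) (ιT w) := a3.symm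
        _ = star q R 1 (l + 1) (ιT (φ w)) (star q R l 1 x (ιT v)) := tw _ _ m2
        _ = star q R (l + 1) 1 (star q R 1 l (ιT (φ w)) x) (ιT v) := a2.symm
        _ = star q R 1 (l + 1) (ιT (φ v)) (star q R 1 l (ιT (φ w)) x) := tw _ _ m1
        _ = _ := a1.symm
  ext1
  ext1 v
  ext1 w
  have h1 := key v w
  rw [star_one_one, star_one_one, tmap_pairEmb] at h1
  have h2 := pairEmb_injective h1
  simp only [map_sub, map_smul, TensorProduct.map_tmul] at h2
  exact sub_right_injective h2

theorem IsVolume.isPhi_iff (h : IsVolume q R n t)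
    (hθ : ∀ v, cycle (gen R) 0 n (ιT v * t) = t * ιT (θ v))
    (hψ : ∀ f : Module.Dual k V, conR f t = conL (f ∘ₗ ψ.toLinearMap) t) (χ : V →ₗ[k] V) :
    IsPhi q R n χ ↔ χ = (nakayamaPhi h.hecke.q_ne_zero n θ ψ).toLinearMap := by
  have hφR := h.phi_comm hθ hψ
  constructor
  · rintro ⟨ν, hν, hχ⟩
    obtain ⟨l, rfl⟩ := Nat.exists_eq_succ_of_ne_zero h.pos.ne'
    ext v
    have hv := ι_mem_Upsilon q R v
    refine (TensorAlgebra.ι_inj k _ _).1 (sub_eq_zero.1 (h.eq_zero_of_star_eq_zero hθ (l := l)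
      (m := 1) rfl (sub_mem (ι_mem_Upsilon q R _) (ι_mem_Upsilon q R _)) fun w hw => ?_))
    have h1 := hν.twist 1 l (add_comm _ _) ⟨ιT v, hv⟩ ⟨w, hw⟩
    rw [hχ] at h1
    have h2 := h.star_eq_star_phi hθ hψ rfl hv hw
    rw [star_sub_left, ← h1, ← tmap_ι, ← h2, sub_self]
  · rintro rfl
    refine ⟨upsilonEquiv q hφR, ⟨?_, h.above, ?_, ?_, ?_⟩, fun v => ?_⟩
    · exact fun h0 => h.ne_zero ((Submodule.mem_bot k).1 (h0 ▸ h.mem))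
    · rw [coe_upsilonEquiv, map_one]
    · intro a b x y
      refine ⟨⟨_, star_mem_Upsilon h.hecke x.2 y.2⟩, rfl, ?_⟩
      rw [coe_upsilonEquiv, tmap_star hφR, coe_upsilonEquiv, coe_upsilonEquiv]
    · intro a b hab x y
      rw [coe_upsilonEquiv]
      exact h.star_eq_star_phi hθ hψ (by omega) x.2 y.2
    · rw [coe_upsilonEquiv, tmap_ι]

theorem IsVolume.isTheta_iff (h : IsVolume q R n t)
    (hθ : ∀ v, cycle (gen R) 0 n (ιT v * t) = t * ιT (θ v)) (χ : V →ₗ[k] V) :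
    IsTheta R n t χ ↔ χ = θ.toLinearMap := by
  rw [isTheta_iff_cycle]
  constructor
  · intro hχ
    ext v
    refine (TensorAlgebra.ι_inj k _ _).1 (h.mul_left_cancel ?_)
    rw [← hχ, hθ, LinearEquiv.coe_coe]
  · rintro rfl
    exact hθ

end Frobenius

/-! ### The quadratic dual as the graded dual of Υ -/

section QuadraticDual

variable {k : Type*} [Field k] {V : Type*} [AddCommGroup V] [Module k V]
  {q : k} {R : V ⊗[k] V →ₗ[k] V ⊗[k] V} {n : ℕ} {t : TensorAlgebra k V}

local notation "ιT" => TensorAlgebra.ι k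

theorem ev_pairEmb (H : Module.Dual k V ⊗[k] Module.Dual k V) (z : V ⊗[k] V) :
    ev k V (pairEmb k _ H) (pairEmb k V z) = TensorProduct.dualDistrib k V V H z := by
  induction H using TensorProduct.induction_on with
  | zero => simp
  | tmul f g =>
    induction z using TensorProduct.induction_on with
    | zero => simp
    | tmul v w => simp [ev_mul_left, ev_ι]
    | add x y hx hy => simp only [map_add, hx, hy]
  | add x y hx hy => simp only [map_add, LinearMap.add_apply, hx, hy]

theorem mem_quadPerp {H : Module.Dual k V ⊗[k] Module.Dual k V} :
    H ∈ quadPerp (imRq q R) ↔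
      ∀ z, ev k V (pairEmb k _ H) (pairEmb k V (R z - q • z)) = 0 := by
  rw [quadPerp, Submodule.mem_comap, Submodule.mem_dualAnnihilator]
  simp only [imRq, LinearMap.mem_range, forall_exists_index, forall_apply_eq_imp_iff, ev_pairEmb]
  rfl

variable (q R) in
/-- The projection from `T(V*)` onto the quadratic dual. -/
def symDualMk : TensorAlgebra k (Module.Dual k V) →ₐ[k] SymDual q R :=
  RingQuot.mkAlgHom k (quadRel (quadPerp (imRq q R)))

theorem symDualMk_surjective : Function.Surjective (symDualMk q R) :=
  RingQuot.mkAlgHom_surjective k _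

theorem symDualMk_pairEmb {H : Module.Dual k V ⊗[k] Module.Dual k V}
    (hH : H ∈ quadPerp (imRq q R)) : symDualMk q R (pairEmb k _ H) = 0 := by
  rw [← map_zero (symDualMk q R)]
  exact RingQuot.mkAlgHom_rel k ⟨rfl, H, hH, rfl⟩

theorem component_eq_map (j : ℕ) : QuadAlg.component (quadPerp (imRq q R)) j =
    (tensorPow k (Module.Dual k V) j).map (symDualMk q R).toLinearMap := by
  rw [QuadAlg.component, QuadAlg.ι, LinearMap.range_comp, tensorPow, Submodule.map_pow]
  rfl

/-- The algebra homomorphisms from the quadratic dual. -/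
def symDualLift {A : Type*} [Semiring A] [Algebra k A] (f : TensorAlgebra k (Module.Dual k V) →ₐ[k] A)
    (hf : ∀ H ∈ quadPerp (imRq q R), f (pairEmb k _ H) = 0) : SymDual q R →ₐ[k] A :=
  RingQuot.liftAlgHom k ⟨f, by
    rintro x y ⟨rfl, H, hH, rfl⟩
    rw [map_zero]
    exact hf H hH⟩

theorem symDualLift_mk {A : Type*} [Semiring A] [Algebra k A]
    (f : TensorAlgebra k (Module.Dual k V) →ₐ[k] A)
    (hf : ∀ H ∈ quadPerp (imRq q R), f (pairEmb k _ H) = 0)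
    (F : TensorAlgebra k (Module.Dual k V)) :
    symDualLift f hf (symDualMk q R F) = f F :=
  RingQuot.liftAlgHom_mkAlgHom_apply _ _ _ _

/-! ### The action on skew tensors -/

/-- A skew tensor with at least two letters lies in Im(R − q) ⊗ T(V), and the relations of the
quadratic dual annihilate the first factor. -/
theorem ctrL_pairEmb_of_mem_Upsilon {H : Module.Dual k V ⊗[k] Module.Dual k V}
    (hH : H ∈ quadPerp (imRq q R)) {m : ℕ} {x : TensorAlgebra k V} (hx : x ∈ Upsilon q R m) :
    ctrL k V (pairEmb k _ H) x = 0 := by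
  rcases Nat.lt_or_ge m 2 with hm | hm
  · have hx := mem_tensorPow_of_mem_Upsilon hx
    clear hH
    induction H using TensorProduct.induction_on with
    | zero => simp
    | tmul f g =>
      rw [pairEmb_tmul, ctrL_mul, Module.End.mul_apply, ctrL_ι, ctrL_ι]
      rcases m with _ | m
      · obtain ⟨c, rfl⟩ := tensorPow_zero_iff.1 hx
        simp
      · obtain rfl : m = 0 := by omega
        obtain ⟨v, rfl⟩ := tensorPow_one_iff.1 hx
        simp
    | add x y hx hy => simp only [map_add, LinearMap.add_apply, hx, hy, add_zero]
  · obtain ⟨l, rfl⟩ := Nat.exists_eq_add_of_le hm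
    obtain ⟨y, hy, rfl⟩ := mem_imGen.1 ((mem_Upsilon.1 hx).2 0 (by omega))
    refine tensorPow_add_induction
      (P := fun y => ctrL k V (pairEmb k _ H) (gen R 0 y - q • y) = 0)
      (fun y hy w _ => ?_) (fun x y hx hy => ?_) hy
    · obtain ⟨z, rfl⟩ := exists_pairEmb hy
      rw [gen_zero_pairEmb, ← smul_mul_assoc, ← sub_mul, ← map_smul, ← map_sub,
        ctrL_mul_eq_smul (pairEmb_mem H) (pairEmb_mem _), mem_quadPerp.1 hH, zero_smul]
    · rw [map_add, smul_add, add_sub_add_comm, map_add, hx, hy, add_zero]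

variable (q R) in
/-- The sum of all `Υ^{(m)}` in `T(V)`. -/
def upsilonSum : Submodule k (TensorAlgebra k V) := ⨆ m, Upsilon q R m

theorem conL_mem_upsilonSum (f : Module.Dual k V) :
    ∀ x ∈ upsilonSum q R, conL f x ∈ upsilonSum q R := by
  change upsilonSum q R ≤ (upsilonSum q R).comap (conL f)
  refine iSup_le fun m x hx => ?_
  rw [Submodule.mem_comap]
  rcases m with _ | m
  · obtain ⟨c, rfl⟩ := tensorPow_zero_iff.1 (mem_tensorPow_of_mem_Upsilon hx)
    simp
  · exact Submodule.mem_iSup_of_mem m (conL_mem_Upsilon f hx)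

variable (q R) in
/-- The action of `T(V*)` on the sum of all `Υ^{(m)}` by contractions. -/
def upsilonAction : TensorAlgebra k (Module.Dual k V) →ₐ[k]
    (Module.End k (upsilonSum q R))ᵐᵒᵖ :=
  TensorAlgebra.lift k ((MulOpposite.opLinearEquiv k).toLinearMap ∘ₗ
    ({ toFun := fun f => (conL f).restrict (conL_mem_upsilonSum f)
       map_add' := fun f g => by ext x; simp [conL_add]
       map_smul' := fun c f => by ext x; simp [conL_smul] } :
      Module.Dual k V →ₗ[k] Module.End k (upsilonSum q R)))

theorem coe_upsilonAction (F : TensorAlgebra k (Module.Dual k V)) (x : upsilonSum q R) :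
    ((upsilonAction q R F).unop x : TensorAlgebra k V) = ctrL k V F x := by
  induction F using TensorAlgebra.induction generalizing x with
  | algebraMap r => simp [Algebra.algebraMap_eq_smul_one]
  | ι g => simp [upsilonAction]
  | mul a b ha hb =>
    rw [map_mul, MulOpposite.unop_mul, Module.End.mul_apply, hb, ha, ctrL_mul,
      Module.End.mul_apply]
  | add a b ha hb =>
    rw [map_add, MulOpposite.unop_add, LinearMap.add_apply, Submodule.coe_add, ha, hb, map_add,
      LinearMap.add_apply]

theorem upsilonAction_pairEmb (H : Module.Dual k V ⊗[k] Module.Dual k V)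
    (hH : H ∈ quadPerp (imRq q R)) : upsilonAction q R (pairEmb k _ H) = 0 := by
  apply MulOpposite.unop_injective
  ext x
  rw [coe_upsilonAction]
  have : upsilonSum q R ≤ LinearMap.ker (ctrL k V (pairEmb k _ H)) :=
    iSup_le fun m x hx => ctrL_pairEmb_of_mem_Upsilon hH hx
  simpa using this x.2

/-- Contraction of skew tensors factors through the quadratic dual, because relations act by zero on
a space stable under all contractions. In particular elements of the quadratic dual can be paired
with `t`. -/
theorem ctrL_eq_of_symDualMk_eq {F G : TensorAlgebra k (Module.Dual k V)}
    (h : symDualMk q R F = symDualMk q R G) {m : ℕ} {x : TensorAlgebra k V}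
    (hx : x ∈ Upsilon q R m) : ctrL k V F x = ctrL k V G x := by
  have hu : ∀ H ∈ quadPerp (imRq q R), upsilonAction q R (pairEmb k _ H) = 0 :=
    fun H hH => upsilonAction_pairEmb H hH
  have h1 : upsilonAction q R F = upsilonAction q R G := by
    rw [← symDualLift_mk (upsilonAction q R) hu F, h, symDualLift_mk]
  have hx' : x ∈ upsilonSum q R := Submodule.mem_iSup_of_mem m hx
  have h2 := coe_upsilonAction F ⟨x, hx'⟩
  rw [h1, coe_upsilonAction] at h2
  exact h2.symm

/-! ### The components of the quadratic dual -/

theorem quadPerp_map {χ : V ≃ₗ[k] V} (hχ : χ ∈ commutingGL R)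
    (H : Module.Dual k V ⊗[k] Module.Dual k V) (hH : H ∈ quadPerp (imRq q R)) :
    ((symDualMk q R).comp (tmap χ.toLinearMap.dualMap)) (pairEmb k _ H) = 0 := by
  rw [AlgHom.comp_apply, tmap_pairEmb]
  refine symDualMk_pairEmb (mem_quadPerp.2 fun z => ?_)
  have := LinearMap.congr_fun (mem_commutingGL.1 hχ) z
  simp only [LinearMap.comp_apply] at this
  rw [← tmap_pairEmb, ← ev_tmap, tmap_pairEmb, map_sub, map_smul, this]
  exact mem_quadPerp.1 hH _

/-- The automorphism of the quadratic dual induced by the dual of an element of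
`commutingGL R`. -/
def symDualEquiv {χ : V ≃ₗ[k] V} (hχ : χ ∈ commutingGL R) : SymDual q R ≃ₐ[k] SymDual q R :=
  AlgEquiv.ofAlgHom (symDualLift _ (quadPerp_map hχ))
    (symDualLift _ (quadPerp_map (symm_mem_commutingGL hχ)))
    (by
      refine AlgHom.ext fun x => ?_
      obtain ⟨F, rfl⟩ := symDualMk_surjective x
      rw [AlgHom.comp_apply, symDualLift_mk, AlgHom.comp_apply, symDualLift_mk, AlgHom.comp_apply,
        tmap_dualMap_symm]
      rfl)
    (by
      refine AlgHom.ext fun x => ?_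
      obtain ⟨F, rfl⟩ := symDualMk_surjective x
      rw [AlgHom.comp_apply, symDualLift_mk, AlgHom.comp_apply, symDualLift_mk, AlgHom.comp_apply]
      exact congrArg _ (tmap_dualMap_symm χ.symm F))

theorem symDualEquiv_mk {χ : V ≃ₗ[k] V} (hχ : χ ∈ commutingGL R)
    (F : TensorAlgebra k (Module.Dual k V)) :
    symDualEquiv (q := q) hχ (symDualMk q R F) = symDualMk q R (tmap χ.toLinearMap.dualMap F) :=
  symDualLift_mk _ _ _

variable [FiniteDimensional k V]

/-- A functional vanishing on Im(R − q) ⊗ V^⊗m belongs to Im(R − q)^⊥ ⊗ (V*)^⊗m; the trailing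
letters are stripped one by one with a dual basis. -/
theorem symDualMk_eq_zero_of_ev_imGen {m : ℕ} {F : TensorAlgebra k (Module.Dual k V)}
    (hF : F ∈ tensorPow k (Module.Dual k V) (m + 2))
    (h : ∀ z, ∀ w ∈ tensorPow k V m, ev k V F (pairEmb k V (R z - q • z) * w) = 0) :
    symDualMk q R F = 0 := by
  induction m generalizing F with
  | zero =>
    obtain ⟨H, rfl⟩ := exists_pairEmb hF
    refine symDualMk_pairEmb (mem_quadPerp.2 fun z => ?_)
    have := h z 1 one_mem_tensorPow
    rwa [mul_one] at this
  | succ m ih =>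
    rw [add_right_comm] at hF
    rw [← sum_conR_mul_ι (Module.finBasis k V).dualBasis hF, map_sum]
    refine Finset.sum_eq_zero fun i _ => ?_
    rw [map_mul, dualBasis_coord, ih (conR_mem _ hF) fun z w hw => ?_, zero_mul]
    rw [ev_conR_eval _ hF, mul_assoc]
    exact h z _ (mul_mem_tensorPow hw (ι_mem_tensorPow _))

/-- Υ^(m+2) contains, and therefore equals, the intersection of V ⊗ Υ^(m+1) with the image of T_0 −
q. So its annihilator is a sum of two: functionals killing the former die in the quadratic dual by
induction, and those killing the latter are combinations of relations in the first two letters. -/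
theorem symDualMk_eq_zero {m : ℕ} {F : TensorAlgebra k (Module.Dual k V)}
    (hF : F ∈ tensorPow k (Module.Dual k V) m) (h : ∀ x ∈ Upsilon q R m, ev k V F x = 0) :
    symDualMk q R F = 0 := by
  induction m generalizing F with
  | zero =>
    rw [eq_zero_of_forall_ev_apply_eq_zero hF fun x hx => h x (mem_Upsilon_zero.2 hx), map_zero]
  | succ m ih =>
    rcases m with _ | m
    · rw [eq_zero_of_forall_ev_apply_eq_zero hF fun x hx => h x (mem_Upsilon_one.2 hx), map_zero]
    let A : Submodule k (TensorAlgebra k V) := tensorPow k V 1 * Upsilon q R (m + 1)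
    let B : Submodule k (TensorAlgebra k V) := imGen q R (m + 2) 0
    have hAB : A ⊓ B ≤ Upsilon q R (m + 2) := by
      rintro x ⟨hA, hB⟩
      have hA1 : ∀ i, i + 1 < m + 1 → x ∈ imGen q R (1 + (m + 1)) (1 + i) := fun i hi => by
        refine Submodule.mul_induction_on hA (fun v hv y hy => ?_) fun x y hx hy => add_mem hx hy
        exact mul_left_mem_imGen ((mem_Upsilon.1 hy).2 i hi) hv
      have hA2 : x ∈ tensorPow k V (1 + (m + 1)) := by
        refine Submodule.mul_induction_on hA (fun v hv y hy => ?_) fun x y hx hy => add_mem hx hy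
        exact mul_mem_tensorPow hv (mem_tensorPow_of_mem_Upsilon hy)
      rw [add_comm 1] at hA2
      refine mem_Upsilon.2 ⟨hA2, fun i hi => ?_⟩
      rcases i with _ | i
      · exact hB
      · have := hA1 i (by omega)
        rwa [add_comm 1, add_comm 1] at this
    have hF' : ev k V F ∈ (A ⊓ B).dualAnnihilator :=
      (Submodule.mem_dualAnnihilator _).2 fun x hx => h x (hAB hx)
    -- The summands `α` and `β` are functionals on all of T(V); only the degree `m + 2` part of `α`
    -- is realized by a tensor `F₁`, and the remainder `F - F₁` then represents `β` in that degree.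
    rw [Subspace.dualAnnihilator_inf_eq, Submodule.mem_sup] at hF'
    obtain ⟨α, hα, β, hβ, hαβ⟩ := hF'
    rw [Submodule.mem_dualAnnihilator] at hα hβ
    obtain ⟨F₁, hF₁, hF₁'⟩ := exists_ev_eq (m + 2) α
    have h1 : symDualMk q R F₁ = 0 := by
      rw [← sum_ι_mul_conL (Module.finBasis k V).dualBasis hF₁, map_sum]
      refine Finset.sum_eq_zero fun i _ => ?_
      rw [map_mul, dualBasis_coord, ih (conL_mem _ hF₁) fun x hx => ?_, mul_zero]
      rw [ev_conL_eval _ hF₁, hF₁' _ (ι_mul_mem_tensorPow _ (mem_tensorPow_of_mem_Upsilon hx))]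
      exact hα _ (Submodule.mul_mem_mul (ι_mem_tensorPow _) hx)
    have h2 : symDualMk q R (F - F₁) = 0 := by
      refine symDualMk_eq_zero_of_ev_imGen (sub_mem hF hF₁) fun z w hw => ?_
      have hz : ∀ z : V ⊗[k] V, pairEmb k V z * w ∈ tensorPow k V (m + 2) := fun z => by
        rw [add_comm]
        exact mul_mem_tensorPow (pairEmb_mem z) hw
      rw [map_sub, LinearMap.sub_apply, hF₁' _ (hz _), ← hαβ, LinearMap.add_apply,
        add_sub_cancel_left]
      refine hβ _ (mem_imGen.2 ⟨pairEmb k V z * w, hz _, ?_⟩)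
      rw [gen_zero_pairEmb, map_sub, map_smul, sub_mul, smul_mul_assoc]
    rw [← sub_add_cancel F F₁, map_add, h1, h2, add_zero]

/-- In top degree everything is tested on `t`, where GF and (ψ*F)G agree because t ⌞ F = (ψ*F) ⌟ t.
Conversely, the twist for a single functional f forces t ⌞ f = (f ∘ χ) ⌟ t, and left contraction is
injective. -/
theorem IsVolume.isPsi_iff (h : IsVolume q R n t) {θ ψ : V ≃ₗ[k] V}
    (hθ : ∀ v, cycle (gen R) 0 n (ιT v * t) = t * ιT (θ v))
    (hψ : ∀ f : Module.Dual k V, conR f t = conL (f ∘ₗ ψ.toLinearMap) t)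
    (hψR : ψ ∈ commutingGL R) (χ : V →ₗ[k] V) :
    IsPsi q R n χ ↔ χ = ψ.toLinearMap := by
  constructor
  · rintro ⟨ν, hν, hχ⟩
    obtain ⟨l, rfl⟩ := Nat.exists_eq_succ_of_ne_zero h.pos.ne'
    have key : ∀ f : Module.Dual k V, f ∘ₗ χ = f ∘ₗ ψ.toLinearMap := by
      intro f
      refine h.conL_injective hθ ?_
      rw [← hψ]
      refine eq_of_forall_ev_eq (conL_mem _ h.mem_tensorPow) (conR_mem _ h.mem_tensorPow)
        fun G hG => ?_
      have h1 := hν.twist 1 l (add_comm _ _) (symDualMk q R (ιT f))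
        (by rw [component_eq_map]; exact Submodule.mem_map_of_mem (ι_mem_tensorPow f))
        (symDualMk q R G) (by rw [component_eq_map]; exact Submodule.mem_map_of_mem hG)
      have h2 : ν (symDualMk q R (ιT f)) = symDualMk q R (ιT (f ∘ₗ χ)) := hχ f
      rw [h2, ← map_mul, ← map_mul] at h1
      have h3 := congrArg TensorAlgebra.algebraMapInv (ctrL_eq_of_symDualMk_eq h1 h.mem)
      rw [← ev_apply, ← ev_apply, ev_mul_right, ev_mul_left, ctrR_ι, ctrL_ι] at h3
      exact h3.symm
    ext v
    refine sub_eq_zero.1 ((Module.forall_dual_apply_eq_zero_iff k _).1 fun f => ?_)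
    rw [map_sub, sub_eq_zero]
    exact LinearMap.congr_fun (key f) v
  · rintro rfl
    refine ⟨symDualEquiv hψR, ⟨?_, ?_, ?_, ?_⟩, fun f => ?_⟩
    · intro h0
      obtain ⟨F, hF, hF1⟩ := h.exists_ev_eq_one
      have h1 : symDualMk q R F ∈ QuadAlg.component (quadPerp (imRq q R)) n := by
        rw [component_eq_map]
        exact Submodule.mem_map_of_mem hF
      rw [h0, Submodule.mem_bot, ← map_zero (symDualMk q R)] at h1
      have h2 := congrArg TensorAlgebra.algebraMapInv (ctrL_eq_of_symDualMk_eq h1 h.mem)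
      rw [← ev_apply, hF1] at h2
      simp at h2
    · intro m hm
      rw [component_eq_map, Submodule.eq_bot_iff]
      rintro _ ⟨F, hF, rfl⟩
      refine symDualMk_eq_zero hF fun x hx => ?_
      rw [h.above m hm, Submodule.mem_bot] at hx
      rw [hx, map_zero]
    · intro j a ha
      rw [component_eq_map] at ha ⊢
      obtain ⟨F, hF, rfl⟩ := ha
      rw [AlgHom.toLinearMap_apply, symDualEquiv_mk]
      exact Submodule.mem_map_of_mem (tmap_mem _ hF)
    · intro i j hij a ha b hb
      rw [component_eq_map] at ha hb
      obtain ⟨F, hF, rfl⟩ := ha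
      obtain ⟨G, hG, rfl⟩ := hb
      rw [AlgHom.toLinearMap_apply, AlgHom.toLinearMap_apply, symDualEquiv_mk, ← map_mul,
        ← map_mul, ← sub_eq_zero, ← map_sub]
      have hF' := tmap_mem ψ.toLinearMap.dualMap hF
      refine symDualMk_eq_zero (m := n) (sub_mem ?_ ?_) fun x hx => ?_
      · rw [← hij, add_comm]
        exact mul_mem_tensorPow hG hF
      · rw [← hij]
        exact mul_mem_tensorPow hF' hG
      · obtain ⟨c, rfl⟩ := h.span x hx
        rw [map_smul, map_sub, LinearMap.sub_apply, ev_mul_right, ctrR_eq_ctrL_tmap hψ,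
          ← ev_mul_left, sub_self, smul_zero]
    · exact symDualEquiv_mk hψR (ιT f) |>.trans (by rw [tmap_ι]; rfl)

end QuadraticDual

end HeckeSym

/-! ### The main theorem -/

theorem theorem3p8 {k : Type*} [Field k] {V : Type*} [AddCommGroup V] [Module k V]
    [FiniteDimensional k V] (q : k) (R : V ⊗[k] V →ₗ[k] V ⊗[k] V)
    (hR : HeckeSym.IsHeckeSymmetry q R) (n : ℕ) (hn : 0 < n)
    (hdim : Module.finrank k (HeckeSym.Upsilon q R n) = 1)
    (htop : HeckeSym.Upsilon q R (n + 1) = ⊥)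
    (t : TensorAlgebra k V) (ht : t ∈ HeckeSym.Upsilon q R n) (ht0 : t ≠ 0) :
    ∃ φ ψ θ : V ≃ₗ[k] V,
      (∀ χ : V →ₗ[k] V, HeckeSym.IsPhi q R n χ ↔ χ = φ.toLinearMap) ∧
      (∀ χ : V →ₗ[k] V, HeckeSym.IsPsi q R n χ ↔ χ = ψ.toLinearMap) ∧
      (∀ χ : V →ₗ[k] V, HeckeSym.IsTheta R n t χ ↔ χ = θ.toLinearMap) ∧
      φ * ψ = ψ * φ ∧ φ * θ = θ * φ ∧ ψ * θ = θ * ψ ∧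
      (ψ.toLinearMap : V →ₗ[k] V) =
        q ^ (-(n : ℤ) - 1) • (φ.toLinearMap ∘ₗ θ.toLinearMap ∘ₗ θ.toLinearMap) ∧
      φ ∈ HeckeSym.commutingGL R ∧ ψ ∈ HeckeSym.commutingGL R ∧
      θ ∈ HeckeSym.commutingGL R := by
  have hspan : ∀ x ∈ HeckeSym.Upsilon q R n, ∃ c : k, x = c • t := by
    intro x hx
    obtain ⟨c, hc⟩ := exists_smul_eq_of_finrank_eq_one hdim (x := ⟨t, ht⟩)
      (fun h0 => ht0 (congrArg Subtype.val h0)) ⟨x, hx⟩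
    exact ⟨c, (congrArg Subtype.val hc).symm⟩
  have h : HeckeSym.IsVolume q R n t :=
    ⟨hR, hn, ht, ht0, hspan, fun m hm => HeckeSym.Upsilon_eq_bot_of_lt htop hm⟩
  obtain ⟨θ, hθ⟩ := h.exists_theta
  obtain ⟨ψ, hψ⟩ := h.exists_psi hθ
  have hθR : θ ∈ HeckeSym.commutingGL R := h.theta_comm hθ
  have hφR := h.phi_comm hθ hψ
  have hc : ψ * θ = θ * ψ := h.psi_comp_theta hθ hψ
  have hq := pow_ne_zero (n + 1) hR.q_ne_zero
  set s : V ≃ₗ[k] V := LinearEquiv.smulOfNeZero k V (q ^ (n + 1)) hq with hs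
  have hsc : ∀ χ : V ≃ₗ[k] V, Commute s χ := fun χ =>
    LinearEquiv.ext fun v => (map_smul χ (q ^ (n + 1)) v).symm
  set φ := HeckeSym.nakayamaPhi h.hecke.q_ne_zero n θ ψ with hφ
  have hφ' : φ = θ⁻¹ * ψ * (s * θ⁻¹) := rfl
  have hψφ : s * ψ = φ * θ * θ := by
    have hc' : Commute ψ θ⁻¹ := (show Commute ψ θ from hc).inv_right
    rw [hφ', ← hc'.eq, (hsc θ⁻¹).eq, (hsc ψ).eq]
    simp only [mul_assoc]
    rw [((hsc θ).mul_right (hsc θ)).eq]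
    simp only [mul_assoc, inv_mul_cancel_left]
  -- For ψ the compatibility with `R` is deduced from that of φ and θ through the identity `hψφ`.
  have hψR : ψ ∈ HeckeSym.commutingGL R := by
    have : ψ = s⁻¹ * (φ * θ * θ) := by rw [← hψφ, inv_mul_cancel_left]
    rw [this]
    exact mul_mem (inv_mem (HeckeSym.smulOfNeZero_mem_commutingGL hq))
      (mul_mem (mul_mem hφR hθR) hθR)
  have c1 : Commute ψ θ⁻¹ := (show Commute ψ θ from hc).inv_right
  have c2 : Commute θ θ⁻¹ := (Commute.refl θ).inv_right
  refine ⟨φ, ψ, θ, h.isPhi_iff hθ hψ, h.isPsi_iff hθ hψ hψR, h.isTheta_iff hθ, ?_, ?_, hc, ?_,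
    hφR, hψR, hθR⟩
  · exact ((c1.mul_right (Commute.refl ψ)).mul_right ((hsc ψ).symm.mul_right c1)).symm.eq
  · exact ((c2.mul_right hc.symm).mul_right ((hsc θ).symm.mul_right c2)).symm.eq
  · ext v
    have h1 : q ^ (n + 1) • ψ v = φ (θ (θ v)) := LinearEquiv.congr_fun hψφ v
    have h2 : q ^ (-(n : ℤ) - 1) = (q ^ (n + 1))⁻¹ := by
      rw [← zpow_natCast, ← zpow_neg]
      congr 1
      push_cast
      ring
    rw [h2]
    simp only [LinearMap.smul_apply, LinearMap.comp_apply, LinearEquiv.coe_coe]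
    rw [← h1, inv_smul_smul₀ hq]
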